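/- An $(n,m)$-multigraph has vertices $1,\dots,n$ and $m$ labelled oriented edges, with loops and multiple edges allowed (so it is a sequence of $m$ ordered pairs of vertices); the degree of a vertex is the number of half-edges attached to it. Let $\delta=(\delta_d)_{d\ge 0}$ be nonnegative reals such that $\Delta(x)=\sum_{d\ge 0}\delta_d x^d/d!$ has a positive radius of convergence. A random $(n,m,\Delta)$-multigraph is an $(n,m)$-multigraph $G$ chosen with probability proportional to $\prod_{v}\delta_{\deg(v)}$. For a tree $T$, let $G[T]$ be the number of subgraphs of $G$ (pairs of a vertex set and an edge set) isomorphic to $T$, where labels and orientations of edges are disregarded. Put $\mu(j)=\min\{d\ge j:\delta_d>0\}$ and $\gamma_\Delta(T)=\sum_{v\in V(T)}\mu(\deg_T(v))$. **Theorem.** Let $T$ be a tree with $k$ vertices such that $\mu(\deg_T(v))$ exists for every vertex $v$ of $T$. Let $m=m(n)\to\infty$ with $m=\Theta(n\epsilon_n)$, where $\epsilon_n>0$ and $\epsilon_n\to 0$. Let $\chi=\chi(n)$ be, for all large $n$, the positive solution, inside the disc of convergence of $\Delta$, of $\chi\Delta'(\chi)/\Delta(\chi)=2m/n$, and suppose that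 for every $0<a<\pi$ $$\int_{-\pi}^{\pi}\frac{\Delta(\chi e^{i\theta})^n}{e^{2mi\theta}}\,d\theta\;\sim\;\int_{-a}^{a}\frac{\Delta(\chi e^{i\theta})^n}{e^{2mi\theta}}\,d\theta\qquad(n\to\infty).$$ Let $G$ be a random $(n,m,\Delta)$-multigraph. Then $$\mathbb{E}(G[T])=\Theta\left(n\,\epsilon_n^{-(k-1)+\gamma_\Delta(T)/\mu(1)}\right).$$ Moreover, if $k\ge 2$ and $\epsilon_n=o(n^{\lambda})$ with $\lambda=\dfrac{\mu(1)}{(k-1)\mu(1)-\gamma_\Delta(T)}$, then $\mathbb{P}(G[T]=0)\to 1$ as $n\to\infty$. -/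

import Mathlib

open Filter Topology Asymptotics
open scoped Nat

noncomputable section

namespace DegreeWeighted

/-- Multigraphs with vertices labelled by `Fin n` and `m` labelled, oriented edges; loops and
multiple edges are allowed.  The edge with label `e` goes from `(G e).1` to `(G e).2`. -/
abbrev Multigraph (n m : ℕ) : Type := Fin m → Fin n × Fin n

variable {n m : ℕ}

/-- The degree of a vertex: the number of half-edges attached to it (a loop counts twice). -/
def Multigraph.deg (G : Multigraph n m) (v : Fin n) : ℕ :=
  (Finset.univ.filter fun e => (G e).1 = v).card + (Finset.univ.filter fun e => (G e).2 = v).card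

/-- A set `A` of vertices and a set `S` of edges of `G` form a subgraph of `G`. -/
def Multigraph.IsSubgraph (G : Multigraph n m) (A : Finset (Fin n)) (S : Finset (Fin m)) : Prop :=
  ∀ e ∈ S, (G e).1 ∈ A ∧ (G e).2 ∈ A

/-- The subgraph of `G` with vertex set `A` and edge set `S` is isomorphic to the graph `T`:
a bijection of the vertices induces a bijection of the edges (labels and orientations of the
edges of `G` play no role). -/
def Multigraph.IsoOn (G : Multigraph n m) {V : Type*} (T : SimpleGraph V)
    (A : Finset (Fin n)) (S : Finset (Fin m)) : Prop :=
  ∃ (α : V ≃ A) (β : T.edgeSet ≃ S), ∀ e : T.edgeSet,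
    Sym2.map (fun v => (α v : Fin n)) (e : Sym2 V) = s((G (β e)).1, (G (β e)).2)

/-- The number of subgraphs of `G` that are isomorphic to `T`. -/
def Multigraph.copies (G : Multigraph n m) {V : Type*} (T : SimpleGraph V) : ℕ :=
  Set.ncard {F : Finset (Fin n) × Finset (Fin m) | G.IsSubgraph F.1 F.2 ∧ G.IsoOn T F.1 F.2}

/-- The weight of `G`: every vertex of degree `d` contributes a factor `δ d`. -/
def Multigraph.weight (δ : ℕ → ℝ) (G : Multigraph n m) : ℝ := ∏ v, δ (G.deg v)

/-- The total weight of all multigraphs with `n` vertices and `m` edges. -/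
def totalWeight (δ : ℕ → ℝ) (n m : ℕ) : ℝ := ∑ G : Multigraph n m, G.weight δ

/-- The probability that the random weighted multigraph with `n` vertices and `m` edges is `G`. -/
def prob (δ : ℕ → ℝ) (G : Multigraph n m) : ℝ := G.weight δ / totalWeight δ n m

/-- The expected number of copies of `T` in the random weighted multigraph. -/
def expectedCopies (δ : ℕ → ℝ) (n m : ℕ) {V : Type*} (T : SimpleGraph V) : ℝ :=
  ∑ G : Multigraph n m, prob δ G * (G.copies T : ℝ)

open Classical in
/-- The probability that the random weighted multigraph contains no copy of `T`. -/
def probNoCopy (δ : ℕ → ℝ) (n m : ℕ) {V : Type*} (T : SimpleGraph V) : ℝ :=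
  ∑ G ∈ (Finset.univ : Finset (Multigraph n m)).filter (fun G => G.copies T = 0), prob δ G

/-- The generating function `Δ(x) = ∑ δ_d x^d / d!` of the weights, for real `x`. -/
def genFun (δ : ℕ → ℝ) (x : ℝ) : ℝ := ∑' d : ℕ, δ d * x ^ d / (d ! : ℝ)

/-- The generating function `Δ(x) = ∑ δ_d x^d / d!` of the weights, for complex `x`. -/
def genFunC (δ : ℕ → ℝ) (x : ℂ) : ℂ := ∑' d : ℕ, (δ d : ℂ) * x ^ d / (d ! : ℂ)

/-- `χ` is the positive solution of `χ Δ'(χ) / Δ(χ) = 2 m / n` inside the disc of convergence. -/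
def IsSaddlePoint (δ : ℕ → ℝ) (n m : ℕ) (χ : ℝ) : Prop :=
  0 < χ ∧ (∃ r : ℝ, χ < r ∧ Summable fun d : ℕ => δ d * r ^ d / (d ! : ℝ)) ∧
    χ * deriv (genFun δ) χ / genFun δ χ = 2 * (m : ℝ) / (n : ℝ)

/-- The part with argument in `[-a, a]` of the integral of `Δ(x)^n / x^(2m)` over the circle of
radius `χ`, up to normalisation. -/
def arcIntegral (δ : ℕ → ℝ) (n m : ℕ) (χ a : ℝ) : ℂ :=
  ∫ θ in (-a)..a, genFunC δ ((χ : ℂ) * Complex.exp ((θ : ℂ) * Complex.I)) ^ n /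
    Complex.exp (2 * (m : ℂ) * (θ : ℂ) * Complex.I)

/-- The full circle integral is asymptotically equal to the integral over the arc `[-a, a]`,
for every `0 < a < π`. -/
def CentralArcDominates (δ : ℕ → ℝ) (m : ℕ → ℕ) (χ : ℕ → ℝ) : Prop :=
  ∀ a : ℝ, 0 < a → a < Real.pi →
    (fun n => arcIntegral δ n (m n) (χ n) Real.pi) ~[atTop]
      (fun n => arcIntegral δ n (m n) (χ n) a)

/-- `μ(j)`: the smallest allowed degree that is at least `j`. -/
def mu (δ : ℕ → ℝ) (j : ℕ) : ℕ := sInf {d | j ≤ d ∧ 0 < δ d}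

/-- `γ_Δ(T)`: the sum of `μ(deg v)` over the vertices `v` of `T`. -/
def gammaTree (δ : ℕ → ℝ) {V : Type*} [Fintype V] (T : SimpleGraph V) [DecidableRel T.Adj] : ℕ :=
  ∑ v, mu δ (T.degree v)

end DegreeWeighted

end

/-! Counting half-edges vertex by vertex, the total weight is `(2m)! [x^(2m)] Δ^n`. If a copy of `T`
with `e = k - 1` edges is prescribed, the remaining weight is `(2(m-e))! [x^(2(m-e))] Δ^(n-k) ∏_u
Δ^(deg u)`, the exponents in the product denoting derivatives, whatever the position, edge labels
and orientations of the copy. There are `Θ(n^k m^e)` prescriptions and the factorials contribute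
`Θ(m^(-2e))`, so `E(G[T])` is of order `n^k m^(-e)` times a ratio of coefficients. The whole problem
is to show that this ratio is `Θ(χ^γ)` (`SparseData.exists_ratio_bounds`). Comparing the mean degree
with its term of degree `μ(1)` gives `χ^μ(1) = Θ(m/n) = Θ(ε)`, and the formula follows. The second
claim is the first moment method.

For the ratio, tilt the weights by `χ`: the series `law δ χ` is a probability law `p` with mean
`2m/n`, and `[x^s] Δ^N · χ^s` is `Δ(χ)^N` times the probability that `N` independent degrees sum to
`s` (`coeff_law_pow`). Such probabilities are `O(1/√m)` uniformly, because masses at `0` and `d =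
μ(1)` already make the characteristic function decay (`SparseFamily.exists_coeffZ_le`). A derivative
`Δ^(c)(χ)` is `O(χ^(μ(c)-c))`, from its lowest term. This settles the upper bound for the numerator.
The denominator is bounded below because the central arc contributes at least order `1/√m`
(`SparseFamily.exists_le_arcOf`) and dominates by assumption.

The delicate point is the lower bound for the numerator. Keeping only the lowest term of each
derivative, it needs a point probability of order `1/√m` at `2m - γ`, a bounded distance from the
centre (`SparseFamily.exists_le_coeffZ_shift`). Lattice obstructions must be excluded, and values
`t` with bounded `n p_t` may or may not matter; passing to an ultrafilter decides for every `t`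
whether `n p_t` stays away from zero. Let `H` be the subgroup generated by those `t`. Inside `H` one
can walk from the centre: a second moment argument gives steps `+t` (`coeffZ_pow_step`), slow
variation gives steps `-d`, and together they give `-t`. An offset `r` outside `H` is impossible:
the mass outside `H` is `o(1/n)`, so the sum of `n` degrees is essentially confined to `H`, and the
probabilities at `2m ± r` are negligible. But domination of every arc, integrated by parts, forces
their sum to be twice the central probability up to `o(1/√m)` (`SparseFamily.abs_symm_le`). -/

namespace DegreeWeighted

/-! ### Power series with integer-indexed coefficients -/

/-- The coefficient of a power series at an integer index, zero for negative indices. -/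
noncomputable def coeffZ (A : PowerSeries ℝ) (s : ℤ) : ℝ :=
  if 0 ≤ s then PowerSeries.coeff s.toNat A else 0

lemma coeffZ_natCast (A : PowerSeries ℝ) (s : ℕ) : coeffZ A (s : ℤ) = PowerSeries.coeff s A := by
  simp [coeffZ]

lemma coeffZ_sum {ι : Type*} (t : Finset ι) (A : ι → PowerSeries ℝ) (s : ℤ) :
    coeffZ (∑ i ∈ t, A i) s = ∑ i ∈ t, coeffZ (A i) s := by
  unfold coeffZ
  split_ifs <;> simp

lemma coeffZ_C_mul (c : ℝ) (A : PowerSeries ℝ) (s : ℤ) :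
    coeffZ (PowerSeries.C c * A) s = c * coeffZ A s := by
  unfold coeffZ
  split_ifs <;> simp

lemma coeffZ_X_pow_mul (A : PowerSeries ℝ) (t : ℕ) (s : ℤ) :
    coeffZ (PowerSeries.X ^ t * A) (s + t) = coeffZ A s := by
  unfold coeffZ
  by_cases h : 0 ≤ s
  · obtain ⟨k, rfl⟩ := Int.eq_ofNat_of_zero_le h
    have : ((k : ℤ) + t).toNat = k + t := by omega
    rw [if_pos (by omega), if_pos h, this, PowerSeries.coeff_X_pow_mul]
    simp
  · rw [if_neg h]
    split_ifs with h'
    · rw [PowerSeries.coeff_X_pow_mul', if_neg (by omega)]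
    · rfl

lemma coeff_mul_nonneg {A B : PowerSeries ℝ} (hA : ∀ j, 0 ≤ PowerSeries.coeff j A)
    (hB : ∀ j, 0 ≤ PowerSeries.coeff j B) (j : ℕ) : 0 ≤ PowerSeries.coeff j (A * B) := by
  rw [PowerSeries.coeff_mul]
  exact Finset.sum_nonneg fun p _ => mul_nonneg (hA _) (hB _)

lemma coeff_pow_nonneg {A : PowerSeries ℝ} (hA : ∀ j, 0 ≤ PowerSeries.coeff j A) (N : ℕ) :
    ∀ j, 0 ≤ PowerSeries.coeff j (A ^ N) := by
  induction N with
  | zero =>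
    intro j
    rw [pow_zero, PowerSeries.coeff_one]
    split_ifs <;> norm_num
  | succ N ih =>
    intro j
    rw [pow_succ]
    exact coeff_mul_nonneg ih hA j

lemma coeff_prod_nonneg {ι : Type*} {A : ι → PowerSeries ℝ}
    (hA : ∀ i j, 0 ≤ PowerSeries.coeff j (A i)) (S : Finset ι) :
    ∀ j, 0 ≤ PowerSeries.coeff j (∏ i ∈ S, A i) := by
  classical
  induction S using Finset.induction_on with
  | empty =>
    intro j
    rw [Finset.prod_empty, PowerSeries.coeff_one]
    split_ifs <;> norm_num
  | insert i S hi ih =>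
    intro j
    rw [Finset.prod_insert hi]
    exact coeff_mul_nonneg (hA i) ih j

lemma coeffZ_nonneg {A : PowerSeries ℝ} (hA : ∀ j, 0 ≤ PowerSeries.coeff j A) (s : ℤ) :
    0 ≤ coeffZ A s := by
  unfold coeffZ
  split_ifs
  · exact hA _
  · exact le_rfl

/-- The first factorial moment of the binomial expansion. -/
lemma sum_mul_choose_mul_pow {R : Type*} [CommRing R] (a b : R) (n : ℕ) :
    ∑ j ∈ Finset.range (n + 1), (j : R) * (a ^ j * b ^ (n - j) * (n.choose j : R)) =
      n * (a * (a + b) ^ (n - 1)) := by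
  -- Differentiate the binomial expansion of `(aX + b)^n` and set `X = 1`.
  have h := congrArg (fun p => Polynomial.eval 1 (Polynomial.derivative p))
    (add_pow (Polynomial.C a * Polynomial.X) (Polynomial.C b) n)
  simp only [Polynomial.derivative_pow, Polynomial.derivative_sum, Polynomial.derivative_mul,
    Polynomial.derivative_C, Polynomial.derivative_X, Polynomial.derivative_add,
    Polynomial.derivative_natCast, Polynomial.eval_mul, Polynomial.eval_add, Polynomial.eval_pow,
    Polynomial.eval_finsetSum, Polynomial.eval_C, Polynomial.eval_X, Polynomial.eval_natCast,
    Polynomial.eval_zero, Polynomial.eval_one, mul_pow, one_pow] at h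
  simp only [mul_zero, mul_one, zero_add, add_zero] at h
  rw [show (n : R) * (a * (a + b) ^ (n - 1)) = n * (a + b) ^ (n - 1) * a by ring, h]
  refine Finset.sum_congr rfl fun j _ => ?_
  rcases j with _ | j
  · simp
  · simp only [pow_succ]
    ring

/-- The second factorial moment of the binomial expansion. -/
lemma sum_mul_mul_choose_mul_pow {R : Type*} [CommRing R] (a b : R) (n : ℕ) :
    ∑ j ∈ Finset.range (n + 1), ((j : R) * (j - 1)) * (a ^ j * b ^ (n - j) * (n.choose j : R)) =
      n * (n - 1 : ℕ) * (a ^ 2 * (a + b) ^ (n - 2)) := by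
  rcases n with _ | n
  · simp
  rw [Finset.sum_range_succ']
  have h := sum_mul_choose_mul_pow a b n
  have key : ∀ j ∈ Finset.range (n + 1),
      (((j + 1 : ℕ) : R) * (((j + 1 : ℕ) : R) - 1)) *
        (a ^ (j + 1) * b ^ (n + 1 - (j + 1)) * ((n + 1).choose (j + 1) : R)) =
      ((n + 1 : ℕ) : R) * a * ((j : R) * (a ^ j * b ^ (n - j) * (n.choose j : R))) := by
    intro j _
    have hc : ((n + 1 : ℕ) : R) * (n.choose j : R) =
        ((n + 1).choose (j + 1) : R) * ((j + 1 : ℕ) : R) := by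
      exact_mod_cast congrArg (Nat.cast : ℕ → R) (Nat.add_one_mul_choose_eq n j)
    rw [Nat.add_sub_add_right, pow_succ]
    have : ((j + 1 : ℕ) : R) - 1 = j := by push_cast; ring
    rw [this]
    linear_combination (-(a * j * a ^ j * b ^ (n - j))) * hc
  rw [Finset.sum_congr rfl key, ← Finset.mul_sum, h]
  simp only [Nat.add_sub_cancel, Nat.cast_zero, zero_mul, add_zero]
  rw [show n + 1 - 2 = n - 1 by omega]
  ring

/-- Coefficients of powers cannot drop too much along a step `t` for which `n * p_t` is not
small: the second moment method applied to the number of summands equal to `t`. -/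
lemma coeffZ_pow_step {P : PowerSeries ℝ} (hP : ∀ j, 0 ≤ PowerSeries.coeff j P) (n t : ℕ) (s : ℤ) :
    (n * PowerSeries.coeff t P * coeffZ (P ^ (n - 1)) s) ^ 2 ≤
      coeffZ (P ^ n) (s + t) *
        (n * (n - 1 : ℕ) * PowerSeries.coeff t P ^ 2 * coeffZ (P ^ (n - 2)) (s - t) +
          n * PowerSeries.coeff t P * coeffZ (P ^ (n - 1)) s) := by
  set p := PowerSeries.coeff t P with hp
  set a : PowerSeries ℝ := PowerSeries.C p * PowerSeries.X ^ t with ha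
  set Q : PowerSeries ℝ := P - a with hQ
  have haQ : a + Q = P := by rw [hQ]; ring
  have hpn : 0 ≤ p := hP t
  have hac : ∀ j, PowerSeries.coeff j a = if j = t then p else 0 := by
    intro j
    rw [ha, PowerSeries.coeff_C_mul, PowerSeries.coeff_X_pow]
    split_ifs <;> simp
  have han : ∀ j, 0 ≤ PowerSeries.coeff j a := by
    intro j
    rw [hac]
    split_ifs
    · exact hpn
    · exact le_rfl
  have hQn : ∀ j, 0 ≤ PowerSeries.coeff j Q := by
    intro j
    rw [hQ, map_sub, hac]
    split_ifs with h
    · rw [h, hp, sub_self]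
    · simpa using hP j
  -- With `P = a + Q`, `w j` is the part of the coefficient in which exactly `j` of the `n` summands
  -- equal `t`. Its factorial moments remove one or two such summands, which lowers the index by `t`
  -- or `2t`.
  set w : ℕ → ℝ := fun j => coeffZ (a ^ j * Q ^ (n - j) * (n.choose j : PowerSeries ℝ)) (s + t)
    with hw
  have hcast : ∀ k : ℕ, ((k : ℕ) : PowerSeries ℝ) = PowerSeries.C (k : ℝ) := fun k => by simp
  have hw0 : ∀ j, 0 ≤ w j := by
    intro j
    rw [hw]
    simp only
    rw [hcast, mul_comm, coeffZ_C_mul]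
    exact mul_nonneg (Nat.cast_nonneg _) (coeffZ_nonneg
      (coeff_mul_nonneg (coeff_pow_nonneg han _) (coeff_pow_nonneg hQn _)) _)
  have e0 : ∑ j ∈ Finset.range (n + 1), w j = coeffZ (P ^ n) (s + t) := by
    rw [hw, ← coeffZ_sum, ← add_pow, haQ]
  have e1 : ∑ j ∈ Finset.range (n + 1), (j : ℝ) * w j = n * p * coeffZ (P ^ (n - 1)) s := by
    have h := congrArg (fun A => coeffZ A (s + t)) (sum_mul_choose_mul_pow a Q n)
    simp only [coeffZ_sum, hcast, coeffZ_C_mul, haQ] at h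
    rw [ha, mul_assoc (PowerSeries.C p), coeffZ_C_mul, coeffZ_X_pow_mul] at h
    rw [mul_assoc, ← h]
    refine Finset.sum_congr rfl fun j _ => ?_
    simp only [hw, hcast, ha]
  have e2 : ∑ j ∈ Finset.range (n + 1), ((j : ℝ) * (j - 1)) * w j =
      n * (n - 1 : ℕ) * p ^ 2 * coeffZ (P ^ (n - 2)) (s - t) := by
    have h := congrArg (fun A => coeffZ A (s + t)) (sum_mul_mul_choose_mul_pow a Q n)
    have hcc : ∀ j : ℕ, ((j : PowerSeries ℝ) * ((j : PowerSeries ℝ) - 1)) =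
        PowerSeries.C ((j : ℝ) * (j - 1)) := fun j => by simp
    have hcd : (n : PowerSeries ℝ) * ((n - 1 : ℕ) : PowerSeries ℝ) =
        PowerSeries.C ((n : ℝ) * (n - 1 : ℕ)) := by simp
    simp only [coeffZ_sum, hcc, coeffZ_C_mul, haQ, hcd] at h
    have ha2 : a ^ 2 * P ^ (n - 2) =
        PowerSeries.C (p ^ 2) * (PowerSeries.X ^ t * (PowerSeries.X ^ t * P ^ (n - 2))) := by
      rw [ha, map_pow]; ring
    rw [ha2, coeffZ_C_mul, coeffZ_X_pow_mul,
      show coeffZ (PowerSeries.X ^ t * P ^ (n - 2)) s = coeffZ (P ^ (n - 2)) (s - t) by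
        rw [← coeffZ_X_pow_mul _ t (s - t), sub_add_cancel]] at h
    rw [mul_assoc, ← h]
  -- Cauchy–Schwarz: `(∑ j w)² ≤ (∑ w)(∑ j² w)`, with `j² = j(j-1) + j`.
  have hCS := Finset.sum_sq_le_sum_mul_sum_of_sq_le_mul (Finset.range (n + 1))
    (r := fun j => (j : ℝ) * w j) (f := w) (g := fun j => (j : ℝ) ^ 2 * w j)
    (fun j _ => hw0 j) (fun j _ => mul_nonneg (by positivity) (hw0 j)) (fun j _ => le_of_eq (by ring))
  have e3 : ∑ j ∈ Finset.range (n + 1), (j : ℝ) ^ 2 * w j =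
      n * (n - 1 : ℕ) * p ^ 2 * coeffZ (P ^ (n - 2)) (s - t) +
        n * p * coeffZ (P ^ (n - 1)) s := by
    rw [← e1, ← e2, ← Finset.sum_add_distrib]
    exact Finset.sum_congr rfl fun j _ => by ring
  rwa [e0, e1, e3] at hCS

/-- A weighted supremum bound on coefficients is preserved by multiplication with a series of
nonnegative coefficients. -/
lemma coeff_mul_prod_le {ι : Type*} (S : Finset ι) (A : PowerSeries ℝ) (B : ι → PowerSeries ℝ)
    {x M : ℝ} (hx : 0 ≤ x) (hM : 0 ≤ M)
    (hB : ∀ i j, 0 ≤ PowerSeries.coeff j (B i)) (b : ι → ℝ)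
    (hb : ∀ i, HasSum (fun j => PowerSeries.coeff j (B i) * x ^ j) (b i))
    (hA : ∀ s, PowerSeries.coeff s A * x ^ s ≤ M) :
    ∀ s, PowerSeries.coeff s (A * ∏ i ∈ S, B i) * x ^ s ≤ M * ∏ i ∈ S, b i := by
  classical
  have hbn : ∀ i, 0 ≤ b i := fun i =>
    (hb i).nonneg fun j => mul_nonneg (hB i j) (pow_nonneg hx j)
  induction S using Finset.induction_on with
  | empty => simpa using hA
  | insert i S hi ih =>
    intro s
    rw [Finset.prod_insert hi, Finset.prod_insert hi, mul_left_comm, PowerSeries.coeff_mul,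
      Finset.sum_mul]
    have hN : 0 ≤ M * ∏ i ∈ S, b i := mul_nonneg hM (Finset.prod_nonneg fun i _ => hbn i)
    calc ∑ p ∈ Finset.HasAntidiagonal.antidiagonal s, PowerSeries.coeff p.1 (B i) *
            PowerSeries.coeff p.2 (A * ∏ i ∈ S, B i) * x ^ s
        ≤ ∑ p ∈ Finset.HasAntidiagonal.antidiagonal s, (PowerSeries.coeff p.1 (B i) * x ^ p.1) *
            (M * ∏ i ∈ S, b i) := by
          refine Finset.sum_le_sum fun p hp => ?_
          rw [← Finset.HasAntidiagonal.mem_antidiagonal.1 hp, pow_add]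
          calc _ = (PowerSeries.coeff p.1 (B i) * x ^ p.1) *
                (PowerSeries.coeff p.2 (A * ∏ i ∈ S, B i) * x ^ p.2) := by ring
            _ ≤ _ := mul_le_mul_of_nonneg_left (ih _) (mul_nonneg (hB _ _) (pow_nonneg hx _))
      _ = (∑ j ∈ Finset.range (s + 1), PowerSeries.coeff j (B i) * x ^ j) *
            (M * ∏ i ∈ S, b i) := by
          rw [← Finset.sum_mul,
            Finset.Nat.sum_antidiagonal_eq_sum_range_succ_mk]
      _ ≤ b i * (M * ∏ i ∈ S, b i) :=
          mul_le_mul_of_nonneg_right (sum_le_hasSum _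
            (fun j _ => mul_nonneg (hB i j) (pow_nonneg hx j)) (hb i)) hN
      _ = _ := by ring

/-- With nonnegative coefficients, a single choice of exponents in the Cauchy product is a lower
bound. -/
lemma le_coeff_mul_prod {ι : Type*} (S : Finset ι) {A : PowerSeries ℝ} {B : ι → PowerSeries ℝ}
    (hA : ∀ j, 0 ≤ PowerSeries.coeff j A) (hB : ∀ i j, 0 ≤ PowerSeries.coeff j (B i))
    (c : ι → ℕ) (s : ℕ) :
    PowerSeries.coeff s A * ∏ i ∈ S, PowerSeries.coeff (c i) (B i) ≤
      PowerSeries.coeff (s + ∑ i ∈ S, c i) (A * ∏ i ∈ S, B i) := by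
  classical
  induction S using Finset.induction_on with
  | empty => simp
  | insert i S hi ih =>
    rw [Finset.prod_insert hi, Finset.prod_insert hi, Finset.sum_insert hi, mul_left_comm,
      mul_left_comm A, PowerSeries.coeff_mul]
    refine (mul_le_mul_of_nonneg_left ih (hB i (c i))).trans ?_
    refine Finset.single_le_sum (f := fun p : ℕ × ℕ => PowerSeries.coeff p.1 (B i) *
      PowerSeries.coeff p.2 (A * ∏ i ∈ S, B i)) (a := (c i, s + ∑ i ∈ S, c i))
      (fun p _ => mul_nonneg (hB _ _)
        (coeff_mul_nonneg hA (coeff_prod_nonneg hB S) _)) ?_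
    rw [Finset.HasAntidiagonal.mem_antidiagonal]
    ring

/-! ### Characteristic functions -/

/-- The sum of a power series on the unit circle. -/
noncomputable def charSum (A : PowerSeries ℝ) (θ : ℝ) : ℂ :=
  ∑' j : ℕ, ((PowerSeries.coeff j A : ℝ) : ℂ) * Complex.exp ((j : ℂ) * θ * Complex.I)

/-- Absolute convergence of a power series on the unit circle. -/
def CoeffSummable (A : PowerSeries ℝ) : Prop := Summable fun j => |PowerSeries.coeff j A|

lemma norm_exp_mul_mul_I (j : ℕ) (θ : ℝ) : ‖Complex.exp ((j : ℂ) * θ * Complex.I)‖ = 1 := by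
  rw [show (j : ℂ) * θ * Complex.I = ((j * θ : ℝ) : ℂ) * Complex.I by push_cast; ring,
    Complex.norm_exp_ofReal_mul_I]

lemma norm_charSum_term (A : PowerSeries ℝ) (θ : ℝ) (j : ℕ) :
    ‖((PowerSeries.coeff j A : ℝ) : ℂ) * Complex.exp ((j : ℂ) * θ * Complex.I)‖ =
      |PowerSeries.coeff j A| := by
  rw [norm_mul, norm_exp_mul_mul_I, mul_one, Complex.norm_real, Real.norm_eq_abs]

lemma CoeffSummable.summable_norm {A : PowerSeries ℝ} (hA : CoeffSummable A) (θ : ℝ) :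
    Summable fun j : ℕ => ‖((PowerSeries.coeff j A : ℝ) : ℂ) * Complex.exp ((j : ℂ) * θ * Complex.I)‖ := by
  simpa only [norm_charSum_term, CoeffSummable] using hA

lemma charSum_term_mul (A B : PowerSeries ℝ) (θ : ℝ) (s : ℕ) :
    ∑ p ∈ Finset.HasAntidiagonal.antidiagonal s,
      (((PowerSeries.coeff p.1 A : ℝ) : ℂ) * Complex.exp ((p.1 : ℂ) * θ * Complex.I)) *
        (((PowerSeries.coeff p.2 B : ℝ) : ℂ) * Complex.exp ((p.2 : ℂ) * θ * Complex.I)) =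
      ((PowerSeries.coeff s (A * B) : ℝ) : ℂ) * Complex.exp ((s : ℂ) * θ * Complex.I) := by
  rw [PowerSeries.coeff_mul, Complex.ofReal_sum, Finset.sum_mul]
  refine Finset.sum_congr rfl fun p hp => ?_
  rw [← Finset.HasAntidiagonal.mem_antidiagonal.1 hp]
  push_cast
  rw [show ((p.1 : ℂ) + p.2) * θ * Complex.I =
    (p.1 : ℂ) * θ * Complex.I + (p.2 : ℂ) * θ * Complex.I by ring, Complex.exp_add]
  ring

lemma CoeffSummable.mul {A B : PowerSeries ℝ} (hA : CoeffSummable A) (hB : CoeffSummable B) :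
    CoeffSummable (A * B) := by
  have h := summable_norm_sum_mul_antidiagonal_of_summable_norm (hA.summable_norm 0)
    (hB.summable_norm 0)
  simpa only [charSum_term_mul, norm_charSum_term, CoeffSummable] using h

lemma charSum_mul {A B : PowerSeries ℝ} (hA : CoeffSummable A) (hB : CoeffSummable B) (θ : ℝ) :
    charSum (A * B) θ = charSum A θ * charSum B θ := by
  unfold charSum
  rw [tsum_mul_tsum_eq_tsum_sum_antidiagonal_of_summable_norm (hA.summable_norm θ)
    (hB.summable_norm θ)]
  simp only [charSum_term_mul]

lemma coeffSummable_one : CoeffSummable 1 := by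
  refine summable_of_ne_finset_zero (s := {0}) fun j hj => ?_
  simp only [Finset.mem_singleton] at hj
  simp [PowerSeries.coeff_one, hj]

lemma charSum_one (θ : ℝ) : charSum 1 θ = 1 := by
  unfold charSum
  rw [tsum_eq_single 0]
  · simp
  · intro j hj
    simp [PowerSeries.coeff_one, hj]

lemma CoeffSummable.pow {A : PowerSeries ℝ} (hA : CoeffSummable A) (N : ℕ) :
    CoeffSummable (A ^ N) := by
  induction N with
  | zero => simpa using coeffSummable_one
  | succ N ih => rw [pow_succ]; exact ih.mul hA

lemma charSum_pow {A : PowerSeries ℝ} (hA : CoeffSummable A) (N : ℕ) (θ : ℝ) :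
    charSum (A ^ N) θ = charSum A θ ^ N := by
  induction N with
  | zero => simp [charSum_one]
  | succ N ih => rw [pow_succ, pow_succ, charSum_mul (hA.pow N) hA, ih]

lemma CoeffSummable.continuous {A : PowerSeries ℝ} (hA : CoeffSummable A) :
    Continuous (charSum A) :=
  continuous_tsum (fun j => by fun_prop) hA fun j θ => (norm_charSum_term A θ j).le

lemma integral_exp_int_mul_I (k : ℤ) :
    ∫ θ in (-Real.pi)..Real.pi, Complex.exp ((k : ℂ) * θ * Complex.I) =
      if k = 0 then 2 * (Real.pi : ℂ) else 0 := by
  split_ifs with h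
  · simp [h]; ring
  · have hc : (k : ℂ) * Complex.I ≠ 0 :=
      mul_ne_zero (by exact_mod_cast h) Complex.I_ne_zero
    have := integral_exp_mul_complex (a := -Real.pi) (b := Real.pi) hc
    simp only [mul_right_comm _ Complex.I] at this
    rw [this]
    have e : Complex.exp ((k : ℂ) * (Real.pi : ℂ) * Complex.I) =
        Complex.exp ((k : ℂ) * ((-Real.pi : ℝ) : ℂ) * Complex.I) := by
      rw [Complex.exp_eq_exp_iff_exists_int]
      exact ⟨k, by push_cast; ring⟩
    rw [e, sub_self, zero_div]

/-- Fourier inversion for an absolutely convergent power series. -/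
lemma integral_charSum {A : PowerSeries ℝ} (hA : CoeffSummable A) (s : ℤ) :
    ∫ θ in (-Real.pi)..Real.pi, charSum A θ * Complex.exp (-((s : ℂ) * θ * Complex.I)) =
      2 * Real.pi * (coeffZ A s : ℂ) := by
  set F : ℕ → ℝ → ℂ := fun j θ =>
    ((PowerSeries.coeff j A : ℝ) : ℂ) * Complex.exp (((j - s : ℤ) : ℂ) * θ * Complex.I) with hF
  have hnorm : ∀ j θ, ‖F j θ‖ = |PowerSeries.coeff j A| := by
    intro j θ
    rw [hF]
    simp only
    rw [show ((j - s : ℤ) : ℂ) * θ * Complex.I = (((j - s : ℤ) * θ : ℝ) : ℂ) * Complex.I by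
      push_cast; ring, norm_mul, Complex.norm_exp_ofReal_mul_I, mul_one, Complex.norm_real,
      Real.norm_eq_abs]
  have hpt : ∀ θ : ℝ, HasSum (fun j => F j θ)
      (charSum A θ * Complex.exp (-((s : ℂ) * θ * Complex.I))) := by
    intro θ
    have h := ((hA.summable_norm θ).of_norm.hasSum).mul_right
      (Complex.exp (-((s : ℂ) * θ * Complex.I)))
    convert! h using 2 with j
    rw [hF, mul_assoc, ← Complex.exp_add]
    beta_reduce
    congr 2
    push_cast
    ring
  have hint : HasSum (fun j => ∫ θ in (-Real.pi)..Real.pi, F j θ)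
      (∫ θ in (-Real.pi)..Real.pi, charSum A θ * Complex.exp (-((s : ℂ) * θ * Complex.I))) := by
    refine intervalIntegral.hasSum_integral_of_dominated_convergence
      (fun j _ => |PowerSeries.coeff j A|) (fun j => ?_) (fun j => ?_) ?_ ?_ ?_
    · exact (Continuous.aestronglyMeasurable (by fun_prop))
    · exact Eventually.of_forall fun θ _ => (hnorm j θ).le
    · exact Eventually.of_forall fun θ _ => hA
    · exact intervalIntegrable_const
    · exact Eventually.of_forall fun θ _ => hpt θ
  have hval : ∀ j : ℕ, ∫ θ in (-Real.pi)..Real.pi, F j θ =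
      if (j : ℤ) = s then 2 * Real.pi * (coeffZ A s : ℂ) else 0 := by
    intro j
    rw [hF]
    simp only
    rw [intervalIntegral.integral_const_mul, integral_exp_int_mul_I]
    by_cases h : (j : ℤ) = s
    · rw [if_pos (by omega), if_pos h, ← h, coeffZ_natCast]; ring
    · rw [if_neg (by omega), if_neg h, mul_zero]
  rw [← hint.tsum_eq]
  simp only [hval]
  by_cases h : 0 ≤ s
  · obtain ⟨k, rfl⟩ := Int.eq_ofNat_of_zero_le h
    rw [tsum_eq_single k]
    · simp
    · intro j hj
      rw [if_neg (by exact_mod_cast hj)]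
  · have : ∀ j : ℕ, ¬ ((j : ℤ) = s) := fun j => by omega
    simp [this, coeffZ, h]

/-- The difference of two coefficients is bounded by the integral of a bound for the difference
of the rotated characteristic functions. -/
lemma abs_coeffZ_sub_coeffZ_le {A B : PowerSeries ℝ} (hA : CoeffSummable A) (hB : CoeffSummable B)
    (s t : ℤ) {g : ℝ → ℝ} (hg : Continuous g)
    (h : ∀ θ, ‖charSum A θ * Complex.exp (-((s : ℂ) * θ * Complex.I)) -
      charSum B θ * Complex.exp (-((t : ℂ) * θ * Complex.I))‖ ≤ g θ) :
    |coeffZ A s - coeffZ B t| ≤ ∫ θ in (-Real.pi)..Real.pi, g θ := by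
  have hcA := hA.continuous
  have hcB := hB.continuous
  have e : (2 * Real.pi * ((coeffZ A s - coeffZ B t : ℝ) : ℂ)) =
      ∫ θ in (-Real.pi)..Real.pi, (charSum A θ * Complex.exp (-((s : ℂ) * θ * Complex.I)) -
        charSum B θ * Complex.exp (-((t : ℂ) * θ * Complex.I))) := by
    rw [intervalIntegral.integral_sub, integral_charSum hA, integral_charSum hB]
    · push_cast; ring
    · exact Continuous.intervalIntegrable (by fun_prop) _ _
    · exact Continuous.intervalIntegrable (by fun_prop) _ _
  have hle : ‖(2 * Real.pi * ((coeffZ A s - coeffZ B t : ℝ) : ℂ))‖ ≤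
      ∫ θ in (-Real.pi)..Real.pi, g θ := by
    rw [e]
    exact intervalIntegral.norm_integral_le_of_norm_le (by linarith [Real.pi_pos])
      (Eventually.of_forall fun θ _ => h θ) (hg.intervalIntegrable _ _)
  rw [norm_mul, norm_mul, Complex.norm_real, Complex.norm_real, Complex.norm_ofNat,
    Real.norm_of_nonneg Real.pi_pos.le, Real.norm_eq_abs] at hle
  refine le_trans ?_ hle
  have : 1 ≤ 2 * Real.pi := by linarith [Real.pi_gt_three]
  exact le_mul_of_one_le_left (abs_nonneg _) this

/-! ### Counting half-edge assignments -/

/-- Multinomial theorem for exponential generating functions: the number of maps with given fibre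
sizes is a multinomial coefficient, whose denominators are absorbed in the series. -/
lemma sum_prod_card_fiber {κ ι : Type*} [Fintype κ] [Fintype ι] [DecidableEq κ] [DecidableEq ι]
    (a : ι → ℕ → ℝ) :
    ∑ h : κ → ι, ∏ v, a v (Finset.univ.filter fun i => h i = v).card =
      ((Fintype.card κ)! : ℝ) * PowerSeries.coeff (Fintype.card κ)
        (∏ v, PowerSeries.mk fun j => a v j / (j ! : ℝ)) := by
  -- This functional replaces each monomial by the product of the weights of its exponents. Applied
  -- to both expansions of `(∑ X_v)^|κ|`, it gives the weighted count.
  set L : MvPolynomial ι ℝ →ₗ[ℝ] ℝ :=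
    (MvPolynomial.basisMonomials ι ℝ).constr ℝ (fun k => ∏ v, a v (k v)) with hL
  have hLm : ∀ f : ι → ℕ, L (∏ v, MvPolynomial.X v ^ f v) = ∏ v, a v (f v) := by
    intro f
    have h : (∏ v, (MvPolynomial.X v : MvPolynomial ι ℝ) ^ f v) =
        MvPolynomial.basisMonomials ι ℝ (Finsupp.equivFunOnFinite.symm f) := by
      rw [MvPolynomial.coe_basisMonomials]
      beta_reduce
      rw [MvPolynomial.monomial_eq, Finsupp.prod_fintype]
      · simp
      · simp
    rw [h, hL, Module.Basis.constr_basis]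
    simp
  have hexp : ∑ h : κ → ι, ∏ v, (MvPolynomial.X v : MvPolynomial ι ℝ) ^
        (Finset.univ.filter fun i => h i = v).card =
      ∑ k ∈ Finset.piAntidiag Finset.univ (Fintype.card κ),
        (Nat.multinomial Finset.univ k : MvPolynomial ι ℝ) * ∏ v, MvPolynomial.X v ^ k v := by
    rw [← Finset.sum_pow_eq_sum_piAntidiag, ← Finset.card_univ, ← Finset.prod_const,
      Finset.prod_univ_sum]
    rw [Fintype.piFinset_univ]
    refine Finset.sum_congr rfl fun h _ => ?_
    rw [← Finset.prod_fiberwise Finset.univ h]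
    refine Finset.prod_congr rfl fun v _ => ?_
    rw [Finset.prod_congr rfl (g := fun _ => (MvPolynomial.X v : MvPolynomial ι ℝ)),
      Finset.prod_const]
    intro i hi
    rw [(Finset.mem_filter.1 hi).2]
  have h := congrArg L hexp
  simp only [map_sum, hLm] at h
  rw [h, PowerSeries.coeff_prod, Finset.mul_sum]
  refine Finset.sum_nbij' (fun k => Finsupp.equivFunOnFinite.symm k)
    (fun k => (k : ι → ℕ)) ?_ ?_ ?_ ?_ ?_
  · intro k hk
    simp only [Finset.mem_piAntidiag] at hk
    simp [hk.1]
  · intro k hk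
    simp only [Finset.mem_finsuppAntidiag] at hk
    simp [hk.1]
  · intro k _
    simp
  · intro k _
    ext
    simp
  · intro k hk
    simp only [Finset.mem_piAntidiag] at hk
    rw [← nsmul_eq_mul, map_nsmul, hLm, nsmul_eq_mul, ← hk.1,
      ← Nat.multinomial_spec Finset.univ k]
    simp only [PowerSeries.coeff_mk, Finsupp.equivFunOnFinite_symm_apply_apply,
      Finset.prod_div_distrib]
    push_cast
    have : (∏ v, ((k v)! : ℝ)) ≠ 0 :=
      Finset.prod_ne_zero_iff.2 fun v _ => by exact_mod_cast Nat.factorial_ne_zero _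
    field_simp

/-- The exponential generating function of the weights shifted by `c`. -/
noncomputable def egf (δ : ℕ → ℝ) (c : ℕ) : PowerSeries ℝ :=
  PowerSeries.mk fun j => δ (j + c) / (j ! : ℝ)

lemma coeff_egf (δ : ℕ → ℝ) (c j : ℕ) : PowerSeries.coeff j (egf δ c) = δ (j + c) / (j ! : ℝ) := by
  simp [egf]

/-- The degree of a vertex, for edges labelled by an arbitrary finite type. -/
def edgeDeg {κ ι : Type*} [Fintype κ] [DecidableEq ι] (H : κ → ι × ι) (v : ι) : ℕ :=
  (Finset.univ.filter fun e => (H e).1 = v).card + (Finset.univ.filter fun e => (H e).2 = v).card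

lemma edgeDeg_eq_sum {κ ι : Type*} [Fintype κ] [DecidableEq ι] (H : κ → ι × ι) (v : ι) :
    edgeDeg H v = ∑ e, ((if (H e).1 = v then 1 else 0) + (if (H e).2 = v then 1 else 0)) := by
  rw [edgeDeg, Finset.card_filter, Finset.card_filter, Finset.sum_add_distrib]

/-- A sequence of ordered pairs is a map on the half-edges `κ ⊕ κ`, and degrees are its fibre sizes.
-/
lemma sum_prod_edgeDeg {κ ι : Type*} [Fintype κ] [Fintype ι] [DecidableEq κ] [DecidableEq ι]
    (δ : ℕ → ℝ) (c : ι → ℕ) :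
    ∑ H : κ → ι × ι, ∏ v, δ (edgeDeg H v + c v) =
      ((2 * Fintype.card κ)! : ℝ) * PowerSeries.coeff (2 * Fintype.card κ)
        (∏ v, egf δ (c v)) := by
  have h := sum_prod_card_fiber (κ := κ ⊕ κ) (fun (v : ι) j => δ (j + c v))
  rw [Fintype.card_sum, ← two_mul] at h
  unfold egf
  rw [← h]
  let E : (κ → ι × ι) ≃ (κ ⊕ κ → ι) :=
    { toFun := fun H => Sum.elim (fun e => (H e).1) (fun e => (H e).2)
      invFun := fun h e => (h (Sum.inl e), h (Sum.inr e))
      left_inv := fun H => by ext <;> rfl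
      right_inv := fun h => by ext (e | e) <;> rfl }
  rw [← E.sum_comp]
  refine Finset.sum_congr rfl fun H _ => Finset.prod_congr rfl fun v _ => ?_
  rw [edgeDeg_eq_sum, Finset.card_filter, Fintype.sum_sum_type, Finset.sum_add_distrib]
  rfl

/-- Summing over the graphs in which the edges with labels in the range of `β` are prescribed. -/
lemma sum_prod_edgeDeg_of_prescribed {κ ι E : Type*} [Fintype κ] [Fintype ι] [Fintype E]
    [DecidableEq κ] [DecidableEq ι] (δ : ℕ → ℝ) (β : E ↪ κ) (q : E → ι × ι) :
    ∑ G ∈ (Finset.univ : Finset (κ → ι × ι)).filter (fun G => ∀ e, G (β e) = q e),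
        ∏ v, δ (edgeDeg G v) =
      ((2 * (Fintype.card κ - Fintype.card E))! : ℝ) *
        PowerSeries.coeff (2 * (Fintype.card κ - Fintype.card E)) (∏ v, egf δ (edgeDeg q v)) := by
  classical
  -- The unprescribed labels carry an arbitrary multigraph; the prescribed edges only shift the
  -- degree of `v` by `edgeDeg q v`.
  let C := {i // i ∉ Set.range β}
  let eqv : E ⊕ C ≃ κ := (Equiv.sumCongr (Equiv.ofInjective β β.injective) (Equiv.refl _)).trans
    (Equiv.Set.sumCompl (Set.range β))
  have heqvl : ∀ e, eqv (Sum.inl e) = β e := fun e => rfl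
  have hcard : Fintype.card C = Fintype.card κ - Fintype.card E := by
    rw [← Fintype.card_congr eqv, Fintype.card_sum]
    simp
  rw [← hcard, ← sum_prod_edgeDeg (κ := C)]
  refine Finset.sum_nbij' (fun G c => G (eqv (Sum.inr c))) (fun H => Sum.elim q H ∘ eqv.symm)
    ?_ ?_ ?_ ?_ ?_
  · intro G _
    simp
  · intro H _
    simp [← heqvl]
  · intro G hG
    rw [Finset.mem_filter] at hG
    funext i
    obtain ⟨x, rfl⟩ := eqv.surjective i
    rcases x with e | c
    · simp [heqvl, hG.2]
      simp [← heqvl]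
    · simp
  · intro H _
    funext c
    simp
  · intro G hG
    rw [Finset.mem_filter] at hG
    refine Finset.prod_congr rfl fun v _ => congrArg δ ?_
    simp only [edgeDeg_eq_sum]
    rw [← eqv.sum_comp, Fintype.sum_sum_type, add_comm]
    simp [heqvl, hG.2]

/-! ### Placements of a tree in a multigraph -/

variable {V : Type*}

/-- The images of the edges of `T` under a map of the vertices, with orientations given by `o`. -/
noncomputable def orient {ι : Type*} (T : SimpleGraph V) (σ : V → ι) (o : T.edgeSet → Bool)
    (e : T.edgeSet) : ι × ι :=
  if o e then (σ (Quot.out (e : Sym2 V)).1, σ (Quot.out (e : Sym2 V)).2)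
  else (σ (Quot.out (e : Sym2 V)).2, σ (Quot.out (e : Sym2 V)).1)

lemma mk_quot_out (e : Sym2 V) : s((Quot.out e).1, (Quot.out e).2) = e := Quot.out_eq e

lemma mk_orient {ι : Type*} (T : SimpleGraph V) (σ : V → ι) (o : T.edgeSet → Bool)
    (e : T.edgeSet) :
    s((orient T σ o e).1, (orient T σ o e).2) = Sym2.map σ (e : Sym2 V) := by
  conv_rhs => rw [← mk_quot_out (e : Sym2 V), Sym2.map_mk]
  unfold orient
  split_ifs
  · rfl
  · exact Sym2.eq_swap

/-- Edges of `T` are not loops and `σ` is injective, so each incident edge contributes exactly one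
half-edge, for either orientation. -/
lemma edgeDeg_orient_apply {ι : Type*} [DecidableEq ι] [Fintype V] (T : SimpleGraph V)
    [DecidableRel T.Adj] [Fintype T.edgeSet] {σ : V → ι} (hσ : Function.Injective σ)
    (o : T.edgeSet → Bool) (u : V) : edgeDeg (orient T σ o) (σ u) = T.degree u := by
  classical
  rw [edgeDeg_eq_sum, ← T.card_incidenceFinset_eq_degree, SimpleGraph.incidenceFinset_eq_filter,
    Finset.card_filter, SimpleGraph.edgeFinset, Finset.sum_set_coe T.edgeSet |>.symm]
  refine Finset.sum_congr rfl fun e _ => ?_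
  have hne : (Quot.out (e : Sym2 V)).1 ≠ (Quot.out (e : Sym2 V)).2 := by
    have h := e.2
    rw [← mk_quot_out (e : Sym2 V), SimpleGraph.mem_edgeSet] at h
    exact h.ne
  have hmem : u ∈ (e : Sym2 V) ↔ u = (Quot.out (e : Sym2 V)).1 ∨ u = (Quot.out (e : Sym2 V)).2 := by
    conv_lhs => rw [← mk_quot_out (e : Sym2 V), Sym2.mem_iff]
  simp only [hmem]
  unfold orient
  generalize (Quot.out (e : Sym2 V)).1 = a at *
  generalize (Quot.out (e : Sym2 V)).2 = b at *
  have hi : ∀ x y, σ x = σ y ↔ x = y := fun _ _ => hσ.eq_iff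
  cases o e <;> simp only [hi, reduceIte, Bool.false_eq_true] <;> grind

lemma edgeDeg_orient_of_notMem {ι : Type*} [DecidableEq ι] (T : SimpleGraph V)
    [Fintype T.edgeSet] {σ : V → ι} (o : T.edgeSet → Bool) {w : ι} (hw : w ∉ Set.range σ) :
    edgeDeg (orient T σ o) w = 0 := by
  have h : ∀ u, σ u ≠ w := fun u hu => hw ⟨u, hu⟩
  rw [edgeDeg_eq_sum]
  refine Finset.sum_eq_zero fun e _ => ?_
  unfold orient
  split_ifs <;> simp_all

lemma prod_egf_orient {ι : Type*} [Fintype ι] [DecidableEq ι] [Fintype V] (T : SimpleGraph V)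
    [DecidableRel T.Adj] [Fintype T.edgeSet] (δ : ℕ → ℝ) (σ : V ↪ ι) (o : T.edgeSet → Bool) :
    ∏ w, egf δ (edgeDeg (orient T σ o) w) =
      egf δ 0 ^ (Fintype.card ι - Fintype.card V) * ∏ u, egf δ (T.degree u) := by
  classical
  rw [← Finset.prod_mul_prod_compl (Finset.univ.map σ), Finset.prod_map, mul_comm]
  congr 1
  · rw [Finset.prod_congr rfl (g := fun _ => egf δ 0), Finset.prod_const, Finset.card_compl,
      Finset.card_map, Finset.card_univ]
    intro w hw
    rw [edgeDeg_orient_of_notMem]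
    simpa using hw
  · exact Finset.prod_congr rfl fun u _ => by rw [edgeDeg_orient_apply T σ.injective]

/-- Vertex maps and edge maps that realise a copy of `T` in `G`, with orientations `o`. -/
def IsRealised {n m : ℕ} (T : SimpleGraph V) (G : Multigraph n m) (σ : V ↪ Fin n)
    (β : T.edgeSet ↪ Fin m) (o : T.edgeSet → Bool) : Prop :=
  ∀ e, G (β e) = orient T σ o e

lemma IsRealised.isSubgraph_and_isoOn {n m : ℕ} [Fintype V] {T : SimpleGraph V} [Fintype T.edgeSet]
    {G : Multigraph n m} {σ : V ↪ Fin n} {β : T.edgeSet ↪ Fin m} {o : T.edgeSet → Bool}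
    (h : IsRealised T G σ β o) :
    G.IsSubgraph (Finset.univ.map σ) (Finset.univ.map β) ∧
      G.IsoOn T (Finset.univ.map σ) (Finset.univ.map β) := by
  constructor
  · intro i hi
    rw [Finset.mem_map] at hi
    obtain ⟨e, -, rfl⟩ := hi
    rw [h e]
    unfold orient
    split_ifs <;> simp
  · refine ⟨(Equiv.ofInjective σ σ.injective).trans (Equiv.subtypeEquivRight (by simp)),
      (Equiv.ofInjective β β.injective).trans (Equiv.subtypeEquivRight (by simp)), fun e => ?_⟩
    have := mk_orient T σ o e
    rw [← h e] at this
    exact this.symm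

-- The orientation of each edge is found by testing whether its image agrees with the reference
-- order chosen by `Quot.out`; if not, the unordered pairs agree only after a swap.
open Classical in
lemma exists_isRealised {n m : ℕ} [Fintype V] {T : SimpleGraph V} [Fintype T.edgeSet]
    {G : Multigraph n m} {A : Finset (Fin n)} {S : Finset (Fin m)} (h : G.IsoOn T A S) :
    ∃ (σ : V ↪ Fin n) (β : T.edgeSet ↪ Fin m) (o : T.edgeSet → Bool), IsRealised T G σ β o ∧
      Finset.univ.map σ = A ∧ Finset.univ.map β = S := by
  obtain ⟨α, β, hαβ⟩ := h
  refine ⟨α.toEmbedding.trans (Function.Embedding.subtype _),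
    β.toEmbedding.trans (Function.Embedding.subtype _),
    fun e => decide (G (β e) = ((α (Quot.out (e : Sym2 V)).1 : Fin n),
      (α (Quot.out (e : Sym2 V)).2 : Fin n))), fun e => ?_, ?_, ?_⟩
  · have h1 := hαβ e
    nth_rewrite 1 [← mk_quot_out (e : Sym2 V)] at h1
    rw [Sym2.map_mk, Sym2.eq_iff] at h1
    unfold orient
    simp only [decide_eq_true_eq]
    split_ifs with hc
    · exact hc
    · rcases h1 with h1 | h1
      · exact absurd (Prod.ext h1.1.symm h1.2.symm) hc
      · exact Prod.ext h1.2.symm h1.1.symm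
  · rw [← Finset.map_map]
    ext x
    simp
  · rw [← Finset.map_map]
    ext x
    simp

-- Every copy comes from at least one realisation. Overcounting by automorphisms costs only a
-- constant factor.
open Classical in
lemma copies_le_card {n m : ℕ} [Fintype V] (T : SimpleGraph V) [Fintype T.edgeSet]
    (G : Multigraph n m) :
    G.copies T ≤ (Finset.univ.filter fun x : (V ↪ Fin n) × (T.edgeSet ↪ Fin m) ×
      (T.edgeSet → Bool) => IsRealised T G x.1 x.2.1 x.2.2).card := by
  refine le_trans (le_trans (Set.ncard_le_ncard (t := ↑((Finset.univ.filter
    fun x : (V ↪ Fin n) × (T.edgeSet ↪ Fin m) × (T.edgeSet → Bool) =>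
      IsRealised T G x.1 x.2.1 x.2.2).image
      fun x => ((Finset.univ.map x.1 : Finset (Fin n)), (Finset.univ.map x.2.1 : Finset (Fin m)))))
      ?_ (Finset.finite_toSet _)) (Set.ncard_coe_finset _).le) Finset.card_image_le
  rintro ⟨A, S⟩ ⟨-, h⟩
  obtain ⟨σ, β, o, hr, hA, hS⟩ := exists_isRealised h
  rw [Finset.mem_coe, Finset.mem_image]
  exact ⟨(σ, β, o), by simpa using hr, by simp [hA, hS]⟩

-- One fixed orientation suffices for a lower bound of the right order. A copy `(A, S)` has at most
-- `|A|^|V| · |S|^|E|` realisations, since the maps take values in `A` and `S`.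
open Classical in
lemma card_le_mul_copies {n m : ℕ} [Fintype V] (T : SimpleGraph V) [Fintype T.edgeSet]
    (G : Multigraph n m) (o : T.edgeSet → Bool) :
    (Finset.univ.filter fun x : (V ↪ Fin n) × (T.edgeSet ↪ Fin m) =>
      IsRealised T G x.1 x.2 o).card ≤
      (Fintype.card V ^ Fintype.card V * Fintype.card T.edgeSet ^ Fintype.card T.edgeSet) *
        G.copies T := by
  unfold Multigraph.copies
  rw [Set.ncard_eq_toFinset_card']
  refine Finset.card_le_mul_card_image_of_maps_to (f := fun x =>
    ((Finset.univ.map x.1 : Finset (Fin n)), (Finset.univ.map x.2 : Finset (Fin m))))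
    (fun x hx => ?_) _ (fun b _ => ?_)
  · rw [Set.mem_toFinset]
    exact (Finset.mem_filter.1 hx).2.isSubgraph_and_isoOn
  · obtain ⟨A, S⟩ := b
    rcases Finset.eq_empty_or_nonempty ((Finset.univ.filter
      fun x : (V ↪ Fin n) × (T.edgeSet ↪ Fin m) => IsRealised T G x.1 x.2 o).filter
      fun x => ((Finset.univ.map x.1 : Finset (Fin n)), (Finset.univ.map x.2 : Finset (Fin m))) =
        (A, S)) with h0 | ⟨x, hx⟩
    · rw [h0]
      exact Nat.zero_le _
    · have hx2 := (Finset.mem_filter.1 hx).2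
      simp only [Prod.mk.injEq] at hx2
      have hA : A.card = Fintype.card V := by rw [← hx2.1, Finset.card_map, Finset.card_univ]
      have hS : S.card = Fintype.card T.edgeSet := by
        rw [← hx2.2, Finset.card_map, Finset.card_univ]
      refine (Finset.card_le_card_of_injOn (t := Fintype.piFinset (fun _ : V => A) ×ˢ
        Fintype.piFinset (fun _ : T.edgeSet => S)) (fun y => ((y.1 : V → Fin n), (y.2 : T.edgeSet → Fin m)))
        (fun y hy => ?_) (fun y _ z _ hyz => ?_)).trans ?_
      · have hy2 := (Finset.mem_filter.1 hy).2
        simp only [Prod.mk.injEq] at hy2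
        simp only [Finset.coe_product, Set.mem_prod, Finset.mem_coe, Fintype.mem_piFinset]
        rw [← hy2.1, ← hy2.2]
        simp
      · simp only [Prod.mk.injEq, DFunLike.coe_fn_eq] at hyz
        exact Prod.ext hyz.1 hyz.2
      · rw [Finset.card_product, Fintype.card_piFinset, Fintype.card_piFinset]
        simp [hA, hS]

/-- The total weight of the graphs in which a given copy of `T` is present. -/
noncomputable def copyWeight [Fintype V] (δ : ℕ → ℝ) (T : SimpleGraph V) [DecidableRel T.Adj]
    (n m e : ℕ) : ℝ :=
  ((2 * (m - e))! : ℝ) * PowerSeries.coeff (2 * (m - e))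
    (egf δ 0 ^ (n - Fintype.card V) * ∏ u, egf δ (T.degree u))

-- The value does not depend on `σ`, `β` or `o`, so summing over placements is just multiplication
-- by their number.
open Classical in
lemma sum_weight_isRealised {n m : ℕ} [Fintype V] (δ : ℕ → ℝ) (T : SimpleGraph V)
    [DecidableRel T.Adj] [Fintype T.edgeSet] (σ : V ↪ Fin n) (β : T.edgeSet ↪ Fin m)
    (o : T.edgeSet → Bool) :
    ∑ G : Multigraph n m, (if IsRealised T G σ β o then G.weight δ else 0) =
      copyWeight δ T n m (Fintype.card T.edgeSet) := by
  have h := sum_prod_edgeDeg_of_prescribed δ β (orient T σ o)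
  rw [prod_egf_orient, Fintype.card_fin, Fintype.card_fin] at h
  rw [copyWeight, ← h, ← Finset.sum_filter]
  refine Finset.sum_congr ?_ fun G _ => rfl
  ext G
  simp [IsRealised]

lemma totalWeight_eq (δ : ℕ → ℝ) (n m : ℕ) :
    totalWeight δ n m = ((2 * m)! : ℝ) * PowerSeries.coeff (2 * m) (egf δ 0 ^ n) := by
  have h := sum_prod_edgeDeg (κ := Fin m) (ι := Fin n) δ (fun _ => 0)
  rw [Finset.prod_const, Finset.card_univ, Fintype.card_fin, Fintype.card_fin] at h
  rw [← h]
  rfl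

lemma weight_nonneg {n m : ℕ} {δ : ℕ → ℝ} (hδ : ∀ d, 0 ≤ δ d) (G : Multigraph n m) :
    0 ≤ G.weight δ := Finset.prod_nonneg fun _ _ => hδ _

lemma sum_weight_mul_copies_le {n m : ℕ} [Fintype V] {δ : ℕ → ℝ} (hδ : ∀ d, 0 ≤ δ d)
    (T : SimpleGraph V) [DecidableRel T.Adj] [Fintype T.edgeSet] :
    ∑ G : Multigraph n m, G.weight δ * (G.copies T : ℝ) ≤
      (n.descFactorial (Fintype.card V) * (m.descFactorial (Fintype.card T.edgeSet) *
        2 ^ Fintype.card T.edgeSet) : ℕ) * copyWeight δ T n m (Fintype.card T.edgeSet) := by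
  classical
  calc ∑ G : Multigraph n m, G.weight δ * (G.copies T : ℝ)
      ≤ ∑ G : Multigraph n m, ∑ x : (V ↪ Fin n) × (T.edgeSet ↪ Fin m) × (T.edgeSet → Bool),
          (if IsRealised T G x.1 x.2.1 x.2.2 then G.weight δ else 0) := by
        refine Finset.sum_le_sum fun G _ => ?_
        rw [← Finset.sum_filter, Finset.sum_const, nsmul_eq_mul, mul_comm]
        exact mul_le_mul_of_nonneg_right (by exact_mod_cast copies_le_card T G)
          (weight_nonneg hδ G)
    _ = _ := by
        rw [Finset.sum_comm]
        simp only [sum_weight_isRealised]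
        rw [Finset.sum_const, Finset.card_univ, nsmul_eq_mul, Fintype.card_prod, Fintype.card_prod,
          Fintype.card_embedding_eq, Fintype.card_embedding_eq, Fintype.card_fin, Fintype.card_fin,
          Fintype.card_fun, Fintype.card_bool]

lemma le_sum_weight_mul_copies {n m : ℕ} [Fintype V] {δ : ℕ → ℝ} (hδ : ∀ d, 0 ≤ δ d)
    (T : SimpleGraph V) [DecidableRel T.Adj] [Fintype T.edgeSet] :
    (n.descFactorial (Fintype.card V) * m.descFactorial (Fintype.card T.edgeSet) : ℕ) *
        copyWeight δ T n m (Fintype.card T.edgeSet) ≤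
      (Fintype.card V ^ Fintype.card V * Fintype.card T.edgeSet ^ Fintype.card T.edgeSet : ℕ) *
        ∑ G : Multigraph n m, G.weight δ * (G.copies T : ℝ) := by
  classical
  calc _ = ∑ G : Multigraph n m, ∑ x : (V ↪ Fin n) × (T.edgeSet ↪ Fin m),
          (if IsRealised T G x.1 x.2 (fun _ => true) then G.weight δ else 0) := by
        rw [Finset.sum_comm]
        simp only [sum_weight_isRealised]
        rw [Finset.sum_const, Finset.card_univ, nsmul_eq_mul, Fintype.card_prod,
          Fintype.card_embedding_eq, Fintype.card_embedding_eq, Fintype.card_fin, Fintype.card_fin]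
    _ ≤ _ := by
        rw [Finset.mul_sum]
        refine Finset.sum_le_sum fun G _ => ?_
        rw [← Finset.sum_filter, Finset.sum_const, nsmul_eq_mul, mul_left_comm, mul_comm]
        exact mul_le_mul_of_nonneg_left
          (by exact_mod_cast card_le_mul_copies T G (fun _ => true)) (weight_nonneg hδ G)

/-! ### Bounds for characteristic functions -/

/-- A power series with nonnegative coefficients of total mass at most one. -/
structure IsSubLaw (A : PowerSeries ℝ) : Prop where
  nonneg : ∀ j, 0 ≤ PowerSeries.coeff j A
  summable : Summable fun j => PowerSeries.coeff j A
  tsum_le : ∑' j, PowerSeries.coeff j A ≤ 1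

lemma IsSubLaw.coeffSummable {A : PowerSeries ℝ} (hA : IsSubLaw A) : CoeffSummable A := by
  have h : (fun j => |PowerSeries.coeff j A|) = fun j => PowerSeries.coeff j A :=
    funext fun j => abs_of_nonneg (hA.nonneg j)
  rw [CoeffSummable, h]
  exact hA.summable

/-- With `x = ab(1 - cos u)`, the squared norm is `(a+b)² - 2x`, while the square of the bound is
`(a+b)² - 2(a+b)x + x²`, which is no smaller because `a + b ≤ 1`. -/
lemma norm_add_mul_exp_le {a b u : ℝ} (ha : 0 ≤ a) (hb : 0 ≤ b) (hab : a + b ≤ 1) :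
    ‖(a : ℂ) + b * Complex.exp (u * Complex.I)‖ ≤ a + b - a * b * (1 - Real.cos u) := by
  have hc := Real.neg_one_le_cos u
  have hc' := Real.cos_le_one u
  have hx : 0 ≤ a * b * (1 - Real.cos u) := mul_nonneg (mul_nonneg ha hb) (by linarith)
  have hR : 0 ≤ a + b - a * b * (1 - Real.cos u) := by
    nlinarith [mul_nonneg ha hb, mul_nonneg (mul_nonneg ha hb) (by linarith : 0 ≤ 1 + Real.cos u),
      sq_nonneg (a - b), mul_nonneg (add_nonneg ha hb) (by linarith : 0 ≤ 1 - (a + b))]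
  have e : (a : ℂ) + b * Complex.exp (u * Complex.I) =
      ((a + b * Real.cos u : ℝ) : ℂ) + ((b * Real.sin u : ℝ) : ℂ) * Complex.I := by
    rw [Complex.exp_mul_I]
    push_cast
    ring
  refine le_of_sq_le_sq ?_ hR
  rw [e, ← Complex.normSq_eq_norm_sq, Complex.normSq_add_mul_I]
  have e2 : (a + b * Real.cos u) ^ 2 + (b * Real.sin u) ^ 2 =
      (a + b) ^ 2 - 2 * (a * b * (1 - Real.cos u)) := by
    linear_combination b ^ 2 * Real.sin_sq_add_cos_sq u
  rw [e2]
  generalize a * b * (1 - Real.cos u) = x at *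
  nlinarith [mul_nonneg hx (by linarith : 0 ≤ 1 - (a + b)), sq_nonneg x]

lemma IsSubLaw.norm_charSum_sub_le {A : PowerSeries ℝ} (hA : IsSubLaw A) (S : Finset ℕ) (θ : ℝ) :
    ‖charSum A θ - ∑ j ∈ S, (PowerSeries.coeff j A : ℝ) * Complex.exp ((j : ℂ) * θ * Complex.I)‖ ≤
      1 - ∑ j ∈ S, PowerSeries.coeff j A := by
  have hs := hA.coeffSummable.summable_norm θ
  rw [charSum, ← hs.of_norm.sum_add_tsum_subtype_compl S, add_sub_cancel_left]
  have h1 := hA.summable.sum_add_tsum_subtype_compl S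
  have h2 : ∑' x : {x // x ∉ S}, PowerSeries.coeff (x : ℕ) A ≤
      1 - ∑ j ∈ S, PowerSeries.coeff j A := by
    linarith [hA.tsum_le]
  refine le_trans (tsum_of_norm_bounded (hA.summable.subtype _).hasSum fun x => ?_) h2
  rw [norm_charSum_term, abs_of_nonneg (hA.nonneg _)]
  rfl

/-- The masses at `0` and `d` interfere, and the rest is bounded by its mass; then `1 - y ≤
exp(-y)`. Only these two coefficients enter the decay, so it survives any truncation that keeps
them. -/
lemma IsSubLaw.norm_charSum_le {A : PowerSeries ℝ} (hA : IsSubLaw A) {d : ℕ} (hd : d ≠ 0) (θ : ℝ) :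
    ‖charSum A θ‖ ≤
      Real.exp (-(PowerSeries.coeff 0 A * PowerSeries.coeff d A * (1 - Real.cos (d * θ)))) := by
  have hS := hA.norm_charSum_sub_le {0, d} θ
  have hle : ∑ j ∈ ({0, d} : Finset ℕ), PowerSeries.coeff j A ≤ 1 :=
    (hA.summable.sum_le_tsum _ fun j _ => hA.nonneg j).trans hA.tsum_le
  rw [Finset.sum_pair hd.symm] at hS hle
  rw [Finset.sum_pair hd.symm] at hS
  have hn := norm_add_mul_exp_le (u := d * θ) (hA.nonneg 0) (hA.nonneg d) hle
  have e : ((PowerSeries.coeff 0 A : ℝ) : ℂ) * Complex.exp (((0 : ℕ) : ℂ) * θ * Complex.I) +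
      ((PowerSeries.coeff d A : ℝ) : ℂ) * Complex.exp ((d : ℂ) * θ * Complex.I) =
      ((PowerSeries.coeff 0 A : ℝ) : ℂ) +
      ((PowerSeries.coeff d A : ℝ) : ℂ) * Complex.exp (((d * θ : ℝ) : ℂ) * Complex.I) := by
    push_cast
    simp
  rw [e] at hS
  have h1 := norm_le_norm_add_norm_sub' (charSum A θ) (((PowerSeries.coeff 0 A : ℝ) : ℂ) +
      ((PowerSeries.coeff d A : ℝ) : ℂ) * Complex.exp (((d * θ : ℝ) : ℂ) * Complex.I))
  have h2 := Real.add_one_le_exp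
    (-(PowerSeries.coeff 0 A * PowerSeries.coeff d A * (1 - Real.cos (d * θ))))
  linarith

lemma IsSubLaw.norm_charSum_le_one {A : PowerSeries ℝ} (hA : IsSubLaw A) (θ : ℝ) :
    ‖charSum A θ‖ ≤ 1 := by
  simpa using hA.norm_charSum_sub_le ∅ θ

lemma IsSubLaw.norm_one_sub_charSum_le {A : PowerSeries ℝ} (hA : IsSubLaw A) (θ : ℝ) :
    ‖1 - charSum A θ‖ ≤ 2 * (1 - PowerSeries.coeff 0 A) := by
  have hS := hA.norm_charSum_sub_le {0} θ
  have hle : ∑ j ∈ ({0} : Finset ℕ), PowerSeries.coeff j A ≤ 1 :=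
    (hA.summable.sum_le_tsum _ fun j _ => hA.nonneg j).trans hA.tsum_le
  rw [Finset.sum_singleton] at hS hle
  rw [Finset.sum_singleton] at hS
  simp only [Nat.cast_zero, zero_mul, Complex.exp_zero, mul_one] at hS
  have h3 : ‖(1 : ℂ) - ((PowerSeries.coeff 0 A : ℝ) : ℂ)‖ = 1 - PowerSeries.coeff 0 A := by
    rw [show (1 : ℂ) - ((PowerSeries.coeff 0 A : ℝ) : ℂ) = ((1 - PowerSeries.coeff 0 A : ℝ) : ℂ) by
      push_cast; rfl, Complex.norm_real, Real.norm_of_nonneg (by linarith)]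
  have h4 := norm_sub_le ((1 : ℂ) - ((PowerSeries.coeff 0 A : ℝ) : ℂ))
    (charSum A θ - ((PowerSeries.coeff 0 A : ℝ) : ℂ))
  rw [sub_sub_sub_cancel_right] at h4
  linarith

/-- Two laws differ on the unit circle by at most the missing mass. -/
lemma norm_charSum_sub_charSum_le {A B : PowerSeries ℝ} (hA : IsSubLaw A) (hB : IsSubLaw B)
    (hBA : ∀ j, PowerSeries.coeff j B ≤ PowerSeries.coeff j A) (θ : ℝ) :
    ‖charSum A θ - charSum B θ‖ ≤
      ∑' j, (PowerSeries.coeff j A - PowerSeries.coeff j B) := by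
  rw [charSum, charSum, ← (hA.coeffSummable.summable_norm θ).of_norm.tsum_sub
    (hB.coeffSummable.summable_norm θ).of_norm]
  refine tsum_of_norm_bounded (hA.summable.sub hB.summable).hasSum fun j => ?_
  rw [← sub_mul, norm_mul, norm_exp_mul_mul_I, mul_one, ← Complex.ofReal_sub, Complex.norm_real,
    Real.norm_of_nonneg (by linarith [hBA j])]

lemma integral_exp_neg_mul_sq_le {b : ℝ} (hb : 0 < b) {x y : ℝ} (hxy : x ≤ y) :
    ∫ θ in x..y, Real.exp (-b * θ ^ 2) ≤ √(Real.pi / b) := by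
  rw [← integral_gaussian, intervalIntegral.integral_of_le hxy]
  exact MeasureTheory.setIntegral_le_integral (integrable_exp_neg_mul_sq hb)
    (Eventually.of_forall fun θ => (Real.exp_pos _).le)

/-- The integrand has `d` equal peaks on the circle, each narrower by a factor `d`, so `d`
disappears. One peak is compared with a Gaussian, using `cos u ≤ 1 - 2u²/π²`; the constant `4` comes
from `π³/2 ≤ 16`. -/
lemma integral_exp_neg_one_sub_cos_le {d : ℕ} (hd : d ≠ 0) {b : ℝ} (hb : 0 < b) :
    ∫ θ in (-Real.pi)..Real.pi, Real.exp (-(b * (1 - Real.cos (d * θ)))) ≤ 4 / √b := by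
  have hd' : (d : ℝ) ≠ 0 := by exact_mod_cast hd
  set g : ℝ → ℝ := fun u => Real.exp (-(b * (1 - Real.cos u))) with hg
  have hper : Function.Periodic g (2 * Real.pi) := fun u => by simp [hg]
  have e1 : ∫ θ in (-Real.pi)..Real.pi, g (d * θ) = ∫ u in (-Real.pi)..Real.pi, g u := by
    rw [intervalIntegral.integral_comp_mul_left g hd']
    have h := hper.intervalIntegral_add_zsmul_eq d (-(d * Real.pi))
      (fun t₁ t₂ => Continuous.intervalIntegrable (by fun_prop) _ _)
    have h' := hper.intervalIntegral_add_eq (-(d * Real.pi)) (-Real.pi)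
    rw [show -(d * Real.pi) + (d : ℤ) • (2 * Real.pi) = d * Real.pi by
      rw [zsmul_eq_mul]; push_cast; ring] at h
    rw [show (d : ℝ) * -Real.pi = -(d * Real.pi) by ring, h, h',
      show -Real.pi + 2 * Real.pi = Real.pi by ring, zsmul_eq_mul, smul_eq_mul]
    push_cast
    field_simp
  have hpi := Real.pi_pos
  have hb' : 0 < 2 / Real.pi ^ 2 * b := by positivity
  calc ∫ θ in (-Real.pi)..Real.pi, g (d * θ) = ∫ u in (-Real.pi)..Real.pi, g u := e1
    _ ≤ ∫ u in (-Real.pi)..Real.pi, Real.exp (-(2 / Real.pi ^ 2 * b) * u ^ 2) := by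
        refine intervalIntegral.integral_mono_on (by linarith)
          (Continuous.intervalIntegrable (by fun_prop) _ _)
          (Continuous.intervalIntegrable (by fun_prop) _ _) fun u hu => ?_
        have hc := Real.cos_le_one_sub_mul_cos_sq (x := u) (abs_le.2 hu)
        refine Real.exp_le_exp.2 ?_
        nlinarith
    _ ≤ √(Real.pi / (2 / Real.pi ^ 2 * b)) := integral_exp_neg_mul_sq_le hb' (by linarith)
    _ ≤ 4 / √b := by
        rw [show Real.pi / (2 / Real.pi ^ 2 * b) = Real.pi ^ 3 / 2 / b by field_simp,
          Real.sqrt_div (by positivity)]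
        refine div_le_div_of_nonneg_right ?_ (Real.sqrt_nonneg b)
        rw [Real.sqrt_le_left (by norm_num)]
        have h : Real.pi ≤ 3.15 := Real.pi_lt_d2.le
        have : Real.pi ^ 3 ≤ 3.15 ^ 3 := pow_le_pow_left₀ hpi.le h 3
        norm_num at this ⊢
        linarith

lemma norm_pow_sub_pow_le {x y : ℂ} {g : ℝ} {N : ℕ} (hx : ‖x‖ ≤ g) (hy : ‖y‖ ≤ g) :
    ‖x ^ N - y ^ N‖ ≤ N * (‖x - y‖ * g ^ (N - 1)) := by
  have hg : 0 ≤ g := (norm_nonneg _).trans hx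
  rw [← (Commute.all x y).geom_sum₂_mul N, norm_mul]
  have : ‖∑ i ∈ Finset.range N, x ^ i * y ^ (N - 1 - i)‖ ≤ N * g ^ (N - 1) := by
    refine (norm_sum_le_of_le (f := fun i => x ^ i * y ^ (N - 1 - i)) _
      (n := fun _ => g ^ (N - 1)) fun i hi => ?_).trans (by simp)
    rw [Finset.mem_range] at hi
    rw [norm_mul, norm_pow, norm_pow]
    calc ‖x‖ ^ i * ‖y‖ ^ (N - 1 - i) ≤ g ^ i * g ^ (N - 1 - i) := by gcongr
      _ = g ^ (N - 1) := by rw [← pow_add]; congr 1; omega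
  calc _ ≤ (N * g ^ (N - 1)) * ‖x - y‖ := mul_le_mul_of_nonneg_right this (norm_nonneg _)
    _ = _ := by ring

/-- Third order Taylor bound for the imaginary exponential. -/
lemma norm_exp_mul_I_sub_le (x : ℝ) :
    ‖Complex.exp (x * Complex.I) - 1 - x * Complex.I + x ^ 2 / 2‖ ≤ 4 * |x| ^ 3 := by
  rcases le_or_gt |x| 1 with h | h
  · have hb := Complex.exp_bound (x := (x : ℂ) * Complex.I) (n := 3)
      (by simpa using h) (by norm_num)
    have e : ∑ j ∈ Finset.range 3, ((x : ℂ) * Complex.I) ^ j / (j ! : ℂ) =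
        1 + x * Complex.I - x ^ 2 / 2 := by
      simp [Finset.sum_range_succ, Nat.factorial, mul_pow]
      ring
    rw [e] at hb
    rw [show Complex.exp (x * Complex.I) - 1 - x * Complex.I + x ^ 2 / 2 =
      Complex.exp (x * Complex.I) - (1 + x * Complex.I - x ^ 2 / 2) by ring]
    refine hb.trans ?_
    have hx : ‖(x : ℂ) * Complex.I‖ = |x| := by simp
    rw [hx]
    have h0 : 0 ≤ |x| ^ 3 := by positivity
    norm_num [Nat.factorial]
    nlinarith
  · have h1 : ‖Complex.exp (x * Complex.I)‖ = 1 := Complex.norm_exp_ofReal_mul_I x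
    have h2 : ‖(x : ℂ) * Complex.I‖ = |x| := by simp
    have h3 : ‖(x : ℂ) ^ 2 / 2‖ = |x| ^ 2 / 2 := by simp
    have h4 := norm_add_le (Complex.exp (x * Complex.I) - 1 - x * Complex.I) ((x : ℂ) ^ 2 / 2)
    have h5 := norm_sub_le (Complex.exp (x * Complex.I) - 1) (x * Complex.I)
    have h6 := norm_sub_le (Complex.exp (x * Complex.I)) 1
    rw [norm_one] at h6
    have h7 : |x| ≤ |x| ^ 2 := by nlinarith
    have h8 : |x| ^ 2 ≤ |x| ^ 3 := by nlinarith [sq_nonneg |x|]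
    linarith

/-! ### Sparse families of laws -/

/-- A family of laws on the natural numbers with mean `2 m / n` tending to zero, for which `d` is
the dominant nonzero value. -/
structure SparseFamily (P : ℕ → PowerSeries ℝ) (m : ℕ → ℕ) (d : ℕ) : Prop where
  d_ne : d ≠ 0
  tendsto_m : Tendsto m atTop atTop
  tendsto_div : Tendsto (fun n => (m n : ℝ) / n) atTop (𝓝 0)
  isSubLaw : ∀ᶠ n in atTop, IsSubLaw (P n)
  hasSum : ∀ᶠ n in atTop, HasSum (fun j => PowerSeries.coeff j (P n)) 1
  tendsto_zero : Tendsto (fun n => PowerSeries.coeff 0 (P n)) atTop (𝓝 1)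
  le_coeff : ∃ c > 0, ∀ᶠ n in atTop, c * (m n : ℝ) ≤ n * PowerSeries.coeff d (P n)
  mean : ∀ᶠ n in atTop,
    HasSum (fun j : ℕ => (j : ℝ) * PowerSeries.coeff j (P n)) (2 * (m n : ℝ) / n)
  third : ∃ C, ∀ᶠ n in atTop, Summable (fun j : ℕ => (j : ℝ) ^ 3 * PowerSeries.coeff j (P n)) ∧
    ∑' j : ℕ, (j : ℝ) ^ 3 * PowerSeries.coeff j (P n) ≤ C * ((m n : ℝ) / n)
  tail : ∀ t, (∀ n, PowerSeries.coeff t (P n) = 0) ∨ ∃ C, ∀ᶠ n in atTop,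
    ∑' j, PowerSeries.coeff (j + t) (P n) ≤ C * PowerSeries.coeff t (P n)

namespace SparseFamily

variable {P : ℕ → PowerSeries ℝ} {m : ℕ → ℕ} {d : ℕ}

lemma tendsto_m_real (h : SparseFamily P m d) : Tendsto (fun n => (m n : ℝ)) atTop atTop :=
  tendsto_natCast_atTop_atTop.comp h.tendsto_m

lemma tendsto_sqrt (h : SparseFamily P m d) : Tendsto (fun n => √(m n : ℝ)) atTop atTop :=
  Real.tendsto_sqrt_atTop.comp h.tendsto_m_real

/-- The exponential bound for characteristic functions, in terms of the number of edges. -/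
lemma exists_exp_pow_le (h : SparseFamily P m d) : ∃ c > 0, ∀ᶠ n in atTop, ∀ N : ℕ, n ≤ 2 * N →
    ∀ θ : ℝ, Real.exp (-(PowerSeries.coeff 0 (P n) * PowerSeries.coeff d (P n) *
      (1 - Real.cos (d * θ)))) ^ N ≤ Real.exp (-(c * m n * (1 - Real.cos (d * θ)))) := by
  obtain ⟨c, hc, hcd⟩ := h.le_coeff
  -- One factor `1/2` comes from `N ≥ n/2` and the other from the mass at `0` being at least `1/2`.
  refine ⟨c / 4, by positivity, ?_⟩
  have h0 : ∀ᶠ n in atTop, 1 / 2 ≤ PowerSeries.coeff 0 (P n) :=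
    h.tendsto_zero.eventually_const_le (by norm_num)
  filter_upwards [hcd, h0, h.isSubLaw] with n h1 h2 h3 N hN θ
  rw [← Real.exp_nat_mul]
  refine Real.exp_le_exp.2 ?_
  have hx : 0 ≤ 1 - Real.cos (d * θ) := by linarith [Real.cos_le_one (d * θ)]
  have hN' : (n : ℝ) ≤ 2 * N := by exact_mod_cast hN
  have hd := h3.nonneg d
  have key : c / 4 * m n ≤ N * (PowerSeries.coeff 0 (P n) * PowerSeries.coeff d (P n)) := by
    have h4 : (n : ℝ) * PowerSeries.coeff d (P n) ≤ 2 * N * PowerSeries.coeff d (P n) :=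
      mul_le_mul_of_nonneg_right hN' hd
    have h5 : 1 / 2 * (N * PowerSeries.coeff d (P n)) ≤
        PowerSeries.coeff 0 (P n) * (N * PowerSeries.coeff d (P n)) :=
      mul_le_mul_of_nonneg_right h2 (by positivity)
    linarith
  nlinarith [mul_le_mul_of_nonneg_right key hx]

/-- A uniform estimate for coefficients from a bound on the difference of characteristic
functions. -/
lemma abs_coeffZ_sub_le_of_norm_le {A B : PowerSeries ℝ} (hA : CoeffSummable A)
    (hB : CoeffSummable B) (hd : d ≠ 0) {b x : ℝ} (hb : 0 < b) (hx : 0 < x) {ρ : ℝ}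
    (s t : ℤ) (h : ∀ θ, ‖charSum A θ * Complex.exp (-((s : ℂ) * θ * Complex.I)) -
      charSum B θ * Complex.exp (-((t : ℂ) * θ * Complex.I))‖ ≤
        ρ * Real.exp (-(b * x * (1 - Real.cos (d * θ))))) :
    |coeffZ A s - coeffZ B t| ≤ ρ * (4 / √b) / √x := by
  have hρ : 0 ≤ ρ := nonneg_of_mul_nonneg_left ((norm_nonneg _).trans (h 0)) (Real.exp_pos _)
  refine (abs_coeffZ_sub_coeffZ_le hA hB s t (by fun_prop) h).trans ?_
  rw [intervalIntegral.integral_const_mul, mul_div_assoc, div_div, ← Real.sqrt_mul hb.le]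
  exact mul_le_mul_of_nonneg_left (integral_exp_neg_one_sub_cos_le hd (mul_pos hb hx)) hρ

lemma norm_exp_neg_mul_I (s : ℤ) (θ : ℝ) : ‖Complex.exp (-((s : ℂ) * θ * Complex.I))‖ = 1 := by
  rw [show -((s : ℂ) * θ * Complex.I) = ((-(s * θ) : ℝ) : ℂ) * Complex.I by push_cast; ring,
    Complex.norm_exp_ofReal_mul_I]

/-- Coefficients of powers are at most of order `1 / √m`. -/
lemma exists_coeffZ_le (h : SparseFamily P m d) : ∃ C > 0, ∀ᶠ n in atTop, ∀ N : ℕ, n ≤ 2 * N →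
    ∀ s : ℤ, coeffZ (P n ^ N) s ≤ C / √(m n) := by
  obtain ⟨c, hc, hb⟩ := h.exists_exp_pow_le
  refine ⟨1 * (4 / √c), by positivity, ?_⟩
  filter_upwards [hb, h.isSubLaw, h.tendsto_m.eventually_gt_atTop 0] with n hb hP hm N hN s
  have hm' : (0 : ℝ) < m n := by exact_mod_cast hm
  have h0 : CoeffSummable 0 := by simp [CoeffSummable]
  -- Comparison with the zero series turns the difference estimate into an upper bound.
  have h1 := abs_coeffZ_sub_le_of_norm_le (hP.coeffSummable.pow N) h0 h.d_ne hc hm' s 0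
    (ρ := 1) fun θ => by
      rw [show charSum 0 θ = 0 by simp [charSum], zero_mul, sub_zero, norm_mul, norm_exp_neg_mul_I,
        mul_one, charSum_pow hP.coeffSummable, norm_pow, one_mul]
      exact (pow_le_pow_left₀ (norm_nonneg _) (hP.norm_charSum_le h.d_ne θ) N).trans (hb N hN θ)
  rw [show coeffZ 0 0 = 0 by simp [coeffZ], sub_zero] at h1
  exact (le_abs_self _).trans h1

/-- Removing a bounded number of factors changes the coefficients only slightly. -/
lemma abs_coeffZ_pow_sub_sub_le (h : SparseFamily P m d) (i : ℕ) {η : ℝ} (hη : 0 < η) :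
    ∀ᶠ n in atTop, ∀ s : ℤ, |coeffZ (P n ^ (n - i)) s - coeffZ (P n ^ n) s| ≤ η / √(m n) := by
  obtain ⟨c, hc, hb⟩ := h.exists_exp_pow_le
  have hlim : Tendsto (fun n => (i * (2 * (1 - PowerSeries.coeff 0 (P n)))) * (4 / √c)) atTop
      (𝓝 ((i * (2 * (1 - 1))) * (4 / √c))) :=
    (((h.tendsto_zero.const_sub 1).const_mul 2).const_mul (i : ℝ)).mul_const _
  rw [sub_self, mul_zero, mul_zero, zero_mul] at hlim
  filter_upwards [hb, h.isSubLaw, h.tendsto_m.eventually_gt_atTop 0, eventually_ge_atTop (2 * i),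
    hlim.eventually_le_const hη] with n hb hP hm hi hlim s
  have hm' : (0 : ℝ) < m n := by exact_mod_cast hm
  have h1 := abs_coeffZ_sub_le_of_norm_le (hP.coeffSummable.pow (n - i)) (hP.coeffSummable.pow n)
    h.d_ne hc hm' s s (ρ := i * (2 * (1 - PowerSeries.coeff 0 (P n)))) fun θ => by
      rw [← sub_mul, norm_mul, norm_exp_neg_mul_I, mul_one, charSum_pow hP.coeffSummable,
        charSum_pow hP.coeffSummable, show charSum (P n) θ ^ n =
          charSum (P n) θ ^ (n - i) * charSum (P n) θ ^ i by rw [← pow_add]; congr 1; omega,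
        ← mul_one_sub, norm_mul, norm_pow, mul_comm]
      refine mul_le_mul ?_ ((pow_le_pow_left₀ (norm_nonneg _)
        (hP.norm_charSum_le h.d_ne θ) _).trans (hb _ (by omega) θ)) (by positivity) ?_
      -- The removed factors are close to `1` on the whole circle, as the mass at `0` tends to `1`.
      -- The remaining `n - i ≥ n/2` factors supply the decay.
      · have h2 := norm_pow_sub_pow_le (x := 1) (y := charSum (P n) θ) (N := i) (g := 1)
          (by simp) (hP.norm_charSum_le_one θ)
        rw [one_pow, one_pow, mul_one] at h2
        exact h2.trans (mul_le_mul_of_nonneg_left (hP.norm_one_sub_charSum_le θ)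
          (Nat.cast_nonneg _))
      · exact mul_nonneg (Nat.cast_nonneg _) ((norm_nonneg _).trans (hP.norm_one_sub_charSum_le θ))
  exact h1.trans (div_le_div_of_nonneg_right hlim (Real.sqrt_nonneg _))

/-- AM–GM gives `√(2x) ≤ η + x/(2η) ≤ η(1 + bx)`, and half of the exponential absorbs `1 + bx`. This
makes the factor `|e^(idθ) - 1|` harmless when `b` is large. -/
lemma sqrt_two_mul_mul_exp_le {x b η : ℝ} (hx : 0 ≤ x) (hη : 0 < η)
    (hbη : 1 ≤ 2 * η ^ 2 * b) :
    √(2 * x) * Real.exp (-(b * x)) ≤ 2 * η * Real.exp (-(b / 2 * x)) := by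
  have h1 : √(2 * x) ≤ η + x / (2 * η) := by
    rw [Real.sqrt_le_left (by positivity)]
    have : (η + x / (2 * η)) ^ 2 = (η - x / (2 * η)) ^ 2 + 2 * x := by field_simp; ring
    nlinarith [sq_nonneg (η - x / (2 * η))]
  have h2 : b / 2 * x + 1 ≤ Real.exp (b / 2 * x) := Real.add_one_le_exp _
  have h3 : x / (2 * η) ≤ η * (b * x) := by
    rw [div_le_iff₀ (by positivity)]
    nlinarith
  have h4 : Real.exp (-(b * x)) = Real.exp (-(b / 2 * x)) * Real.exp (-(b / 2 * x)) := by
    rw [← Real.exp_add]; ring_nf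
  have h5 : Real.exp (b / 2 * x) * Real.exp (-(b / 2 * x)) = 1 := by
    rw [← Real.exp_add]; simp
  rw [h4, ← mul_assoc]
  refine mul_le_mul_of_nonneg_right ?_ (Real.exp_pos _).le
  have h6 := Real.exp_pos (-(b / 2 * x))
  calc √(2 * x) * Real.exp (-(b / 2 * x))
      ≤ (2 * η * Real.exp (b / 2 * x)) * Real.exp (-(b / 2 * x)) := by
        refine mul_le_mul_of_nonneg_right ?_ h6.le
        nlinarith
    _ = 2 * η := by rw [mul_assoc, h5, mul_one]

lemma norm_exp_sub_one (u : ℝ) :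
    ‖Complex.exp (u * Complex.I) - 1‖ = √(2 * (1 - Real.cos u)) := by
  rw [← Real.sqrt_sq (norm_nonneg (Complex.exp (u * Complex.I) - 1)),
    ← Complex.normSq_eq_norm_sq]
  congr 1
  rw [show Complex.exp (u * Complex.I) - 1 =
    ((Real.cos u - 1 : ℝ) : ℂ) + ((Real.sin u : ℝ) : ℂ) * Complex.I by
      rw [Complex.exp_mul_I]; push_cast; ring, Complex.normSq_add_mul_I]
  nlinarith [Real.sin_sq_add_cos_sq u]

/-- Coefficients of powers vary slowly along steps of length `d`. -/
lemma abs_coeffZ_add_sub_le (h : SparseFamily P m d) {η : ℝ} (hη : 0 < η) :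
    ∀ᶠ n in atTop, ∀ s : ℤ, |coeffZ (P n ^ n) (s + d) - coeffZ (P n ^ n) s| ≤ η / √(m n) := by
  obtain ⟨c, hc, hb⟩ := h.exists_exp_pow_le
  -- Half of the decay rate `c` is spent on the factor `√(2(1 - cos dθ))`; `ρ` is chosen so that the
  -- remaining integral gives exactly `η / √m`.
  set ρ : ℝ := η / (2 * (4 / √(c / 2))) with hρ
  have hρ0 : 0 < ρ := by positivity
  have hlim : Tendsto (fun n => 2 * ρ ^ 2 * (c * (m n : ℝ))) atTop atTop :=
    (h.tendsto_m_real.const_mul_atTop hc).const_mul_atTop (by positivity)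
  filter_upwards [hb, h.isSubLaw, h.tendsto_m.eventually_gt_atTop 0,
    hlim.eventually_ge_atTop 1] with n hb hP hm hlim s
  have hm' : (0 : ℝ) < m n := by exact_mod_cast hm
  have h1 := abs_coeffZ_sub_le_of_norm_le (b := c / 2) (hP.coeffSummable.pow n)
    (hP.coeffSummable.pow n) h.d_ne (by positivity) hm' (s + d) s (ρ := 2 * ρ) fun θ => by
      have e : Complex.exp (-(((s + d : ℤ) : ℂ) * θ * Complex.I)) =
          Complex.exp (-((s : ℂ) * θ * Complex.I)) *
            Complex.exp (((-(d * θ) : ℝ) : ℂ) * Complex.I) := by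
        rw [← Complex.exp_add]
        congr 1
        push_cast
        ring
      have hx : 0 ≤ 1 - Real.cos (d * θ) := by linarith [Real.cos_le_one (d * θ)]
      rw [e, ← mul_sub, ← mul_sub_one, norm_mul, norm_mul, norm_exp_neg_mul_I, one_mul,
        norm_exp_sub_one, Real.cos_neg, charSum_pow hP.coeffSummable, norm_pow, mul_comm]
      refine (mul_le_mul_of_nonneg_left ((pow_le_pow_left₀ (norm_nonneg _)
        (hP.norm_charSum_le h.d_ne θ) _).trans (hb n (by omega) θ)) (Real.sqrt_nonneg _)).trans ?_
      refine (sqrt_two_mul_mul_exp_le hx hρ0 hlim).trans (le_of_eq ?_)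
      ring_nf
  refine h1.trans (le_of_eq ?_)
  rw [hρ]
  congr 1
  field_simp

/-- Removing a small part of the mass changes the coefficients only slightly. -/
lemma exists_abs_coeffZ_sub_le (h : SparseFamily P m d) : ∃ C > 0, ∀ᶠ n in atTop,
    ∀ A : PowerSeries ℝ, IsSubLaw A → (∀ j, PowerSeries.coeff j A ≤ PowerSeries.coeff j (P n)) →
      PowerSeries.coeff 0 A = PowerSeries.coeff 0 (P n) →
      PowerSeries.coeff d A = PowerSeries.coeff d (P n) → ∀ s : ℤ,
      |coeffZ (P n ^ n) s - coeffZ (A ^ n) s| ≤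
        C * (n * ∑' j, (PowerSeries.coeff j (P n) - PowerSeries.coeff j A)) / √(m n) := by
  obtain ⟨c, hc, hb⟩ := h.exists_exp_pow_le
  refine ⟨4 / √c, by positivity, ?_⟩
  filter_upwards [hb, h.isSubLaw, h.tendsto_m.eventually_gt_atTop 0, eventually_ge_atTop 2] with
    n hb hP hm hn A hA hle h0 hd s
  have hm' : (0 : ℝ) < m n := by exact_mod_cast hm
  have h1 := abs_coeffZ_sub_le_of_norm_le (hP.coeffSummable.pow n)
    (hA.coeffSummable.pow n) h.d_ne hc hm' s s
    (ρ := n * ∑' j, (PowerSeries.coeff j (P n) - PowerSeries.coeff j A)) fun θ => by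
      rw [← sub_mul, norm_mul, norm_exp_neg_mul_I, mul_one, charSum_pow hP.coeffSummable,
        charSum_pow hA.coeffSummable]
      have hA' := hA.norm_charSum_le h.d_ne θ
      rw [h0, hd] at hA'
      -- Both laws share the decay bound because their coefficients at `0` and `d` agree, so each of
      -- the `n` telescoping terms keeps `n - 1` decaying factors.
      refine (norm_pow_sub_pow_le (hP.norm_charSum_le h.d_ne θ) hA').trans ?_
      rw [← mul_assoc]
      have h2 := norm_charSum_sub_charSum_le hP hA hle θ
      exact mul_le_mul (mul_le_mul_of_nonneg_left h2 (Nat.cast_nonneg _))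
        (hb (n - 1) (by omega) θ) (by positivity)
        (mul_nonneg (Nat.cast_nonneg _) ((norm_nonneg _).trans h2))
  refine h1.trans (le_of_eq ?_)
  ring

end SparseFamily

/-! ### The central arc -/

/-- The value `j = 0` contributes at most `μ`, and for `j ≥ 1` centring only decreases. Hence
centred moments are controlled by the third moment plus the mean, both `O(m/n)` in a sparse family.
-/
lemma sq_abs_sub_bounds {j : ℕ} {μ : ℝ} (hμ : 0 ≤ μ) (hμ1 : μ ≤ 1) :
    ((j : ℝ) - μ) ^ 2 ≤ (j : ℝ) ^ 3 + μ ∧ |(j : ℝ) - μ| ^ 3 ≤ (j : ℝ) ^ 3 + μ := by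
  have hj0 : (0 : ℝ) ≤ j := Nat.cast_nonneg j
  have hμ2 : μ ^ 2 ≤ μ := by nlinarith
  have hμ3 : μ ^ 3 ≤ μ := by nlinarith [pow_nonneg hμ 2]
  have h3 : 0 ≤ (j : ℝ) ^ 3 := by positivity
  rcases Nat.eq_zero_or_pos j with rfl | hj
  · simp [abs_of_nonneg hμ, hμ2, hμ3]
  · have hj1 : (1 : ℝ) ≤ j := by exact_mod_cast hj
    have h0 : 0 ≤ (j : ℝ) - μ := by linarith
    rw [abs_of_nonneg h0]
    have h1 : (j : ℝ) - μ ≤ j := by linarith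
    have h2 : ((j : ℝ) - μ) ^ 2 ≤ (j : ℝ) ^ 2 := pow_le_pow_left₀ h0 h1 2
    have h4 : ((j : ℝ) - μ) ^ 3 ≤ (j : ℝ) ^ 3 := pow_le_pow_left₀ h0 h1 3
    have h5 : (j : ℝ) ^ 2 ≤ (j : ℝ) ^ 3 := pow_le_pow_right₀ hj1 (by norm_num)
    constructor <;> linarith

/-- Second order expansion of the centred characteristic function. -/
lemma IsSubLaw.exists_norm_charSum_sub_le {A : PowerSeries ℝ} (hA : IsSubLaw A)
    (h1 : HasSum (fun j => PowerSeries.coeff j A) 1) {μ : ℝ} (hμ : 0 ≤ μ) (hμ1 : μ ≤ 1)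
    (hmean : HasSum (fun j : ℕ => (j : ℝ) * PowerSeries.coeff j A) μ)
    (h3 : Summable fun j : ℕ => (j : ℝ) ^ 3 * PowerSeries.coeff j A) :
    ∃ v, 0 ≤ v ∧ v ≤ ∑' j : ℕ, (j : ℝ) ^ 3 * PowerSeries.coeff j A + μ ∧ ∀ θ : ℝ,
      ‖charSum A θ * Complex.exp (-(μ * θ * Complex.I)) - ((1 - v * θ ^ 2 / 2 : ℝ) : ℂ)‖ ≤
        4 * (∑' j : ℕ, (j : ℝ) ^ 3 * PowerSeries.coeff j A + μ) * |θ| ^ 3 := by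
  set M3 := ∑' j : ℕ, (j : ℝ) ^ 3 * PowerSeries.coeff j A with hM3
  have hbd : HasSum (fun j : ℕ => ((j : ℝ) ^ 3 + μ) * PowerSeries.coeff j A) (M3 + μ) := by
    have := h3.hasSum.add (h1.mul_left μ)
    rw [mul_one] at this
    simpa only [add_mul] using this
  have hvs : Summable fun j : ℕ => ((j : ℝ) - μ) ^ 2 * PowerSeries.coeff j A :=
    Summable.of_nonneg_of_le (fun j => mul_nonneg (sq_nonneg _) (hA.nonneg j))
      (fun j => mul_le_mul_of_nonneg_right (sq_abs_sub_bounds hμ hμ1).1 (hA.nonneg j)) hbd.summable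
  refine ⟨∑' j : ℕ, ((j : ℝ) - μ) ^ 2 * PowerSeries.coeff j A,
    tsum_nonneg fun j => mul_nonneg (sq_nonneg _) (hA.nonneg j), ?_, fun θ => ?_⟩
  · exact hasSum_le (fun j => mul_le_mul_of_nonneg_right (sq_abs_sub_bounds hμ hμ1).1 (hA.nonneg j))
      hvs.hasSum hbd
  · set v := ∑' j : ℕ, ((j : ℝ) - μ) ^ 2 * PowerSeries.coeff j A with hv
    set F : ℕ → ℂ := fun j => ((PowerSeries.coeff j A : ℝ) : ℂ) *
      (Complex.exp ((((j : ℝ) - μ) * θ : ℝ) * Complex.I) - 1 -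
        (((j : ℝ) - μ) * θ : ℝ) * Complex.I + (((j : ℝ) - μ) * θ : ℝ) ^ 2 / 2) with hF
    have e1 := ((hA.coeffSummable.summable_norm θ).of_norm.hasSum).mul_right
      (Complex.exp (-(μ * θ * Complex.I)))
    have e2 := Complex.hasSum_ofReal.2 h1
    have hc0 : HasSum (fun j : ℕ => ((j : ℝ) - μ) * PowerSeries.coeff j A) 0 := by
      have := hmean.sub (h1.mul_left μ)
      rw [mul_one, sub_self] at this
      simpa only [sub_mul] using this
    have e3 := (Complex.hasSum_ofReal.2 hc0).mul_right (θ * Complex.I)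
    have e4 := (Complex.hasSum_ofReal.2 hvs.hasSum).mul_right ((θ : ℂ) ^ 2 / 2)
    rw [← hv] at e4
    have hsum : HasSum F (charSum A θ * Complex.exp (-(μ * θ * Complex.I)) -
        ((1 - v * θ ^ 2 / 2 : ℝ) : ℂ)) := by
      convert! ((e1.sub e2).sub e3).add e4 using 1
      · funext j
        have hexp : Complex.exp ((j : ℂ) * θ * Complex.I) * Complex.exp (-(μ * θ * Complex.I)) =
            Complex.exp ((((j : ℝ) - μ) * θ : ℝ) * Complex.I) := by
          rw [← Complex.exp_add]
          congr 1
          push_cast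
          ring
        rw [hF]
        beta_reduce
        rw [mul_assoc (((PowerSeries.coeff j A : ℝ) : ℂ)), hexp]
        push_cast
        ring
      · rw [charSum]
        push_cast
        ring
    rw [← hsum.tsum_eq]
    refine tsum_of_norm_bounded (hbd.mul_right (4 * |θ| ^ 3)) (fun j => ?_) |>.trans
      (le_of_eq (by ring))
    rw [hF]
    beta_reduce
    rw [norm_mul, Complex.norm_real, Real.norm_of_nonneg (hA.nonneg j)]
    have hT := norm_exp_mul_I_sub_le (((j : ℝ) - μ) * θ)
    rw [abs_mul, mul_pow] at hT
    have h5 := (sq_abs_sub_bounds (j := j) hμ hμ1).2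
    calc _ ≤ PowerSeries.coeff j A * (4 * (|(j : ℝ) - μ| ^ 3 * |θ| ^ 3)) :=
          mul_le_mul_of_nonneg_left hT (hA.nonneg j)
      _ ≤ PowerSeries.coeff j A * (4 * (((j : ℝ) ^ 3 + μ) * |θ| ^ 3)) := by
          have := hA.nonneg j
          gcongr
      _ = _ := by ring

/-- The part of the coefficient integral with arguments in `[-a, a]`. -/
noncomputable def arcOf (A : PowerSeries ℝ) (N : ℕ) (s : ℤ) (a : ℝ) : ℂ :=
  ∫ θ in (-a)..a, charSum A θ ^ N * Complex.exp (-((s : ℂ) * θ * Complex.I))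

lemma arcOf_pi {A : PowerSeries ℝ} (hA : CoeffSummable A) (N : ℕ) (s : ℤ) :
    arcOf A N s Real.pi = 2 * Real.pi * (coeffZ (A ^ N) s : ℂ) := by
  rw [← integral_charSum (hA.pow N), arcOf]
  simp only [charSum_pow hA]

namespace SparseFamily

variable {P : ℕ → PowerSeries ℝ} {m : ℕ → ℕ} {d : ℕ}

/-- Moment bounds for a sparse family. -/
lemma exists_moment_bound (h : SparseFamily P m d) : ∃ C > 0, ∀ᶠ n in atTop, ∃ v : ℝ, 0 ≤ v ∧
    v ≤ C * (m n / n) ∧ ∀ θ : ℝ,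
      ‖charSum (P n) θ * Complex.exp (-((2 * (m n : ℝ) / n : ℝ) * θ * Complex.I)) -
        ((1 - v * θ ^ 2 / 2 : ℝ) : ℂ)‖ ≤ C * (m n / n) * |θ| ^ 3 := by
  obtain ⟨C, hC⟩ := h.third
  refine ⟨4 * (|C| + 2), by positivity, ?_⟩
  have hsmall : ∀ᶠ n in atTop, (m n : ℝ) / n ≤ 1 / 2 :=
    h.tendsto_div.eventually_le_const (by norm_num)
  filter_upwards [hC, h.isSubLaw, h.hasSum, h.mean, hsmall] with n hC hP h1 hmean hs
  have hq : (0 : ℝ) ≤ (m n : ℝ) / n := by positivity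
  have e : 2 * (m n : ℝ) / n = 2 * ((m n : ℝ) / n) := by ring
  obtain ⟨v, hv0, hv, hθ⟩ := hP.exists_norm_charSum_sub_le h1 (by positivity)
    (by rw [e]; linarith) hmean hC.1
  have hb : ∑' j : ℕ, (j : ℝ) ^ 3 * PowerSeries.coeff j (P n) + 2 * (m n : ℝ) / n ≤
      (|C| + 2) * (m n / n) := by
    rw [e]
    have := mul_le_mul_of_nonneg_right (le_abs_self C) hq
    linarith [hC.2]
  have hC0 : 0 ≤ |C| * ((m n : ℝ) / n) := by positivity
  refine ⟨v, hv0, by linarith, fun θ => (hθ θ).trans ?_⟩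
  refine mul_le_mul_of_nonneg_right (by linarith) (by positivity)

set_option maxHeartbeats 1000000 in
/-- A pointwise lower bound for the integrand on the central arc. -/
lemma exists_arc_pointwise (h : SparseFamily P m d) : ∃ b > 0, ∃ C > 0, ∀ ρ > 0, ∀ᶠ n in atTop,
    ∀ θ : ℝ, |θ| ≤ Real.pi / (2 * d) → max 0 (1 - C * m n * θ ^ 2) -
      ρ * Real.exp (-(b * m n) * θ ^ 2) ≤
        (charSum (P n) θ ^ n * Complex.exp (-(((2 * m n : ℤ) : ℂ) * θ * Complex.I))).re := by
  obtain ⟨c, hc, hb⟩ := h.exists_exp_pow_le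
  obtain ⟨C, hC, hmom⟩ := h.exists_moment_bound
  have hd : (1 : ℝ) ≤ d := by exact_mod_cast Nat.one_le_iff_ne_zero.2 h.d_ne
  have hpi := Real.pi_pos
  -- The available Gaussian rate is `2b`. One `b` makes the tail beyond `mθ² = K` smaller than `ρ`;
  -- the other stays in the stated bound.
  set b : ℝ := c * (2 / Real.pi ^ 2) / 2 with hbdef
  have hb0 : 0 < b := by positivity
  refine ⟨b, hb0, C, hC, fun ρ hρ => ?_⟩
  -- the radius of the region in which the expansion is used
  obtain ⟨K, hK1, hK⟩ : ∃ K : ℝ, max 1 (1 / C) ≤ K ∧ Real.exp (-(b * K)) ≤ ρ := by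
    have ht : Tendsto (fun K : ℝ => Real.exp (-(b * K))) atTop (𝓝 0) :=
      Real.tendsto_exp_neg_atTop_nhds_zero.comp (tendsto_id.const_mul_atTop hb0)
    exact ((eventually_ge_atTop _).and (ht.eventually_le_const hρ)).exists
  have hKC : 1 ≤ C * K := by
    rw [mul_comm, ← div_le_iff₀ hC]
    exact (le_max_right _ _).trans hK1
  replace hK1 : 1 ≤ K := (le_max_left _ _).trans hK1
  have hlim : Tendsto (fun n => C * K ^ 2 * Real.exp (b * K) / √(m n)) atTop (𝓝 0) :=
    h.tendsto_sqrt.const_div_atTop _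
  have hlim2 : Tendsto (fun n : ℕ => C * K / (n : ℝ)) atTop (𝓝 0) :=
    tendsto_natCast_atTop_atTop.const_div_atTop _
  filter_upwards [hb, hmom, h.isSubLaw, h.tendsto_m.eventually_gt_atTop 0, eventually_gt_atTop 0,
    hlim.eventually_le_const hρ, hlim2.eventually_le_const one_pos] with
    n hb hmom hP hm hn hl1 hl2 θ hθ
  have hm' : (0 : ℝ) < m n := by exact_mod_cast hm
  have hn' : (0 : ℝ) < n := by exact_mod_cast hn
  have hsm : 0 < √(m n : ℝ) := Real.sqrt_pos.2 hm'
  obtain ⟨v, hv0, hv, hv2⟩ := hmom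
  set z : ℂ := charSum (P n) θ * Complex.exp (-((2 * (m n : ℝ) / n : ℝ) * θ * Complex.I)) with hz
  have hzn : charSum (P n) θ ^ n * Complex.exp (-(((2 * m n : ℤ) : ℂ) * θ * Complex.I)) =
      z ^ n := by
    rw [hz, mul_pow, ← Complex.exp_nat_mul]
    congr 2
    have : (n : ℂ) ≠ 0 := by exact_mod_cast hn.ne'
    push_cast
    field_simp
  rw [hzn]
  have hnz : ‖z‖ = ‖charSum (P n) θ‖ := by
    rw [hz, norm_mul, show -((2 * (m n : ℝ) / n : ℝ) * θ * Complex.I) =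
      ((-(2 * (m n : ℝ) / n * θ) : ℝ) : ℂ) * Complex.I by push_cast; ring,
      Complex.norm_exp_ofReal_mul_I, mul_one]
  have hz1 : ‖z‖ ≤ 1 := hnz ▸ hP.norm_charSum_le_one θ
  have hE := Real.exp_pos (-(b * m n) * θ ^ 2)
  rcases le_or_gt (m n * θ ^ 2) K with hsm2 | hbig
  · -- the central region
    set y : ℝ := 1 - v * θ ^ 2 / 2 with hy
    have hvθ : v * θ ^ 2 ≤ C * (m n / n) * θ ^ 2 := mul_le_mul_of_nonneg_right hv (sq_nonneg θ)
    have hvθ2 : C * (m n / n) * θ ^ 2 ≤ 1 := by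
      calc C * (m n / n) * θ ^ 2 = C * (m n * θ ^ 2) / n := by ring
        _ ≤ C * K / n := by gcongr
        _ ≤ 1 := hl2
    have hvθ0 : 0 ≤ v * θ ^ 2 := mul_nonneg hv0 (sq_nonneg θ)
    have hy0 : 0 ≤ y := by linarith
    have hy1 : y ≤ 1 := by linarith
    -- The centred characteristic function is replaced by its quadratic Taylor polynomial `y`. The
    -- total error, of order `m|θ|³`, is `O(1/√m)` where `mθ² ≤ K`; Bernoulli's inequality then
    -- bounds `y^n` from below.
    have hdiff := norm_pow_sub_pow_le (N := n) hz1 (y := (y : ℂ))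
      (by rw [Complex.norm_real, Real.norm_of_nonneg hy0]; exact hy1)
    rw [one_pow, mul_one] at hdiff
    have hdiff2 : ‖z ^ n - (y : ℂ) ^ n‖ ≤ C * m n * |θ| ^ 3 := by
      refine hdiff.trans ((mul_le_mul_of_nonneg_left (hv2 θ) hn'.le).trans (le_of_eq ?_))
      field_simp
    have hre : y ^ n - C * m n * |θ| ^ 3 ≤ (z ^ n).re := by
      have h1 := (Complex.abs_re_le_norm (z ^ n - (y : ℂ) ^ n)).trans hdiff2
      rw [Complex.sub_re, ← Complex.ofReal_pow, Complex.ofReal_re] at h1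
      linarith [neg_le_of_abs_le h1]
    have hyn : max 0 (1 - C * m n * θ ^ 2) ≤ y ^ n := by
      refine max_le (pow_nonneg hy0 n) ?_
      have hB := one_add_mul_le_pow (a := y - 1) (by linarith) n
      rw [add_sub_cancel] at hB
      refine le_trans ?_ hB
      have : n * (v * θ ^ 2) ≤ C * m n * θ ^ 2 := by
        refine (mul_le_mul_of_nonneg_left hvθ hn'.le).trans (le_of_eq ?_)
        field_simp
      have h0 : 0 ≤ (n : ℝ) * (v * θ ^ 2) := mul_nonneg hn'.le hvθ0
      rw [hy]
      linarith
    have herr : C * m n * |θ| ^ 3 ≤ ρ * Real.exp (-(b * m n) * θ ^ 2) := by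
      have hθs : √(m n) * |θ| ≤ K := by
        have h1 : (√(m n) * |θ|) ^ 2 ≤ K := by
          rw [mul_pow, Real.sq_sqrt hm'.le, sq_abs]; exact hsm2
        nlinarith [mul_nonneg hsm.le (abs_nonneg θ)]
      have h1 : C * m n * |θ| ^ 3 ≤ C * K ^ 2 / √(m n) := by
        rw [le_div_iff₀ hsm]
        calc C * m n * |θ| ^ 3 * √(m n) = C * ((m n * |θ| ^ 2) * (√(m n) * |θ|)) := by ring
          _ ≤ C * (K * K) := by
              rw [sq_abs]
              gcongr
          _ = C * K ^ 2 := by ring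
      have h2 : C * K ^ 2 / √(m n) ≤ ρ * Real.exp (-(b * K)) := by
        have e1 : Real.exp (b * K) * Real.exp (-(b * K)) = 1 := by rw [← Real.exp_add]; simp
        calc C * K ^ 2 / √(m n)
            = (C * K ^ 2 * Real.exp (b * K) / √(m n)) * Real.exp (-(b * K)) := by
              rw [div_mul_eq_mul_div, mul_assoc (C * K ^ 2), e1, mul_one]
          _ ≤ ρ * Real.exp (-(b * K)) := by gcongr
      refine h1.trans (h2.trans (mul_le_mul_of_nonneg_left (Real.exp_le_exp.2 ?_) hρ.le))
      nlinarith
    linarith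
  · -- the tails
    have hdθ : |d * θ| ≤ Real.pi := by
      rw [abs_mul, abs_of_nonneg (by linarith : (0 : ℝ) ≤ d)]
      have : (d : ℝ) * |θ| ≤ d * (Real.pi / (2 * d)) := by gcongr
      rw [show (d : ℝ) * (Real.pi / (2 * d)) = Real.pi / 2 by field_simp] at this
      linarith
    have hcos := Real.cos_le_one_sub_mul_cos_sq hdθ
    have hd2 : θ ^ 2 ≤ (d * θ) ^ 2 := by
      rw [mul_pow]
      have : (1 : ℝ) ≤ (d : ℝ) ^ 2 := one_le_pow₀ hd
      nlinarith [sq_nonneg θ]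
    have hcos2 : 2 / Real.pi ^ 2 * θ ^ 2 ≤ 1 - Real.cos (d * θ) := by
      have : 2 / Real.pi ^ 2 * θ ^ 2 ≤ 2 / Real.pi ^ 2 * (d * θ) ^ 2 := by gcongr
      linarith
    have hnorm : ‖z ^ n‖ ≤ ρ * Real.exp (-(b * m n) * θ ^ 2) := by
      rw [norm_pow, hnz]
      refine ((pow_le_pow_left₀ (norm_nonneg _) (hP.norm_charSum_le h.d_ne θ) n).trans
        (hb n (by omega) θ)).trans ?_
      calc Real.exp (-(c * m n * (1 - Real.cos (d * θ))))
          ≤ Real.exp (-(b * K) + -(b * m n) * θ ^ 2) := by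
            refine Real.exp_le_exp.2 ?_
            have h1 : c * m n * (2 / Real.pi ^ 2 * θ ^ 2) ≤ c * m n * (1 - Real.cos (d * θ)) := by
              gcongr
            have h2 : c * m n * (2 / Real.pi ^ 2 * θ ^ 2) = 2 * b * (m n * θ ^ 2) := by
              rw [hbdef]; ring
            nlinarith
        _ = Real.exp (-(b * K)) * Real.exp (-(b * m n) * θ ^ 2) := Real.exp_add _ _
        _ ≤ _ := by gcongr
    have hre := neg_le_of_abs_le ((Complex.abs_re_le_norm (z ^ n)).trans hnorm)
    have hneg : 1 - C * m n * θ ^ 2 ≤ 0 := by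
      have := mul_le_mul_of_nonneg_left hbig.le hC.le
      linarith
    rw [max_eq_left hneg]
    linarith

/-- The central arc contributes at least an amount of order `1 / √m`. -/
lemma exists_le_arcOf (h : SparseFamily P m d) : ∃ c > 0, ∀ᶠ n in atTop,
    c / √(m n) ≤ (arcOf (P n) n (2 * m n) (Real.pi / (2 * d))).re := by
  obtain ⟨b, hb, C, hC, hpt⟩ := h.exists_arc_pointwise
  have hpi := Real.pi_pos
  have hd : (0 : ℝ) < d := by exact_mod_cast Nat.pos_of_ne_zero h.d_ne
  set a := Real.pi / (2 * d) with ha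
  have ha0 : 0 < a := by positivity
  -- For `|θ| ≤ κ/√m` one has `C m θ² ≤ 1/2`, so this window contributes at least `κ/√m`; `ρ` limits
  -- the Gaussian error to half of that.
  set κ := 1 / √(2 * C) with hκ
  have hκ0 : 0 < κ := by positivity
  set ρ := κ / (2 * √(Real.pi / b)) with hρ
  have hρ0 : 0 < ρ := by positivity
  refine ⟨κ / 2, by positivity, ?_⟩
  have hlim : Tendsto (fun n => κ / √(m n)) atTop (𝓝 0) := h.tendsto_sqrt.const_div_atTop _
  filter_upwards [hpt ρ hρ0, h.isSubLaw, h.tendsto_m.eventually_gt_atTop 0,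
    hlim.eventually_le_const ha0] with n hpt hP hm hκa
  have hm' : (0 : ℝ) < m n := by exact_mod_cast hm
  have hsm : 0 < √(m n : ℝ) := Real.sqrt_pos.2 hm'
  have hcont := hP.coeffSummable.continuous
  set x := κ / √(m n) with hx
  have hx0 : 0 < x := by positivity
  have hF : Continuous fun θ : ℝ => charSum (P n) θ ^ n *
      Complex.exp (-(((2 * m n : ℤ) : ℂ) * θ * Complex.I)) := by fun_prop
  have e1 : (arcOf (P n) n (2 * m n) a).re = ∫ θ in (-a)..a, (charSum (P n) θ ^ n *
      Complex.exp (-(((2 * m n : ℤ) : ℂ) * θ * Complex.I))).re := by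
    rw [arcOf, ← Complex.reCLM_apply, ← Complex.reCLM.intervalIntegral_comp_comm
      (hF.intervalIntegrable _ _)]
    simp
  have h1 : ∫ θ in (-a)..a, (max 0 (1 - C * m n * θ ^ 2) - ρ * Real.exp (-(b * m n) * θ ^ 2)) ≤
      (arcOf (P n) n (2 * m n) a).re := by
    rw [e1]
    refine intervalIntegral.integral_mono_on (by linarith)
      (Continuous.intervalIntegrable (by fun_prop) _ _)
      ((Complex.continuous_re.comp hF).intervalIntegrable _ _) fun θ hθ => hpt θ (abs_le.2 hθ)
  rw [intervalIntegral.integral_sub (Continuous.intervalIntegrable (by fun_prop) _ _)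
    (Continuous.intervalIntegrable (by fun_prop) _ _), intervalIntegral.integral_const_mul] at h1
  have h2 := integral_exp_neg_mul_sq_le (mul_pos hb hm') (x := -a) (y := a) (by linarith)
  have h3 : ∫ θ in (-x)..x, (1 / 2 : ℝ) ≤ ∫ θ in (-x)..x, max 0 (1 - C * m n * θ ^ 2) := by
    refine intervalIntegral.integral_mono_on (by linarith) intervalIntegrable_const
      (Continuous.intervalIntegrable (by fun_prop) _ _) fun θ hθ => le_max_of_le_right ?_
    have hθ2 : θ ^ 2 ≤ x ^ 2 := sq_le_sq' hθ.1 hθ.2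
    have : C * m n * θ ^ 2 ≤ C * m n * x ^ 2 := by gcongr
    have hx2 : C * m n * x ^ 2 = 1 / 2 := by
      rw [hx, hκ, div_pow, div_pow, Real.sq_sqrt hm'.le, Real.sq_sqrt (by positivity)]
      field_simp
    linarith
  have h4 : ∫ θ in (-x)..x, max 0 (1 - C * m n * θ ^ 2) ≤
      ∫ θ in (-a)..a, max 0 (1 - C * m n * θ ^ 2) :=
    intervalIntegral.integral_mono_interval (by linarith) (by linarith) hκa
      (Eventually.of_forall fun θ => le_max_left _ _)
      (Continuous.intervalIntegrable (by fun_prop) _ _)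
  rw [intervalIntegral.integral_const, smul_eq_mul] at h3
  have h5 : ρ * ∫ θ in (-a)..a, Real.exp (-(b * m n) * θ ^ 2) ≤ x / 2 := by
    refine (mul_le_mul_of_nonneg_left h2 hρ0.le).trans (le_of_eq ?_)
    rw [← div_div, Real.sqrt_div (by positivity), hρ, hx]
    field_simp
  have h6 : κ / 2 / √(m n) = x / 2 := by rw [hx]; ring
  rw [h6]
  linarith

/-- Uniformity in the arc length provides the dominating function in `abs_symm_le`. -/
lemma norm_arcOf_le (h : SparseFamily P m d) : ∃ C > 0, ∀ᶠ n in atTop, ∀ s : ℤ, ∀ a : ℝ, 0 ≤ a →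
    a ≤ Real.pi → ‖arcOf (P n) n s a‖ ≤ C / √(m n) := by
  obtain ⟨c, hc, hb⟩ := h.exists_exp_pow_le
  refine ⟨4 / √c, by positivity, ?_⟩
  filter_upwards [hb, h.isSubLaw, h.tendsto_m.eventually_gt_atTop 0] with n hb hP hm s a ha0 ha
  have hm' : (0 : ℝ) < m n := by exact_mod_cast hm
  have hg : Continuous fun θ : ℝ => Real.exp (-(c * m n * (1 - Real.cos (d * θ)))) := by fun_prop
  refine (intervalIntegral.norm_integral_le_of_norm_le (by linarith)
    (Eventually.of_forall fun θ _ => ?_) (hg.intervalIntegrable _ _)).trans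
    ((intervalIntegral.integral_mono_interval (by linarith) (by linarith) ha
      (Eventually.of_forall fun θ => (Real.exp_pos _).le) (hg.intervalIntegrable _ _)).trans
      ((integral_exp_neg_one_sub_cos_le h.d_ne (mul_pos hc hm')).trans (le_of_eq ?_)))
  · rw [norm_mul, norm_exp_neg_mul_I, mul_one, norm_pow]
    exact (pow_le_pow_left₀ (norm_nonneg _) (hP.norm_charSum_le h.d_ne θ) n).trans
      (hb n (by omega) θ)
  · rw [Real.sqrt_mul hc.le, div_div]

/-- If the central arcs dominate, the central coefficient is at least of order `1 / √m`. -/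
lemma exists_le_coeffZ (h : SparseFamily P m d)
    (harc : ∀ a : ℝ, 0 < a → a < Real.pi → (fun n => arcOf (P n) n (2 * m n) Real.pi) ~[atTop]
      fun n => arcOf (P n) n (2 * m n) a) :
    ∃ c > 0, ∀ᶠ n in atTop, c / √(m n) ≤ coeffZ (P n ^ n) (2 * m n) := by
  obtain ⟨c, hc, harcle⟩ := h.exists_le_arcOf
  have hpi := Real.pi_pos
  have hd : (1 : ℝ) ≤ d := by exact_mod_cast Nat.one_le_iff_ne_zero.2 h.d_ne
  have ha := harc (Real.pi / (2 * d)) (by positivity) (by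
    rw [div_lt_iff₀ (by positivity)]
    nlinarith)
  refine ⟨c / (4 * Real.pi), by positivity, ?_⟩
  filter_upwards [harcle, ha.isLittleO.def (c := 1 / 2) (by norm_num), h.isSubLaw] with n h1 h2 hP
  rw [Pi.sub_apply, arcOf_pi hP.coeffSummable] at h2
  set z := arcOf (P n) n (2 * m n) (Real.pi / (2 * d)) with hz
  set f := coeffZ (P n ^ n) (2 * m n) with hf
  have h3 : c / √(m n) ≤ ‖z‖ := h1.trans (Complex.re_le_norm z)
  -- The last term is at most `‖z‖ / 2` by the asymptotic equivalence, so the full circle integral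
  -- has at least half the size of the arc integral.
  have h4 : ‖z‖ ≤ ‖2 * (Real.pi : ℂ) * (f : ℂ)‖ + ‖2 * (Real.pi : ℂ) * (f : ℂ) - z‖ := by
    have := norm_sub_le (2 * (Real.pi : ℂ) * (f : ℂ)) (2 * (Real.pi : ℂ) * (f : ℂ) - z)
    rwa [sub_sub_cancel] at this
  have hf0 : 0 ≤ f := coeffZ_nonneg (coeff_pow_nonneg hP.nonneg n) _
  have h5 : ‖2 * (Real.pi : ℂ) * (f : ℂ)‖ = 2 * Real.pi * f := by
    rw [norm_mul, norm_mul, Complex.norm_real, Complex.norm_real, Real.norm_of_nonneg hf0,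
      Real.norm_of_nonneg hpi.le, Complex.norm_ofNat]
  rw [h5] at h4
  have h6 : c / (4 * Real.pi) / √(m n) = (c / √(m n)) / (4 * Real.pi) := by ring
  rw [h6, div_le_iff₀ (by positivity)]
  linarith

/-- Adding the coefficients at `s ± r` produces the even kernel `2 cos(rθ)`, which sees only the
symmetrised integrand, that is, the derivative of the arc integral. Integrate by parts against
`arcOf θ - arcOf π`, which vanishes at `π`; the boundary term at `0` is the central coefficient. -/
lemma arcOf_symm_identity {A : PowerSeries ℝ} (hA : CoeffSummable A) (N : ℕ) (s r : ℤ) :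
    Real.pi * ((coeffZ (A ^ N) (s + r) + coeffZ (A ^ N) (s - r) - 2 * coeffZ (A ^ N) s : ℝ) : ℂ) =
      ∫ θ in (0 : ℝ)..Real.pi, ((r * Real.sin (r * θ) : ℝ) : ℂ) *
        (arcOf A N s θ - arcOf A N s Real.pi) := by
  have hcont := hA.continuous
  set F : ℝ → ℂ := fun θ => charSum A θ ^ N * Complex.exp (-((s : ℂ) * θ * Complex.I)) with hF
  have hFc : Continuous F := by fun_prop
  set k : ℝ → ℂ := fun θ => F θ + F (-θ) with hk
  have hkc : Continuous k := by fun_prop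
  have hsplit : ∀ G : ℝ → ℂ, Continuous G → ∀ a : ℝ, ∫ θ in (-a)..a, G θ =
      ∫ θ in (0 : ℝ)..a, (G θ + G (-θ)) := by
    intro G hG a
    rw [intervalIntegral.integral_add (hG.intervalIntegrable _ _)
      (Continuous.intervalIntegrable (by fun_prop) _ _), intervalIntegral.integral_comp_neg,
      neg_zero, add_comm, intervalIntegral.integral_add_adjacent_intervals
      (hG.intervalIntegrable _ _) (hG.intervalIntegrable _ _)]
  have harc : ∀ a, arcOf A N s a = ∫ θ in (0 : ℝ)..a, k θ := fun a => hsplit F hFc a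
  have hder : ∀ a, HasDerivAt (arcOf A N s) (k a) a := by
    intro a
    rw [show arcOf A N s = fun a => ∫ θ in (0 : ℝ)..a, k θ from funext harc]
    exact intervalIntegral.integral_hasDerivAt_right (hkc.intervalIntegrable _ _)
      hkc.aestronglyMeasurable.stronglyMeasurableAtFilter hkc.continuousAt
  have hcoeff : 2 * Real.pi * ((coeffZ (A ^ N) (s + r) : ℂ) + (coeffZ (A ^ N) (s - r) : ℂ)) =
      2 * ∫ θ in (0 : ℝ)..Real.pi, ((Real.cos (r * θ) : ℝ) : ℂ) * k θ := by
    rw [mul_add, ← integral_charSum (hA.pow N), ← integral_charSum (hA.pow N)]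
    simp only [charSum_pow hA]
    rw [← intervalIntegral.integral_add (Continuous.intervalIntegrable (by fun_prop) _ _)
      (Continuous.intervalIntegrable (by fun_prop) _ _), ← intervalIntegral.integral_const_mul,
      hsplit _ (by fun_prop)]
    refine intervalIntegral.integral_congr fun θ _ => ?_
    have hF2 : ∀ θ : ℝ, charSum A θ ^ N * Complex.exp (-(((s + r : ℤ) : ℂ) * θ * Complex.I)) +
        charSum A θ ^ N * Complex.exp (-(((s - r : ℤ) : ℂ) * θ * Complex.I)) =
        2 * ((Real.cos (r * θ) : ℝ) : ℂ) * F θ := by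
      intro θ
      have e1 : Complex.exp (-(((s + r : ℤ) : ℂ) * θ * Complex.I)) =
          Complex.exp (-((s : ℂ) * θ * Complex.I)) * Complex.exp (-((r * θ : ℂ)) * Complex.I) := by
        rw [← Complex.exp_add]; congr 1; push_cast; ring
      have e2 : Complex.exp (-(((s - r : ℤ) : ℂ) * θ * Complex.I)) =
          Complex.exp (-((s : ℂ) * θ * Complex.I)) * Complex.exp ((r * θ : ℂ) * Complex.I) := by
        rw [← Complex.exp_add]; congr 1; push_cast; ring
      rw [e1, e2, hF]
      push_cast
      rw [Complex.two_cos]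
      ring
    rw [hF2, hF2, hk, mul_neg, Real.cos_neg]
    ring
  have hu : ∀ θ : ℝ, HasDerivAt (fun θ : ℝ => ((Real.cos (r * θ) : ℝ) : ℂ))
      (((-(r * Real.sin (r * θ)) : ℝ) : ℂ)) θ := by
    intro θ
    have h1 : HasDerivAt (fun θ : ℝ => Real.cos (r * θ)) (-(r * Real.sin (r * θ))) θ := by
      have := (Real.hasDerivAt_cos (r * θ)).comp θ ((hasDerivAt_id θ).const_mul (r : ℝ))
      simp only [mul_one] at this
      convert! this using 1
      ring
    exact h1.ofReal_comp
  have hparts := intervalIntegral.integral_mul_deriv_eq_deriv_mul (a := 0) (b := Real.pi)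
    (fun θ _ => hu θ) (fun θ _ => (hder θ).sub_const (arcOf A N s Real.pi))
    (Continuous.intervalIntegrable (by fun_prop) _ _) (hkc.intervalIntegrable _ _)
  have h0 : arcOf A N s 0 = 0 := by simp [arcOf]
  rw [sub_self, mul_zero, h0, mul_zero, Real.cos_zero, Complex.ofReal_one, one_mul] at hparts
  simp only [zero_sub, neg_neg] at hparts
  rw [hparts, arcOf_pi hA] at hcoeff
  have hneg : ∫ θ in (0 : ℝ)..Real.pi, ((-(r * Real.sin (r * θ)) : ℝ) : ℂ) *
      (arcOf A N s θ - 2 * Real.pi * (coeffZ (A ^ N) s : ℂ)) =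
      -∫ θ in (0 : ℝ)..Real.pi, ((r * Real.sin (r * θ) : ℝ) : ℂ) *
        (arcOf A N s θ - 2 * Real.pi * (coeffZ (A ^ N) s : ℂ)) := by
    rw [← intervalIntegral.integral_neg]
    refine intervalIntegral.integral_congr fun θ _ => ?_
    push_cast
    ring
  rw [hneg] at hcoeff
  rw [arcOf_pi hA]
  push_cast at hcoeff ⊢
  linear_combination hcoeff / 2

lemma continuous_arcOf {A : PowerSeries ℝ} (hA : CoeffSummable A) (N : ℕ) (s : ℤ) :
    Continuous (arcOf A N s) := by
  have hcont := hA.continuous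
  have hF : Continuous fun θ : ℝ => charSum A θ ^ N * Complex.exp (-((s : ℂ) * θ * Complex.I)) := by
    fun_prop
  have h := intervalIntegral.continuous_primitive (μ := MeasureTheory.volume)
    (fun a b => hF.intervalIntegrable a b) 0
  have e : arcOf A N s = fun a => (∫ θ in (0 : ℝ)..a, charSum A θ ^ N *
      Complex.exp (-((s : ℂ) * θ * Complex.I))) - ∫ θ in (0 : ℝ)..(-a), charSum A θ ^ N *
      Complex.exp (-((s : ℂ) * θ * Complex.I)) := by
    funext a
    rw [arcOf, intervalIntegral.integral_interval_sub_left (hF.intervalIntegrable _ _)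
      (hF.intervalIntegrable _ _)]
  rw [e]
  exact h.sub (h.comp continuous_neg)

/-- If the central arcs dominate, the coefficients around the centre are asymptotically
balanced. -/
lemma abs_symm_le (h : SparseFamily P m d)
    (harc : ∀ a : ℝ, 0 < a → a < Real.pi → (fun n => arcOf (P n) n (2 * m n) Real.pi) ~[atTop]
      fun n => arcOf (P n) n (2 * m n) a) (r : ℤ) {η : ℝ} (hη : 0 < η) :
    ∀ᶠ n in atTop, |coeffZ (P n ^ n) (2 * m n + r) + coeffZ (P n ^ n) (2 * m n - r) -
      2 * coeffZ (P n ^ n) (2 * m n)| ≤ η / √(m n) := by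
  obtain ⟨C, hC, hb⟩ := h.norm_arcOf_le
  have hpi := Real.pi_pos
  set G : ℕ → ℝ → ℂ := fun n θ => (√(m n) : ℂ) * (((r * Real.sin (r * θ) : ℝ) : ℂ) *
    (arcOf (P n) n (2 * m n) θ - arcOf (P n) n (2 * m n) Real.pi)) with hG
  have hsin : ∀ θ : ℝ, |(r : ℝ) * Real.sin (r * θ)| ≤ |(r : ℝ)| := fun θ => by
    rw [abs_mul]
    exact mul_le_of_le_one_right (abs_nonneg _) (Real.abs_sin_le_one _)
  -- Dominated convergence: after multiplication by `√m` the integrand is bounded, and for each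
  -- fixed `θ < π` it tends to zero because the arc of half-length `θ` already dominates.
  have hlim : Tendsto (fun n => ∫ θ in (0 : ℝ)..Real.pi, G n θ) atTop
      (𝓝 (∫ θ in (0 : ℝ)..Real.pi, (0 : ℂ))) := by
    refine intervalIntegral.tendsto_integral_filter_of_dominated_convergence
      (fun _ => |(r : ℝ)| * (2 * C)) ?_ ?_ intervalIntegrable_const ?_
    · filter_upwards [h.isSubLaw] with n hP
      have := continuous_arcOf hP.coeffSummable n (2 * m n)
      exact Continuous.aestronglyMeasurable (by fun_prop)
    · filter_upwards [hb, h.tendsto_m.eventually_gt_atTop 0] with n hb hm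
      refine Eventually.of_forall fun θ hθ => ?_
      rw [Set.uIoc_of_le hpi.le] at hθ
      have hsm : 0 < √(m n : ℝ) := Real.sqrt_pos.2 (by exact_mod_cast hm)
      have h1 := hb (2 * m n) θ hθ.1.le hθ.2
      have h2 := hb (2 * m n) Real.pi hpi.le le_rfl
      have h3 := (norm_sub_le (arcOf (P n) n (2 * m n) θ)
        (arcOf (P n) n (2 * m n) Real.pi)).trans (add_le_add h1 h2)
      rw [hG]
      beta_reduce
      rw [norm_mul, norm_mul, Complex.norm_real, Complex.norm_real, Real.norm_of_nonneg hsm.le,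
        Real.norm_eq_abs]
      calc _ ≤ √(m n : ℝ) * (|(r : ℝ)| * (C / √(m n) + C / √(m n))) :=
            mul_le_mul_of_nonneg_left (mul_le_mul (hsin θ) h3 (norm_nonneg _) (abs_nonneg _))
              hsm.le
        _ = _ := by field_simp; ring
    · refine Eventually.of_forall fun θ hθ => ?_
      rw [Set.uIoc_of_le hpi.le] at hθ
      rcases hθ.2.eq_or_lt with rfl | hlt
      · simp [hG]
      · have ha := (harc θ hθ.1 hlt).isLittleO
        rw [Metric.tendsto_atTop']
        intro t ht
        have hden : 0 < C * (|(r : ℝ)| + 1) := by positivity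
        have hev := (ha.def (c := t / 2 / (C * (|(r : ℝ)| + 1))) (by positivity)).and
          (hb.and (h.tendsto_m.eventually_gt_atTop 0))
        obtain ⟨n0, hn0⟩ := eventually_atTop.1 hev
        refine ⟨n0, fun n hn => ?_⟩
        obtain ⟨h1, h2, h3⟩ := hn0 n hn.le
        have hsm : 0 < √(m n : ℝ) := Real.sqrt_pos.2 (by exact_mod_cast h3)
        rw [Pi.sub_apply, norm_sub_rev] at h1
        have h4 := h2 (2 * m n) θ hθ.1.le hθ.2
        rw [dist_zero_right, hG]
        beta_reduce
        rw [norm_mul, norm_mul, Complex.norm_real, Complex.norm_real, Real.norm_of_nonneg hsm.le,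
          Real.norm_eq_abs]
        calc _ ≤ √(m n : ℝ) * ((|(r : ℝ)| + 1) *
              (t / 2 / (C * (|(r : ℝ)| + 1)) * (C / √(m n)))) := by
              gcongr
              · exact (hsin θ).trans (by linarith)
              · exact h1.trans (mul_le_mul_of_nonneg_left h4 (by positivity))
          _ = t / 2 := by field_simp
          _ < t := by linarith
  rw [intervalIntegral.integral_zero] at hlim
  have hnorm := hlim.norm
  rw [norm_zero] at hnorm
  filter_upwards [hnorm.eventually_le_const (mul_pos hpi hη), h.isSubLaw,
    h.tendsto_m.eventually_gt_atTop 0] with n h1 hP hm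
  have hsm : 0 < √(m n : ℝ) := Real.sqrt_pos.2 (by exact_mod_cast hm)
  rw [hG] at h1
  beta_reduce at h1
  rw [intervalIntegral.integral_const_mul, ← arcOf_symm_identity hP.coeffSummable, norm_mul,
    norm_mul, Complex.norm_real, Complex.norm_real, Complex.norm_real, Real.norm_of_nonneg hsm.le,
    Real.norm_of_nonneg hpi.le, Real.norm_eq_abs] at h1
  rw [le_div_iff₀ hsm]
  have h2 := le_of_mul_le_mul_left (a := Real.pi) (by linarith) hpi
    (b := |coeffZ (P n ^ n) (2 * m n + r) + coeffZ (P n ^ n) (2 * m n - r) -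
      2 * coeffZ (P n ^ n) (2 * m n)| * √(m n)) (c := η)
  exact h2

end SparseFamily

/-! ### Comparison of nearby coefficients -/

lemma coeff_pow_eq_zero_of_support {A : PowerSeries ℝ} {H : AddSubgroup ℤ}
    (hA : ∀ j : ℕ, (j : ℤ) ∉ H → PowerSeries.coeff j A = 0) (N : ℕ) :
    ∀ j : ℕ, (j : ℤ) ∉ H → PowerSeries.coeff j (A ^ N) = 0 := by
  induction N with
  | zero =>
    intro j hj
    rw [pow_zero, PowerSeries.coeff_one, if_neg]
    rintro rfl
    exact hj H.zero_mem
  | succ N ih =>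
    intro j hj
    rw [pow_succ, PowerSeries.coeff_mul]
    refine Finset.sum_eq_zero fun p hp => ?_
    by_cases h1 : (p.1 : ℤ) ∈ H
    · by_cases h2 : (p.2 : ℤ) ∈ H
      · refine absurd ?_ hj
        rw [← Finset.HasAntidiagonal.mem_antidiagonal.1 hp]
        push_cast
        exact H.add_mem h1 h2
      · rw [hA _ h2, mul_zero]
    · rw [ih _ h1, zero_mul]

lemma coeffZ_pow_eq_zero_of_support {A : PowerSeries ℝ} {H : AddSubgroup ℤ}
    (hA : ∀ j : ℕ, (j : ℤ) ∉ H → PowerSeries.coeff j A = 0) (N : ℕ) {s : ℤ} (hs : s ∉ H) :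
    coeffZ (A ^ N) s = 0 := by
  unfold coeffZ
  split_ifs with h
  · obtain ⟨k, rfl⟩ := Int.eq_ofNat_of_zero_le h
    exact coeff_pow_eq_zero_of_support hA N _ hs
  · rfl

/-- The second moment inequality reads off `F` of order `A/(A+1) · 1/q`. As `A/(A+1)` increases with
`A`, only a lower bound on `A = n p_t` is needed, which may stay bounded or diverge. -/
lemma le_of_step_inequality {a A B C c q F L L₂ : ℝ} (ha : 0 < a) (haA : a ≤ A) (hBA : B ≤ A ^ 2)
    (hB : 0 ≤ B) (hC : 0 < C) (hc : 0 < c) (hq : 0 < q) (hF : 0 ≤ F) (hL : c / q ≤ L)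
    (hLC : L ≤ C / q) (hL₂ : L₂ ≤ C / q) (hstep : (A * L) ^ 2 ≤ F * (B * L₂ + A * L)) :
    a / (a + 1) * (c ^ 2 / C) / q ≤ F := by
  have hA : 0 < A := ha.trans_le haA
  have h1 : B * L₂ + A * L ≤ (A ^ 2 + A) * (C / q) := by
    have h2 : B * L₂ ≤ A ^ 2 * (C / q) :=
      (mul_le_mul_of_nonneg_left hL₂ hB).trans (mul_le_mul_of_nonneg_right hBA (by positivity))
    have h3 : A * L ≤ A * (C / q) := mul_le_mul_of_nonneg_left hLC hA.le
    linarith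
  have h2 : (A * (c / q)) ^ 2 ≤ F * ((A ^ 2 + A) * (C / q)) := by
    refine le_trans ?_ (hstep.trans (mul_le_mul_of_nonneg_left h1 hF))
    gcongr
  have h3 : a / (a + 1) ≤ A / (A + 1) := by
    rw [div_le_div_iff₀ (by positivity) (by positivity)]
    linarith
  calc a / (a + 1) * (c ^ 2 / C) / q ≤ A / (A + 1) * (c ^ 2 / C) / q := by gcongr
    _ = (A * (c / q)) ^ 2 / ((A ^ 2 + A) * (C / q)) := by field_simp
    _ ≤ F := by
        rw [div_le_iff₀ (by positivity)]
        exact h2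

namespace SparseFamily

variable {P : ℕ → PowerSeries ℝ} {m : ℕ → ℕ} {d : ℕ}

/-- Along `l`, the coefficients with offset `s` from the centre are of order `1 / √m`. -/
def PosAt (P : ℕ → PowerSeries ℝ) (m : ℕ → ℕ) (l : Filter ℕ) (s : ℤ) : Prop :=
  ∃ c > 0, ∀ᶠ n in l, c / √(m n) ≤ coeffZ (P n ^ n) (2 * m n + s)

/-- The values whose expected number of occurrences stays bounded below along `l`. -/
def frequentValues (P : ℕ → PowerSeries ℝ) (l : Filter ℕ) : Set ℕ :=
  {t | ∃ a > 0, ∀ᶠ n in l, a ≤ n * PowerSeries.coeff t (P n)}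

lemma PosAt.add (h : SparseFamily P m d) {l : Filter ℕ} (hl : l ≤ atTop) {s : ℤ} {t : ℕ}
    (hs : PosAt P m l s) (ht : t ∈ frequentValues P l) : PosAt P m l (s + t) := by
  obtain ⟨c, hc, hs⟩ := hs
  obtain ⟨a, ha, ht⟩ := ht
  obtain ⟨C, hC, hup⟩ := h.exists_coeffZ_le
  refine ⟨a / (a + 1) * ((c / 2) ^ 2 / C), by positivity, ?_⟩
  filter_upwards [hs, ht, hl hup, hl (h.abs_coeffZ_pow_sub_sub_le 1 (half_pos hc)),
    hl h.isSubLaw, hl (h.tendsto_m.eventually_gt_atTop 0), hl (eventually_ge_atTop 4)] with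
    n h1 h2 h3 h4 hP hm hn
  have hsm : 0 < √(m n : ℝ) := Real.sqrt_pos.2 (by exact_mod_cast hm)
  have h5 := coeffZ_pow_step hP.nonneg n t (2 * m n + s)
  rw [add_assoc] at h5
  have h6 : ((n - 1 : ℕ) : ℝ) ≤ n := by exact_mod_cast Nat.sub_le n 1
  have hp := hP.nonneg t
  refine le_of_step_inequality ha h2 ?_ ?_ hC (half_pos hc) hsm
    (coeffZ_nonneg (coeff_pow_nonneg hP.nonneg n) _) ?_ (h3 _ (by omega) _) (h3 _ (by omega) _) h5
  · rw [mul_pow, sq (n : ℝ)]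
    gcongr
  · positivity
  · have := (abs_le.1 (h4 (2 * m n + s))).1
    have e : c / √(m n) = c / 2 / √(m n) + c / 2 / √(m n) := by ring
    linarith

lemma PosAt.sub_d (h : SparseFamily P m d) {l : Filter ℕ} (hl : l ≤ atTop) {s : ℤ}
    (hs : PosAt P m l s) : PosAt P m l (s - d) := by
  obtain ⟨c, hc, hs⟩ := hs
  refine ⟨c / 2, by positivity, ?_⟩
  filter_upwards [hs, hl (h.abs_coeffZ_add_sub_le (half_pos hc))] with n h1 h2
  have h3 := (abs_le.1 (h2 (2 * m n + (s - d)))).2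
  rw [show 2 * (m n : ℤ) + (s - d) + d = 2 * m n + s by ring] at h3
  have e : c / √(m n) = c / 2 / √(m n) + c / 2 / √(m n) := by ring
  linarith

/-- Steps down are available only in multiples of `d`, but `-t = (d-1)t - td`. -/
lemma PosAt.sub (h : SparseFamily P m d) {l : Filter ℕ} (hl : l ≤ atTop) {s : ℤ} {t : ℕ}
    (hs : PosAt P m l s) (ht : t ∈ frequentValues P l) : PosAt P m l (s - t) := by
  have h1 : ∀ j : ℕ, PosAt P m l (s + j * t) := by
    intro j
    induction j with
    | zero => simpa using hs
    | succ j ih =>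
      have := ih.add h hl ht
      rwa [show s + (j : ℤ) * t + t = s + ((j + 1 : ℕ) : ℤ) * t by push_cast; ring] at this
  have h2 : ∀ (x : ℤ), PosAt P m l x → ∀ j : ℕ, PosAt P m l (x - j * d) := by
    intro x hx j
    induction j with
    | zero => simpa using hx
    | succ j ih =>
      have := ih.sub_d h hl
      rwa [show x - (j : ℤ) * d - d = x - ((j + 1 : ℕ) : ℤ) * d by push_cast; ring] at this
  have h3 := h2 _ (h1 (d - 1)) t
  have hd : ((d - 1 : ℕ) : ℤ) = d - 1 := by
    have := h.d_ne
    omega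
  rwa [hd, show s + ((d : ℤ) - 1) * t - t * d = s - t by ring] at h3

lemma PosAt.of_mem_closure (h : SparseFamily P m d) {l : Filter ℕ} (hl : l ≤ atTop) {s : ℤ}
    (hs : PosAt P m l s) {x : ℤ}
    (hx : x ∈ AddSubgroup.closure ((fun t : ℕ => (t : ℤ)) '' frequentValues P l)) :
    PosAt P m l (s + x) := by
  -- Both signs and all starting points are carried through, so that negation and sums in the
  -- closure induction are immediate.
  have key : ∀ s, PosAt P m l s → PosAt P m l (s + x) ∧ PosAt P m l (s - x) := by
    induction hx using AddSubgroup.closure_induction with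
    | mem x hx =>
      obtain ⟨t, ht, rfl⟩ := hx
      exact fun s hs => ⟨hs.add h hl ht, hs.sub h hl ht⟩
    | zero => simp
    | add x y _ _ hx hy =>
      intro s hs
      rw [← add_assoc, ← sub_sub]
      exact ⟨(hy _ (hx s hs).1).1, (hy _ (hx s hs).2).2⟩
    | neg x _ hx =>
      intro s hs
      rw [← sub_eq_add_neg, sub_neg_eq_add]
      exact (hx s hs).symm
  exact (key s hs).1

lemma d_mem_frequentValues (h : SparseFamily P m d) {l : Filter ℕ} (hl : l ≤ atTop) :
    d ∈ frequentValues P l := by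
  obtain ⟨c, hc, hd⟩ := h.le_coeff
  refine ⟨c, hc, ?_⟩
  filter_upwards [hl hd, hl (h.tendsto_m.eventually_gt_atTop 0)] with n h1 hm
  have hm' : (1 : ℝ) ≤ m n := by exact_mod_cast hm
  nlinarith

open Classical in
/-- The part of a law supported on a subgroup. -/
noncomputable def restrict (A : PowerSeries ℝ) (H : AddSubgroup ℤ) : PowerSeries ℝ :=
  PowerSeries.mk fun j => if (j : ℤ) ∈ H then PowerSeries.coeff j A else 0

lemma coeff_restrict_of_mem {A : PowerSeries ℝ} {H : AddSubgroup ℤ} {j : ℕ} (hj : (j : ℤ) ∈ H) :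
    PowerSeries.coeff j (restrict A H) = PowerSeries.coeff j A := by
  simp [restrict, hj]

lemma coeff_restrict_of_notMem {A : PowerSeries ℝ} {H : AddSubgroup ℤ} {j : ℕ}
    (hj : (j : ℤ) ∉ H) : PowerSeries.coeff j (restrict A H) = 0 := by
  simp [restrict, hj]

lemma coeff_restrict_bounds {A : PowerSeries ℝ} (hA : IsSubLaw A) (H : AddSubgroup ℤ) (j : ℕ) :
    0 ≤ PowerSeries.coeff j (restrict A H) ∧
      PowerSeries.coeff j (restrict A H) ≤ PowerSeries.coeff j A := by
  by_cases hj : (j : ℤ) ∈ H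
  · rw [coeff_restrict_of_mem hj]
    exact ⟨hA.nonneg j, le_rfl⟩
  · rw [coeff_restrict_of_notMem hj]
    exact ⟨le_rfl, hA.nonneg j⟩

lemma isSubLaw_restrict {A : PowerSeries ℝ} (hA : IsSubLaw A) (H : AddSubgroup ℤ) :
    IsSubLaw (restrict A H) := by
  have hs : Summable fun j => PowerSeries.coeff j (restrict A H) :=
    Summable.of_nonneg_of_le (fun j => (coeff_restrict_bounds hA H j).1)
      (fun j => (coeff_restrict_bounds hA H j).2) hA.summable
  exact ⟨fun j => (coeff_restrict_bounds hA H j).1, hs,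
    (hs.tsum_le_tsum (fun j => (coeff_restrict_bounds hA H j).2) hA.summable).trans hA.tsum_le⟩

/-- The mass outside a subgroup containing all frequent values is `o(1 / n)`. -/
lemma eventually_mass_le (h : SparseFamily P m d) {U : Ultrafilter ℕ} (hU : (U : Filter ℕ) ≤ atTop)
    {H : AddSubgroup ℤ} (hH : ∀ t ∈ frequentValues P U, (t : ℤ) ∈ H) {η : ℝ} (hη : 0 < η) :
    ∀ᶠ n in (U : Filter ℕ), n * ∑' j, (PowerSeries.coeff j (P n) -
      PowerSeries.coeff j (restrict (P n) H)) ≤ η := by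
  classical
  by_cases hex : ∃ t : ℕ, (t : ℤ) ∉ H ∧ ¬ ∀ n, PowerSeries.coeff t (P n) = 0
  -- Let `t` be the least value outside `H` that ever has mass. All the mass outside `H` then lies
  -- in the tail from `t` on, which is comparable to `p_t` itself.
  · set t := Nat.find hex with ht
    obtain ⟨htH, ht0⟩ := Nat.find_spec hex
    have hmin : ∀ j < t, (j : ℤ) ∉ H → ∀ n, PowerSeries.coeff j (P n) = 0 := by
      intro j hj hjH
      by_contra hcon
      exact Nat.find_min hex hj ⟨hjH, hcon⟩
    obtain ⟨C, hC⟩ := (h.tail t).resolve_left ht0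
    have htK : t ∉ frequentValues P U := fun hK => htH (hH t hK)
    have hsmall : ∀ᶠ n in (U : Filter ℕ), n * PowerSeries.coeff t (P n) < η / (|C| + 1) := by
      -- Along an ultrafilter, not eventually large means eventually small.
      have h1 : ¬ ∀ᶠ n in (U : Filter ℕ), η / (|C| + 1) ≤ n * PowerSeries.coeff t (P n) :=
        fun hcon => htK ⟨_, by positivity, hcon⟩
      rw [← Ultrafilter.eventually_not] at h1
      simpa only [not_le] using h1
    filter_upwards [hsmall, hU hC, hU h.isSubLaw] with n h1 h2 hP
    have hA := isSubLaw_restrict hP H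
    have hsum := hP.summable.sub hA.summable
    have hp := hP.nonneg t
    rw [← hsum.sum_add_tsum_nat_add t, Finset.sum_eq_zero, zero_add]
    · have h3 : ∑' j, (PowerSeries.coeff (j + t) (P n) -
          PowerSeries.coeff (j + t) (restrict (P n) H)) ≤ C * PowerSeries.coeff t (P n) := by
        refine le_trans (Summable.tsum_le_tsum (fun j => ?_) ((summable_nat_add_iff t).2 hsum)
          ((summable_nat_add_iff t).2 hP.summable)) h2
        linarith [(coeff_restrict_bounds hP H (j + t)).1]
      have hn : (0 : ℝ) ≤ n := Nat.cast_nonneg n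
      rw [lt_div_iff₀ (by positivity)] at h1
      have h4 : C * PowerSeries.coeff t (P n) ≤ (|C| + 1) * PowerSeries.coeff t (P n) := by
        have := le_abs_self C
        gcongr
        linarith
      calc _ ≤ n * ((|C| + 1) * PowerSeries.coeff t (P n)) :=
            mul_le_mul_of_nonneg_left (h3.trans h4) hn
        _ ≤ η := by linarith
    · intro j hj
      rw [Finset.mem_range] at hj
      by_cases hjH : (j : ℤ) ∈ H
      · rw [coeff_restrict_of_mem hjH, sub_self]
      · rw [coeff_restrict_of_notMem hjH, hmin j hj hjH, sub_self]
  · push Not at hex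
    refine Eventually.of_forall fun n => ?_
    have : ∀ j, PowerSeries.coeff j (P n) - PowerSeries.coeff j (restrict (P n) H) = 0 := by
      intro j
      by_cases hjH : (j : ℤ) ∈ H
      · rw [coeff_restrict_of_mem hjH, sub_self]
      · rw [coeff_restrict_of_notMem hjH, hex j hjH, sub_self]
    simp only [this, tsum_zero, mul_zero]
    exact hη.le

/-- Along an ultrafilter, all coefficients at bounded distance from the centre are of
order `1 / √m`. -/
lemma posAt_of_ultrafilter (h : SparseFamily P m d)
    (harc : ∀ a : ℝ, 0 < a → a < Real.pi → (fun n => arcOf (P n) n (2 * m n) Real.pi) ~[atTop]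
      fun n => arcOf (P n) n (2 * m n) a)
    {U : Ultrafilter ℕ} (hU : (U : Filter ℕ) ≤ atTop) (r : ℤ) : PosAt P m U r := by
  obtain ⟨c, hc, hle⟩ := h.exists_le_coeffZ harc
  have h0 : PosAt P m U 0 := ⟨c, hc, by simp only [add_zero]; exact hle.filter_mono hU⟩
  set H := AddSubgroup.closure ((fun t : ℕ => (t : ℤ)) '' frequentValues P U) with hH
  by_cases hr : r ∈ H
  · simpa using h0.of_mem_closure h hU hr
  exfalso
  have hKH : ∀ t ∈ frequentValues P U, (t : ℤ) ∈ H := fun t ht =>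
    AddSubgroup.subset_closure ⟨t, ht, rfl⟩
  obtain ⟨C, hC, htr⟩ := h.exists_abs_coeffZ_sub_le
  obtain ⟨n, h1, h2, h3, h4, hP, hm⟩ := ((hle.filter_mono hU).and ((htr.filter_mono hU).and
    ((h.eventually_mass_le hU hKH (η := c / 2 / C) (by positivity)).and
    (((h.abs_symm_le harc r (half_pos hc)).filter_mono hU).and
    ((h.isSubLaw.filter_mono hU).and ((h.tendsto_m.eventually_gt_atTop 0).filter_mono hU)))))).exists
  have hsm : 0 < √(m n : ℝ) := Real.sqrt_pos.2 (by exact_mod_cast hm)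
  have hdiff : ∀ s : ℤ, |coeffZ (P n ^ n) s - coeffZ (restrict (P n) H ^ n) s| ≤
      c / 2 / √(m n) := by
    intro s
    refine (h2 _ (isSubLaw_restrict hP H) (fun j => (coeff_restrict_bounds hP H j).2)
      (coeff_restrict_of_mem (by simp))
      (coeff_restrict_of_mem (hKH d (h.d_mem_frequentValues hU))) s).trans ?_
    refine div_le_div_of_nonneg_right ?_ hsm.le
    calc _ ≤ C * (c / 2 / C) := mul_le_mul_of_nonneg_left h3 hC.le
      _ = c / 2 := by field_simp
  have hzero : ∀ s : ℤ, s ∉ H → coeffZ (P n ^ n) s ≤ c / 2 / √(m n) := by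
    intro s hs
    have h5 := (abs_le.1 (hdiff s)).2
    rwa [coeffZ_pow_eq_zero_of_support (fun j hj => coeff_restrict_of_notMem hj) n hs,
      sub_zero] at h5
  have hcq : 0 < c / √(m n) := by positivity
  have e : c / √(m n) = c / 2 / √(m n) + c / 2 / √(m n) := by ring
  -- Outside `H` coefficients are at most half the central lower bound, so the centre lies in `H`.
  -- Then `2m ± r` both lie outside, so their sum is too small for the symmetry estimate.
  have hmem : (2 * m n : ℤ) ∈ H := by
    by_contra hcon
    have := hzero _ hcon
    linarith
  have h6 := hzero (2 * m n + r) fun hcon => hr ((H.add_mem_cancel_left hmem).1 hcon)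
  have h7 := hzero (2 * m n - r) fun hcon => hr (by
    have := H.sub_mem hmem hcon
    rwa [sub_sub_cancel] at this)
  have h8 := (abs_le.1 h4).1
  linarith

/-- If the central arcs dominate, all coefficients at bounded distance from the centre are of
order `1 / √m`, even after removing a bounded number of factors. -/
theorem exists_le_coeffZ_shift (h : SparseFamily P m d)
    (harc : ∀ a : ℝ, 0 < a → a < Real.pi → (fun n => arcOf (P n) n (2 * m n) Real.pi) ~[atTop]
      fun n => arcOf (P n) n (2 * m n) a) (i : ℕ) (r : ℤ) :
    ∃ c > 0, ∀ᶠ n in atTop, c / √(m n) ≤ coeffZ (P n ^ (n - i)) (2 * m n + r) := by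
  have key : PosAt P m atTop r := by
    by_contra hcon
    -- Failure of the bound makes `0` a cluster point of the normalised coefficients, hence their
    -- limit along some ultrafilter, where positivity is already known.
    have hcl : MapClusterPt 0 atTop fun n => √(m n) * coeffZ (P n ^ n) (2 * m n + r) := by
      rw [mapClusterPt_iff_frequently]
      intro S hS
      obtain ⟨η, hη, hball⟩ := Metric.mem_nhds_iff.1 hS
      have hfreq : ∃ᶠ n in atTop, ¬ η / √(m n) ≤ coeffZ (P n ^ n) (2 * m n + r) := by
        rw [← not_eventually]
        exact fun hev => hcon ⟨η, hη, hev⟩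
      refine (hfreq.and_eventually (h.isSubLaw.and (h.tendsto_m.eventually_gt_atTop 0))).mono ?_
      rintro n ⟨h1, hP, hm⟩
      have hsm : 0 < √(m n : ℝ) := Real.sqrt_pos.2 (by exact_mod_cast hm)
      refine hball ?_
      rw [Metric.mem_ball, dist_zero_right, Real.norm_of_nonneg (mul_nonneg hsm.le
        (coeffZ_nonneg (coeff_pow_nonneg hP.nonneg n) _))]
      rw [not_le, lt_div_iff₀ hsm] at h1
      linarith
    obtain ⟨U, hU, hlim⟩ := mapClusterPt_iff_ultrafilter.1 hcl
    obtain ⟨c, hc, hpos⟩ := h.posAt_of_ultrafilter harc hU r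
    obtain ⟨n, h1, h2, hm⟩ := (hpos.and ((hlim.eventually_lt_const hc).and
      ((h.tendsto_m.eventually_gt_atTop 0).filter_mono hU))).exists
    have hsm : 0 < √(m n : ℝ) := Real.sqrt_pos.2 (by exact_mod_cast hm)
    rw [div_le_iff₀ hsm] at h1
    linarith
  obtain ⟨c, hc, hpos⟩ := key
  refine ⟨c / 2, by positivity, ?_⟩
  filter_upwards [hpos, h.abs_coeffZ_pow_sub_sub_le i (half_pos hc)] with n h1 h2
  have h3 := (abs_le.1 (h2 (2 * m n + r))).1
  have e : c / √(m n) = c / 2 / √(m n) + c / 2 / √(m n) := by ring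
  linarith

end SparseFamily

/-! ### The law of a degree at the saddle point -/

lemma summable_pow_mul_of_lt {a : ℕ → ℝ} {x r : ℝ} (ha : ∀ j, 0 ≤ a j) (hx : 0 ≤ x) (hxr : x < r)
    (hs : Summable fun j => a j * r ^ j) (k : ℕ) :
    Summable fun j : ℕ => (j : ℝ) ^ k * (a j * x ^ j) := by
  have hr : 0 < r := hx.trans_lt hxr
  have hq : |x / r| < 1 := by
    rw [abs_of_nonneg (by positivity), div_lt_one hr]
    exact hxr
  obtain ⟨C, hC⟩ := (tendsto_pow_const_mul_const_pow_of_abs_lt_one k hq).bddAbove_range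
  refine Summable.of_nonneg_of_le (fun j => ?_) (fun j => ?_) (hs.mul_left C)
  · have := ha j
    positivity
  · have h1 : (j : ℝ) ^ k * (x / r) ^ j ≤ C := hC ⟨j, rfl⟩
    have h2 : 0 ≤ a j * r ^ j := mul_nonneg (ha j) (pow_nonneg hr.le j)
    calc (j : ℝ) ^ k * (a j * x ^ j) = ((j : ℝ) ^ k * (x / r) ^ j) * (a j * r ^ j) := by
          rw [div_pow]; field_simp
      _ ≤ C * (a j * r ^ j) := mul_le_mul_of_nonneg_right h1 h2

/-- Write `x^j = (x/r)^j r^j`; only `j ≥ t` occur and `x/r ≤ 1`, so `(x/r)^t` factors out. -/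
lemma tsum_mul_pow_le {a : ℕ → ℝ} {x r : ℝ} (ha : ∀ j, 0 ≤ a j) (hx : 0 ≤ x) (hr : 0 < r)
    (hxr : x ≤ r) (hs : Summable fun j => a j * r ^ j) {t : ℕ} (ht : ∀ j < t, a j = 0) :
    Summable (fun j => a j * x ^ j) ∧
      ∑' j, a j * x ^ j ≤ (∑' j, a j * r ^ j) / r ^ t * x ^ t := by
  have hle : ∀ j, a j * x ^ j ≤ (x / r) ^ t * (a j * r ^ j) := by
    intro j
    rcases lt_or_ge j t with hj | hj
    · simp [ht j hj]
    · have h1 : x ^ j = (x / r) ^ j * r ^ j := by rw [div_pow]; field_simp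
      have h2 : (x / r) ^ j ≤ (x / r) ^ t :=
        pow_le_pow_of_le_one (by positivity) (by rw [div_le_one hr]; exact hxr) hj
      have h3 := mul_nonneg (ha j) (pow_nonneg hr.le j)
      calc a j * x ^ j = (x / r) ^ j * (a j * r ^ j) := by rw [h1]; ring
        _ ≤ _ := mul_le_mul_of_nonneg_right h2 h3
  have hsum : Summable fun j => a j * x ^ j :=
    Summable.of_nonneg_of_le (fun j => mul_nonneg (ha j) (pow_nonneg hx j)) hle (hs.mul_left _)
  refine ⟨hsum, (hsum.tsum_le_tsum hle (hs.mul_left _)).trans (le_of_eq ?_)⟩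
  rw [tsum_mul_left, div_pow]
  ring

/-- The terms of the generating function. -/
lemma genFun_term (δ : ℕ → ℝ) (x : ℝ) (j : ℕ) :
    δ j * x ^ j / (j ! : ℝ) = δ j / (j ! : ℝ) * x ^ j := by ring

/-- The mean of the degree distribution is given by the logarithmic derivative. -/
lemma hasSum_mul_deriv_genFun {δ : ℕ → ℝ} (hδ : ∀ d, 0 ≤ δ d) {x r : ℝ} (hx : 0 < x) (hxr : x < r)
    (hs : Summable fun d : ℕ => δ d * r ^ d / (d ! : ℝ)) :
    HasSum (fun j : ℕ => (j : ℝ) * (δ j * x ^ j / (j ! : ℝ))) (x * deriv (genFun δ) x) := by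
  simp only [genFun_term] at hs ⊢
  have ha : ∀ j, 0 ≤ δ j / (j ! : ℝ) := fun j => div_nonneg (hδ j) (Nat.cast_nonneg _)
  -- An intermediate radius leaves room to sum the differentiated series uniformly on a ball
  -- containing `x`.
  set ρ := (x + r) / 2 with hρ
  have hxρ : x < ρ := by rw [hρ]; linarith
  have hρr : ρ < r := by rw [hρ]; linarith
  have hρ0 : 0 < ρ := hx.trans hxρ
  have hu : Summable fun j : ℕ => δ j / (j ! : ℝ) * (j * ρ ^ (j - 1)) := by
    have h1 := (summable_pow_mul_of_lt ha hρ0.le hρr hs 1).mul_left (1 / ρ)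
    refine h1.congr fun j => ?_
    rcases j with _ | j
    · simp
    · rw [Nat.add_sub_cancel]
      field_simp
      ring
  have hder := hasDerivAt_tsum_of_isPreconnected (t := Metric.ball (0 : ℝ) ρ)
    (g := fun (j : ℕ) y => δ j / (j ! : ℝ) * y ^ j)
    (g' := fun (j : ℕ) y => δ j / (j ! : ℝ) * (j * y ^ (j - 1)))
    (y := x) (y₀ := x) hu Metric.isOpen_ball (convex_ball 0 ρ).isPreconnected
    (fun j y _ => (hasDerivAt_pow j y).const_mul _)
    (fun j y hy => by
      rw [Metric.mem_ball, dist_zero_right, Real.norm_eq_abs] at hy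
      rw [norm_mul, norm_mul, norm_pow, Real.norm_of_nonneg (ha j),
        Real.norm_of_nonneg (Nat.cast_nonneg j), Real.norm_eq_abs]
      have := ha j
      gcongr)
    (by simpa [abs_of_pos hx] using hxρ)
    (by simpa using summable_pow_mul_of_lt ha hx.le hxr hs 0)
    (by simpa [abs_of_pos hx] using hxρ)
  have hgen : genFun δ = fun y => ∑' j : ℕ, δ j / (j ! : ℝ) * y ^ j := by
    funext y
    simp only [genFun, genFun_term]
  rw [hgen, hder.deriv, ← tsum_mul_left]
  have hsum : Summable fun j : ℕ => (j : ℝ) * (δ j / (j ! : ℝ) * x ^ j) := by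
    simpa using summable_pow_mul_of_lt ha hx.le hxr hs 1
  convert! hsum.hasSum using 1
  refine tsum_congr fun j => ?_
  rcases j with _ | j
  · simp
  · rw [Nat.add_sub_cancel, pow_succ]
    ring

/-- The degree distribution with parameter `x`. -/
noncomputable def law (δ : ℕ → ℝ) (x : ℝ) : PowerSeries ℝ :=
  PowerSeries.mk fun j => δ j * x ^ j / (j ! : ℝ) / genFun δ x

lemma coeff_law (δ : ℕ → ℝ) (x : ℝ) (j : ℕ) :
    PowerSeries.coeff j (law δ x) = δ j * x ^ j / (j ! : ℝ) / genFun δ x := by simp [law]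

/-- Basic consequences of the saddle point equation. -/
lemma IsSaddlePoint.basic {δ : ℕ → ℝ} (hδ : ∀ d, 0 ≤ δ d) {n m : ℕ} (hn : 0 < n) (hm : 0 < m)
    {χ : ℝ} (h : IsSaddlePoint δ n m χ) :
    0 < genFun δ χ ∧ HasSum (fun j => PowerSeries.coeff j (law δ χ)) 1 ∧
      HasSum (fun j : ℕ => (j : ℝ) * PowerSeries.coeff j (law δ χ)) (2 * (m : ℝ) / n) ∧
      IsSubLaw (law δ χ) := by
  obtain ⟨hχ, ⟨r, hχr, hr⟩, heq⟩ := h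
  have hn' : (0 : ℝ) < n := by exact_mod_cast hn
  have hm' : (0 : ℝ) < m := by exact_mod_cast hm
  have hw : ∀ j : ℕ, 0 ≤ δ j * χ ^ j / (j ! : ℝ) := fun j =>
    div_nonneg (mul_nonneg (hδ j) (pow_nonneg hχ.le j)) (Nat.cast_nonneg _)
  have hsum : Summable fun j : ℕ => δ j * χ ^ j / (j ! : ℝ) := by
    have := summable_pow_mul_of_lt (a := fun j => δ j / (j ! : ℝ))
      (fun j => div_nonneg (hδ j) (Nat.cast_nonneg _)) hχ.le hχr
      (by simpa only [genFun_term] using hr) 0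
    simpa only [pow_zero, one_mul, ← genFun_term] using this
  have hG0 : 0 ≤ genFun δ χ := tsum_nonneg hw
  -- If `Δ(χ)` vanished, division by zero would give `0` on the left of the saddle point equation,
  -- against `2m/n > 0`.
  have hG : genFun δ χ ≠ 0 := by
    intro h0
    rw [h0, div_zero] at heq
    have : 0 < 2 * (m : ℝ) / n := by positivity
    linarith
  have hGp : 0 < genFun δ χ := lt_of_le_of_ne hG0 (Ne.symm hG)
  have h1 : HasSum (fun j => PowerSeries.coeff j (law δ χ)) 1 := by
    simp only [coeff_law]
    have := hsum.hasSum.div_const (genFun δ χ)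
    rwa [← genFun, div_self hG] at this
  have h2 := (hasSum_mul_deriv_genFun hδ hχ hχr hr).div_const (genFun δ χ)
  rw [heq] at h2
  refine ⟨hGp, h1, ?_, ⟨fun j => ?_, h1.summable, h1.tsum_eq.le⟩⟩
  · simp only [coeff_law]
    simpa only [mul_div_assoc] using h2
  · rw [coeff_law]
    exact div_nonneg (hw j) hG0

lemma IsSubLaw.one_sub_coeff_zero_le {A : PowerSeries ℝ} (hA : IsSubLaw A)
    (h1 : HasSum (fun j => PowerSeries.coeff j A) 1) {μ : ℝ}
    (hmean : HasSum (fun j : ℕ => (j : ℝ) * PowerSeries.coeff j A) μ) :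
    1 - PowerSeries.coeff 0 A ≤ μ := by
  have h2 : HasSum (fun j : ℕ => if j = 0 then PowerSeries.coeff 0 A else 0)
      (PowerSeries.coeff 0 A) := hasSum_ite_eq 0 _
  refine hasSum_le (fun j => ?_) (h1.sub h2) hmean
  rcases j with _ | j
  · simp
  · simp only [Nat.add_eq_zero_iff, one_ne_zero, and_false, if_false, sub_zero]
    have := hA.nonneg (j + 1)
    have hj : (1 : ℝ) ≤ ((j + 1 : ℕ) : ℝ) := by exact_mod_cast Nat.le_add_left 1 j
    nlinarith

/-- The factor does not depend on `a`, so arc domination passes to the normalised law. -/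
lemma arcIntegral_eq {δ : ℕ → ℝ} {x : ℝ} (hG : genFun δ x ≠ 0) (n m : ℕ) (a : ℝ) :
    arcIntegral δ n m x a = (genFun δ x : ℂ) ^ n * arcOf (law δ x) n (2 * m) a := by
  have hG' : (genFun δ x : ℂ) ≠ 0 := by exact_mod_cast hG
  rw [arcIntegral, arcOf, ← intervalIntegral.integral_const_mul]
  refine intervalIntegral.integral_congr fun θ _ => ?_
  have e1 : genFunC δ ((x : ℂ) * Complex.exp ((θ : ℂ) * Complex.I)) =
      (genFun δ x : ℂ) * charSum (law δ x) θ := by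
    rw [genFunC, charSum, ← tsum_mul_left]
    refine tsum_congr fun j => ?_
    rw [coeff_law, mul_pow, ← Complex.exp_nat_mul]
    push_cast
    rw [show (j : ℂ) * ((θ : ℂ) * Complex.I) = (j : ℂ) * θ * Complex.I by ring]
    field_simp
  rw [e1, mul_pow, div_eq_mul_inv, ← Complex.exp_neg, mul_assoc]
  push_cast
  rfl

/-- The law is the rescaled generating function divided by its value. This identity translates
counting into local probabilities. -/
lemma coeff_law_pow (δ : ℕ → ℝ) {x : ℝ} (hG : genFun δ x ≠ 0) (N s : ℕ) :
    PowerSeries.coeff s (egf δ 0 ^ N) * x ^ s =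
      genFun δ x ^ N * PowerSeries.coeff s (law δ x ^ N) := by
  have h : law δ x = PowerSeries.C (genFun δ x)⁻¹ * PowerSeries.rescale x (egf δ 0) := by
    ext j
    rw [PowerSeries.coeff_C_mul, PowerSeries.coeff_rescale, coeff_law, coeff_egf, add_zero]
    ring
  rw [h, mul_pow, ← map_pow, ← map_pow, PowerSeries.coeff_C_mul, PowerSeries.coeff_rescale,
    inv_pow]
  field_simp

/-- The data of the theorem, without the tree. -/
structure SparseData (δ : ℕ → ℝ) (m : ℕ → ℕ) (χ : ℕ → ℝ) : Prop where
  nonneg : ∀ d, 0 ≤ δ d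
  radius : ∃ r : ℝ, 0 < r ∧ Summable fun d : ℕ => δ d * r ^ d / (d ! : ℝ)
  tendsto_m : Tendsto m atTop atTop
  tendsto_div : Tendsto (fun n => (m n : ℝ) / n) atTop (𝓝 0)
  saddle : ∀ᶠ n in atTop, IsSaddlePoint δ n (m n) (χ n)

/-! ### Size of the saddle point and moments of the tilted law -/

namespace SparseData

variable {δ : ℕ → ℝ} {m : ℕ → ℕ} {χ : ℕ → ℝ}

lemma basic (h : SparseData δ m χ) : ∀ᶠ n in atTop, 0 < n ∧ 0 < m n ∧ 0 < χ n ∧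
    0 < genFun δ (χ n) ∧ HasSum (fun j => PowerSeries.coeff j (law δ (χ n))) 1 ∧
      HasSum (fun j : ℕ => (j : ℝ) * PowerSeries.coeff j (law δ (χ n))) (2 * (m n : ℝ) / n) ∧
      IsSubLaw (law δ (χ n)) := by
  filter_upwards [h.saddle, h.tendsto_m.eventually_gt_atTop 0, eventually_gt_atTop 0] with n h1 hm hn
  exact ⟨hn, hm, h1.1, h1.basic h.nonneg hn hm⟩

lemma tendsto_coeff_zero (h : SparseData δ m χ) :
    Tendsto (fun n => PowerSeries.coeff 0 (law δ (χ n))) atTop (𝓝 1) := by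
  have hlim : Tendsto (fun n => 1 - 2 * ((m n : ℝ) / n)) atTop (𝓝 (1 - 2 * 0)) :=
    (h.tendsto_div.const_mul 2).const_sub 1
  rw [mul_zero, sub_zero] at hlim
  refine tendsto_of_tendsto_of_tendsto_of_le_of_le' hlim tendsto_const_nhds ?_ ?_
  · filter_upwards [h.basic] with n ⟨_, _, _, _, h1, h2, h3⟩
    have := h3.one_sub_coeff_zero_le h1 h2
    rw [mul_div_assoc] at this
    linarith
  · filter_upwards [h.basic] with n ⟨_, _, _, _, h1, h2, h3⟩
    exact le_hasSum h1 0 fun j _ => h3.nonneg j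

/-- The weight of isolated vertices is positive, and the generating function is close to it. -/
lemma genFun_bounds (h : SparseData δ m χ) : 0 < δ 0 ∧
    ∀ᶠ n in atTop, δ 0 ≤ genFun δ (χ n) ∧ genFun δ (χ n) ≤ 2 * δ 0 := by
  have key : ∀ᶠ n in atTop, 0 < genFun δ (χ n) ∧ 1 / 2 ≤ δ 0 / genFun δ (χ n) ∧
      δ 0 / genFun δ (χ n) ≤ 1 := by
    filter_upwards [h.basic, h.tendsto_coeff_zero.eventually_const_le
      (by norm_num : (1 / 2 : ℝ) < 1)] with n ⟨_, _, _, hG, h1, _, h3⟩ h4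
    have h5 := le_hasSum h1 0 fun j _ => h3.nonneg j
    rw [coeff_law] at h4 h5
    simp only [pow_zero, mul_one, Nat.factorial_zero, Nat.cast_one, div_one] at h4 h5
    exact ⟨hG, h4, h5⟩
  constructor
  · obtain ⟨n, hG, h1, -⟩ := key.exists
    rw [le_div_iff₀ hG] at h1
    linarith
  · filter_upwards [key] with n ⟨hG, h1, h2⟩
    rw [le_div_iff₀ hG] at h1
    rw [div_le_one hG] at h2
    constructor <;> linarith

/-- The smallest positive degree. -/
lemma mu_one_spec (h : SparseData δ m χ) :
    1 ≤ mu δ 1 ∧ 0 < δ (mu δ 1) ∧ ∀ j, 1 ≤ j → j < mu δ 1 → δ j = 0 := by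
  -- Without a positive degree the mean would be zero, but it equals `2m/n > 0`.
  have hex : {d | 1 ≤ d ∧ 0 < δ d}.Nonempty := by
    by_contra hcon
    rw [Set.not_nonempty_iff_eq_empty] at hcon
    obtain ⟨n, hn, hm, _, _, _, h2, _⟩ := h.basic.exists
    have h3 : ∀ j : ℕ, (j : ℝ) * PowerSeries.coeff j (law δ (χ n)) = 0 := by
      intro j
      rcases Nat.eq_zero_or_pos j with rfl | hj
      · simp
      · have : ¬ 0 < δ j := fun h0 => by
          have hmem : j ∈ {d | 1 ≤ d ∧ 0 < δ d} := ⟨hj, h0⟩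
          rw [hcon] at hmem
          exact hmem
        rw [coeff_law, le_antisymm (not_lt.1 this) (h.nonneg j)]
        simp
    simp only [h3] at h2
    have h4 := h2.unique hasSum_zero
    have : 0 < 2 * (m n : ℝ) / n := by
      have : (0 : ℝ) < m n := by exact_mod_cast hm
      have : (0 : ℝ) < n := by exact_mod_cast hn
      positivity
    linarith
  have hmem := Nat.sInf_mem hex
  refine ⟨hmem.1, hmem.2, fun j hj hlt => ?_⟩
  by_contra hne
  exact Nat.notMem_of_lt_sInf hlt ⟨hj, lt_of_le_of_ne (h.nonneg j) (Ne.symm hne)⟩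

/-- The mean `2m/n` is at least its single term of degree `μ(1)`. -/
lemma exists_pow_le (h : SparseData δ m χ) : ∃ C > 0, ∀ᶠ n in atTop,
    χ n ^ mu δ 1 ≤ C * (m n / n) := by
  obtain ⟨hd1, hd2, -⟩ := h.mu_one_spec
  obtain ⟨h0, hG⟩ := h.genFun_bounds
  set d := mu δ 1 with hd
  refine ⟨(d ! : ℝ) / δ d * (4 * δ 0), by positivity, ?_⟩
  filter_upwards [hG, h.basic] with n hG ⟨hn, hm, hχ, hG0, h1, h2, h3⟩
  have h4 := le_hasSum h2 d fun j _ => mul_nonneg (Nat.cast_nonneg j) (h3.nonneg j)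
  have h5 : PowerSeries.coeff d (law δ (χ n)) ≤ 2 * (m n : ℝ) / n := by
    have hd1' : (1 : ℝ) ≤ d := by exact_mod_cast hd1
    have := h3.nonneg d
    nlinarith
  rw [coeff_law, div_le_iff₀ hG0] at h5
  have hq : 0 ≤ (m n : ℝ) / n := by positivity
  have h6 : δ d * χ n ^ d / (d ! : ℝ) ≤ (4 * δ 0) * (m n / n) := by
    refine h5.trans ?_
    rw [mul_div_assoc]
    nlinarith [mul_le_mul_of_nonneg_left hG.2 hq]
  calc χ n ^ d = (d ! : ℝ) / δ d * (δ d * χ n ^ d / (d ! : ℝ)) := by field_simp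
    _ ≤ (d ! : ℝ) / δ d * ((4 * δ 0) * (m n / n)) := by gcongr
    _ = _ := by ring

lemma tendsto_chi (h : SparseData δ m χ) : Tendsto χ atTop (𝓝 0) := by
  obtain ⟨C, hC, hle⟩ := h.exists_pow_le
  have hd := h.mu_one_spec.1
  have hlim := h.tendsto_div.const_mul C
  rw [mul_zero] at hlim
  rw [Metric.tendsto_nhds]
  intro η hη
  filter_upwards [hle, h.basic, hlim.eventually_lt_const (pow_pos hη (mu δ 1))] with
    n h1 ⟨_, _, hχ, _⟩ h2
  rw [dist_zero_right, Real.norm_of_nonneg hχ.le]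
  exact lt_of_pow_lt_pow_left₀ _ hη.le (h1.trans_lt h2)

/-- A radius inside the disc of convergence. -/
lemma exists_radius (h : SparseData δ m χ) : ∃ r : ℝ, 0 < r ∧
    (∀ k : ℕ, Summable fun j : ℕ => (j : ℝ) ^ k * (δ j / (j ! : ℝ)) * r ^ j) ∧
    ∀ᶠ n in atTop, χ n ≤ r := by
  obtain ⟨r, hr, hs⟩ := h.radius
  refine ⟨r / 2, by positivity, fun k => ?_, h.tendsto_chi.eventually_le_const (by positivity)⟩
  simp only [genFun_term] at hs
  have := summable_pow_mul_of_lt (fun j => div_nonneg (h.nonneg j) (Nat.cast_nonneg _))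
    (by positivity : 0 ≤ r / 2) (by linarith) hs k
  simpa only [mul_assoc] using this

/-- Moments of the degree distribution at the saddle point. -/
lemma exists_moment_le (h : SparseData δ m χ) (k : ℕ) (hk : k ≠ 0) : ∃ C > 0, ∀ᶠ n in atTop,
    Summable (fun j : ℕ => (j : ℝ) ^ k * PowerSeries.coeff j (law δ (χ n))) ∧
      ∑' j : ℕ, (j : ℝ) ^ k * PowerSeries.coeff j (law δ (χ n)) ≤ C * χ n ^ mu δ 1 := by
  obtain ⟨r, hr, hs, hχr⟩ := h.exists_radius
  obtain ⟨hd1, hd2, hd3⟩ := h.mu_one_spec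
  obtain ⟨h0, hG⟩ := h.genFun_bounds
  set M := ∑' j : ℕ, (j : ℝ) ^ k * (δ j / (j ! : ℝ)) * r ^ j with hM
  have ha : ∀ j : ℕ, 0 ≤ (j : ℝ) ^ k * (δ j / (j ! : ℝ)) := fun j =>
    mul_nonneg (by positivity) (div_nonneg (h.nonneg j) (Nat.cast_nonneg _))
  have hM0 : 0 ≤ M := tsum_nonneg fun j => mul_nonneg (ha j) (pow_nonneg hr.le j)
  refine ⟨(M + 1) / r ^ mu δ 1 / δ 0, by positivity, ?_⟩
  filter_upwards [hG, h.basic, hχr] with n hG ⟨hn, hm, hχ, hG0, _⟩ hχr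
  obtain ⟨h1, h2⟩ := tsum_mul_pow_le ha hχ.le hr hχr (hs k) (t := mu δ 1) fun j hj => by
    rcases Nat.eq_zero_or_pos j with rfl | hj0
    · simp [hk]
    · rw [hd3 j hj0 hj, zero_div, mul_zero]
  have e : (fun j : ℕ => (j : ℝ) ^ k * PowerSeries.coeff j (law δ (χ n))) =
      fun j : ℕ => ((j : ℝ) ^ k * (δ j / (j ! : ℝ)) * χ n ^ j) / genFun δ (χ n) := by
    funext j
    rw [coeff_law]
    ring
  rw [e, tsum_div_const]
  refine ⟨h1.div_const _, ?_⟩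
  rw [div_le_iff₀ hG0]
  refine h2.trans ?_
  calc M / r ^ mu δ 1 * χ n ^ mu δ 1 ≤ (M + 1) / r ^ mu δ 1 * χ n ^ mu δ 1 := by
        gcongr; linarith
    _ = (M + 1) / r ^ mu δ 1 / δ 0 * χ n ^ mu δ 1 * δ 0 := by field_simp
    _ ≤ _ := by
        gcongr
        exact hG.1

/-- Conversely, the mean is a power series in `χ` starting at degree `μ(1)`, up to the bounded
factor `1/Δ(χ)`. -/
lemma exists_le_pow (h : SparseData δ m χ) : ∃ c > 0, ∀ᶠ n in atTop,
    c * (m n / n) ≤ χ n ^ mu δ 1 := by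
  obtain ⟨C, hC, hle⟩ := h.exists_moment_le 1 one_ne_zero
  refine ⟨2 / C, by positivity, ?_⟩
  filter_upwards [hle, h.basic] with n h1 ⟨_, _, _, _, _, h2, _⟩
  have h3 := h1.2
  simp only [pow_one] at h3
  rw [h2.tsum_eq] at h3
  calc 2 / C * ((m n : ℝ) / n) = (2 * (m n : ℝ) / n) / C := by ring
    _ ≤ χ n ^ mu δ 1 := by
        rw [div_le_iff₀ hC]
        linarith

theorem sparseFamily (h : SparseData δ m χ) :
    SparseFamily (fun n => law δ (χ n)) m (mu δ 1) where
  d_ne := (Nat.one_le_iff_ne_zero.1 h.mu_one_spec.1)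
  tendsto_m := h.tendsto_m
  tendsto_div := h.tendsto_div
  isSubLaw := h.basic.mono fun n hn => hn.2.2.2.2.2.2
  hasSum := h.basic.mono fun n hn => hn.2.2.2.2.1
  tendsto_zero := h.tendsto_coeff_zero
  le_coeff := by
    obtain ⟨c, hc, hle⟩ := h.exists_le_pow
    obtain ⟨hd1, hd2, -⟩ := h.mu_one_spec
    obtain ⟨h0, hG⟩ := h.genFun_bounds
    refine ⟨δ (mu δ 1) / (mu δ 1)! / (2 * δ 0) * c, by positivity, ?_⟩
    filter_upwards [hle, hG, h.basic] with n h1 hG ⟨hn, hm, hχ, hG0, _⟩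
    have hn' : (0 : ℝ) < n := by exact_mod_cast hn
    rw [coeff_law]
    calc δ (mu δ 1) / (mu δ 1)! / (2 * δ 0) * c * m n
        = n * (δ (mu δ 1) * (c * (m n / n)) / (mu δ 1)! / (2 * δ 0)) := by field_simp
      _ ≤ n * (δ (mu δ 1) * χ n ^ mu δ 1 / (mu δ 1)! / genFun δ (χ n)) := by
          gcongr
          exact hG.2
  mean := h.basic.mono fun n hn => hn.2.2.2.2.2.1
  third := by
    obtain ⟨C, hC, hle⟩ := h.exists_moment_le 3 (by norm_num)
    obtain ⟨C', hC', hle'⟩ := h.exists_pow_le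
    refine ⟨C * C', ?_⟩
    filter_upwards [hle, hle'] with n h1 h2
    refine ⟨h1.1, h1.2.trans ?_⟩
    rw [mul_assoc]
    gcongr
  tail := by
    intro t
    rcases (h.nonneg t).eq_or_lt with h0 | ht
    · left
      intro n
      rw [coeff_law, ← h0]
      simp
    · right
      obtain ⟨r, hr, hs, hχr⟩ := h.exists_radius
      have hs0 : Summable fun j : ℕ => δ (j + t) / ((j + t)! : ℝ) * r ^ j := by
        have h1 := ((summable_nat_add_iff t).2 (hs 0)).mul_right (1 / r ^ t)
        refine h1.congr fun j => ?_
        rw [pow_add]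
        field_simp
      refine ⟨(∑' j : ℕ, δ (j + t) / ((j + t)! : ℝ) * r ^ j) * (t ! / δ t), ?_⟩
      filter_upwards [hχr, h.basic] with n hχr ⟨hn, hm, hχ, hG0, _⟩
      obtain ⟨h1, h2⟩ := tsum_mul_pow_le (a := fun j => δ (j + t) / ((j + t)! : ℝ))
        (fun j => div_nonneg (h.nonneg _) (Nat.cast_nonneg _)) hχ.le hr hχr hs0 (t := 0) (by simp)
      rw [pow_zero, pow_zero, div_one, mul_one] at h2
      have e : (fun j : ℕ => PowerSeries.coeff (j + t) (law δ (χ n))) =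
          fun j : ℕ => (χ n ^ t / genFun δ (χ n)) * (δ (j + t) / ((j + t)! : ℝ) * χ n ^ j) := by
        funext j
        rw [coeff_law, pow_add]
        ring
      rw [e, tsum_mul_left, coeff_law]
      calc _ ≤ χ n ^ t / genFun δ (χ n) * ∑' j : ℕ, δ (j + t) / ((j + t)! : ℝ) * r ^ j := by
            gcongr
        _ = _ := by field_simp

lemma arcOf_isEquivalent (h : SparseData δ m χ) (harc : CentralArcDominates δ m χ) :
    ∀ a : ℝ, 0 < a → a < Real.pi →
      (fun n => arcOf (law δ (χ n)) n (2 * m n) Real.pi) ~[atTop]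
        fun n => arcOf (law δ (χ n)) n (2 * m n) a := by
  intro a h0 h1
  have h2 := harc a h0 h1
  have h3 := (IsEquivalent.refl (l := atTop)
    (u := fun n => ((genFun δ (χ n) : ℂ) ^ n)⁻¹)).mul h2
  refine (h3.congr_left ?_).congr_right ?_
  all_goals
    filter_upwards [h.basic] with n ⟨_, _, _, hG0, _⟩
    have hG' : (genFun δ (χ n) : ℂ) ^ n ≠ 0 := pow_ne_zero _ (by exact_mod_cast hG0.ne')
    rw [Pi.mul_apply, arcIntegral_eq hG0.ne', inv_mul_cancel_left₀ hG']

end SparseData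

/-! ### The expected number of copies -/

lemma mu_spec {δ : ℕ → ℝ} {j : ℕ} (h : ∃ d, j ≤ d ∧ 0 < δ d) : j ≤ mu δ j ∧ 0 < δ (mu δ j) :=
  Nat.sInf_mem (s := {d | j ≤ d ∧ 0 < δ d}) h

lemma eq_zero_of_lt_mu {δ : ℕ → ℝ} (hδ : ∀ d, 0 ≤ δ d) {j i : ℕ} (hj : j ≤ i) (hi : i < mu δ j) :
    δ i = 0 := by
  by_contra hne
  exact Nat.notMem_of_lt_sInf hi ⟨hj, lt_of_le_of_ne (hδ i) (Ne.symm hne)⟩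

lemma coeff_egf_nonneg {δ : ℕ → ℝ} (hδ : ∀ d, 0 ≤ δ d) (c j : ℕ) :
    0 ≤ PowerSeries.coeff j (egf δ c) := by
  rw [coeff_egf]
  exact div_nonneg (hδ _) (Nat.cast_nonneg _)

namespace SparseData

variable {δ : ℕ → ℝ} {m : ℕ → ℕ} {χ : ℕ → ℝ}

/-- The derivatives of the generating function near zero. -/
lemma exists_egf_le (h : SparseData δ m χ) (c : ℕ) : ∃ C > 0, ∀ᶠ n in atTop,
    Summable (fun j : ℕ => PowerSeries.coeff j (egf δ c) * χ n ^ j) ∧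
      ∑' j : ℕ, PowerSeries.coeff j (egf δ c) * χ n ^ j ≤ C * χ n ^ (mu δ c - c) := by
  obtain ⟨r, hr, hs, hχr⟩ := h.exists_radius
  have hs0 : Summable fun j : ℕ => PowerSeries.coeff j (egf δ c) * r ^ j := by
    have h1 := ((summable_nat_add_iff c).2 (hs c)).mul_right (1 / r ^ c)
    refine Summable.of_nonneg_of_le
      (fun j => mul_nonneg (coeff_egf_nonneg h.nonneg c j) (pow_nonneg hr.le j)) (fun j => ?_) h1
    have h2 : ((j + c)! : ℝ) ≤ (j ! : ℝ) * ((j + c : ℕ) : ℝ) ^ c := by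
      have h3 := Nat.factorial_mul_descFactorial (Nat.le_add_left c j)
      rw [Nat.add_sub_cancel] at h3
      rw [← h3]
      push_cast
      gcongr
      exact_mod_cast Nat.descFactorial_le_pow (j + c) c
    have h4 : (1 : ℝ) / (j ! : ℝ) ≤ ((j + c : ℕ) : ℝ) ^ c / ((j + c)! : ℝ) := by
      rw [div_le_div_iff₀ (by positivity) (by positivity)]
      linarith
    have h5 := h.nonneg (j + c)
    rw [coeff_egf]
    calc δ (j + c) / (j ! : ℝ) * r ^ j = δ (j + c) * r ^ j * (1 / (j ! : ℝ)) := by ring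
      _ ≤ δ (j + c) * r ^ j * (((j + c : ℕ) : ℝ) ^ c / ((j + c)! : ℝ)) := by gcongr
      _ = _ := by rw [pow_add]; field_simp
  set M := ∑' j : ℕ, PowerSeries.coeff j (egf δ c) * r ^ j with hM
  have hM0 : 0 ≤ M := tsum_nonneg fun j =>
    mul_nonneg (coeff_egf_nonneg h.nonneg c j) (pow_nonneg hr.le j)
  -- If no admissible degree is at least `c`, then `mu δ c = 0`, the truncated exponent is `0`, and
  -- the bound still holds.
  refine ⟨(M + 1) / r ^ (mu δ c - c), by positivity, ?_⟩
  filter_upwards [hχr, h.basic] with n hχr ⟨hn, hm, hχ, _⟩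
  obtain ⟨h1, h2⟩ := tsum_mul_pow_le (coeff_egf_nonneg h.nonneg c) hχ.le hr hχr hs0
    (t := mu δ c - c) fun j hj => by
      rw [coeff_egf, eq_zero_of_lt_mu h.nonneg (Nat.le_add_left c j) (by omega), zero_div]
  refine ⟨h1, h2.trans ?_⟩
  gcongr
  linarith

variable {V : Type*} [Fintype V]

/-- The uniform `1/√m` bound survives multiplication by the vertex series at the cost of their
values at `χ`. -/
lemma exists_coeff_prod_le (h : SparseData δ m χ) (T : SimpleGraph V) [DecidableRel T.Adj] :
    ∃ C > 0, ∀ᶠ n in atTop, ∀ s : ℕ, PowerSeries.coeff s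
      (egf δ 0 ^ (n - Fintype.card V) * ∏ u, egf δ (T.degree u)) * χ n ^ s ≤
        C * genFun δ (χ n) ^ (n - Fintype.card V) *
          χ n ^ (∑ u, (mu δ (T.degree u) - T.degree u)) / √(m n) := by
  obtain ⟨C, hC, hup⟩ := h.sparseFamily.exists_coeffZ_le
  choose D hD hDle using fun u : V => h.exists_egf_le (T.degree u)
  refine ⟨C * ∏ u, D u, mul_pos hC (Finset.prod_pos fun u _ => hD u), ?_⟩
  filter_upwards [hup, eventually_all.2 hDle, h.basic,
    eventually_ge_atTop (2 * Fintype.card V)] with n h1 h2 ⟨hn, hm, hχ, hG, _⟩ hnV s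
  have hb := coeff_mul_prod_le Finset.univ (egf δ 0 ^ (n - Fintype.card V))
    (fun u => egf δ (T.degree u)) hχ.le
    (M := genFun δ (χ n) ^ (n - Fintype.card V) * (C / √(m n))) (by positivity)
    (fun u j => coeff_egf_nonneg h.nonneg _ j) _ (fun u => (h2 u).1.hasSum) (fun s => by
      rw [coeff_law_pow δ hG.ne', ← coeffZ_natCast]
      exact mul_le_mul_of_nonneg_left (h1 _ (by omega) _) (by positivity)) s
  refine hb.trans ?_
  have h3 : ∏ u, ∑' j : ℕ, PowerSeries.coeff j (egf δ (T.degree u)) * χ n ^ j ≤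
      ∏ u, (D u * χ n ^ (mu δ (T.degree u) - T.degree u)) :=
    Finset.prod_le_prod (fun u _ => tsum_nonneg fun j =>
      mul_nonneg (coeff_egf_nonneg h.nonneg _ j) (pow_nonneg hχ.le j)) fun u _ => (h2 u).2
  rw [Finset.prod_mul_distrib, Finset.prod_pow_eq_pow_sum] at h3
  refine (mul_le_mul_of_nonneg_left h3 (by positivity)).trans (le_of_eq ?_)
  ring

/-- Each vertex of `T` takes the smallest admissible degree, that is, the lowest term of its series;
the other `n - k` vertices must then share `2m - γ` half-edges, a bounded offset from the centre. -/
lemma exists_le_coeff_prod (h : SparseData δ m χ) (harc : CentralArcDominates δ m χ)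
    (T : SimpleGraph V) [DecidableRel T.Adj] (hμ : ∀ v, ∃ d, T.degree v ≤ d ∧ 0 < δ d) :
    ∃ c > 0, ∀ᶠ n in atTop, c * genFun δ (χ n) ^ (n - Fintype.card V) *
        χ n ^ (∑ u, (mu δ (T.degree u) - T.degree u)) / √(m n) ≤
      PowerSeries.coeff (2 * m n - gammaTree δ T + ∑ u, (mu δ (T.degree u) - T.degree u))
        (egf δ 0 ^ (n - Fintype.card V) * ∏ u, egf δ (T.degree u)) *
        χ n ^ (2 * m n - gammaTree δ T + ∑ u, (mu δ (T.degree u) - T.degree u)) := by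
  obtain ⟨c, hc, hlow⟩ := h.sparseFamily.exists_le_coeffZ_shift (h.arcOf_isEquivalent harc)
    (Fintype.card V) (-(gammaTree δ T : ℤ))
  have hq : ∀ u : V, 0 < PowerSeries.coeff (mu δ (T.degree u) - T.degree u)
      (egf δ (T.degree u)) := by
    intro u
    obtain ⟨h1, h2⟩ := mu_spec (hμ u)
    rw [coeff_egf, Nat.sub_add_cancel h1]
    positivity
  set q := ∏ u, PowerSeries.coeff (mu δ (T.degree u) - T.degree u) (egf δ (T.degree u)) with hqdef
  have hq0 : 0 < q := Finset.prod_pos fun u _ => hq u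
  refine ⟨c * q, by positivity, ?_⟩
  filter_upwards [hlow, h.basic, h.tendsto_m.eventually_ge_atTop (gammaTree δ T)] with
    n h1 ⟨hn, hm, hχ, hG, _⟩ hγ
  have h2 := le_coeff_mul_prod Finset.univ
    (coeff_pow_nonneg (coeff_egf_nonneg h.nonneg 0) (n - Fintype.card V))
    (B := fun u : V => egf δ (T.degree u)) (fun u j => coeff_egf_nonneg h.nonneg _ j)
    (fun u => mu δ (T.degree u) - T.degree u) (2 * m n - gammaTree δ T)
  have e : (2 * m n : ℤ) + -(gammaTree δ T : ℤ) = ((2 * m n - gammaTree δ T : ℕ) : ℤ) := by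
    omega
  rw [e, coeffZ_natCast] at h1
  refine le_trans ?_ (mul_le_mul_of_nonneg_right h2 (pow_nonneg hχ.le _))
  rw [pow_add (χ n) (2 * m n - gammaTree δ T)]
  set X := χ n ^ ∑ u, (mu δ (T.degree u) - T.degree u) with hX
  have hX0 : 0 < X := pow_pos hχ _
  have h3 := coeff_law_pow δ hG.ne' (n - Fintype.card V) (2 * m n - gammaTree δ T)
  rw [← hqdef]
  calc c * q * genFun δ (χ n) ^ (n - Fintype.card V) * X / √(m n)
      = genFun δ (χ n) ^ (n - Fintype.card V) * (c / √(m n)) * (q * X) := by ring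
    _ ≤ genFun δ (χ n) ^ (n - Fintype.card V) * PowerSeries.coeff (2 * m n - gammaTree δ T)
          (law δ (χ n) ^ (n - Fintype.card V)) * (q * X) := by gcongr
    _ = _ := by
        rw [← h3]
        ring

/-- The ratio of the coefficients that govern the expected number of copies. -/
lemma exists_ratio_bounds (h : SparseData δ m χ) (harc : CentralArcDominates δ m χ)
    (T : SimpleGraph V) [DecidableRel T.Adj] (hμ : ∀ v, ∃ d, T.degree v ≤ d ∧ 0 < δ d) {e : ℕ}
    (he : ∑ u, T.degree u = 2 * e) :
    ∃ c > 0, ∃ C > 0, ∀ᶠ n in atTop, 0 < PowerSeries.coeff (2 * m n) (egf δ 0 ^ n) ∧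
      c * χ n ^ gammaTree δ T * PowerSeries.coeff (2 * m n) (egf δ 0 ^ n) ≤
        PowerSeries.coeff (2 * (m n - e))
          (egf δ 0 ^ (n - Fintype.card V) * ∏ u, egf δ (T.degree u)) ∧
      PowerSeries.coeff (2 * (m n - e))
          (egf δ 0 ^ (n - Fintype.card V) * ∏ u, egf δ (T.degree u)) ≤
        C * χ n ^ gammaTree δ T * PowerSeries.coeff (2 * m n) (egf δ 0 ^ n) := by
  obtain ⟨c₁, hc₁, h1⟩ := h.exists_le_coeff_prod harc T hμ
  obtain ⟨C₁, hC₁, h2⟩ := h.exists_coeff_prod_le T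
  obtain ⟨c₂, hc₂, h3⟩ := h.sparseFamily.exists_le_coeffZ (h.arcOf_isEquivalent harc)
  obtain ⟨C₂, hC₂, h4⟩ := h.sparseFamily.exists_coeffZ_le
  obtain ⟨hδ0, hG⟩ := h.genFun_bounds
  set k := Fintype.card V with hk
  -- The exponent of `χ` is `γ`: the excess degrees come from the lowest terms, and `2e` from
  -- comparing indices `2m` and `2(m-e)`.
  have hγ : ∑ u, (mu δ (T.degree u) - T.degree u) + 2 * e = gammaTree δ T := by
    rw [← he, ← Finset.sum_add_distrib, gammaTree]
    exact Finset.sum_congr rfl fun u _ => Nat.sub_add_cancel (mu_spec (hμ u)).1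
  set x := ∑ u, (mu δ (T.degree u) - T.degree u) with hx
  refine ⟨c₁ / (C₂ * (2 * δ 0) ^ k), by positivity, C₁ / (c₂ * δ 0 ^ k), by positivity, ?_⟩
  filter_upwards [h1, h2, h3, h4, hG, h.basic, eventually_ge_atTop k,
    h.tendsto_m.eventually_ge_atTop (gammaTree δ T)] with
    n h1 h2 h3 h4 hG ⟨hn, hm, hχ, hG0, _⟩ hnk hmγ
  have hsm : 0 < √(m n : ℝ) := Real.sqrt_pos.2 (by exact_mod_cast hm)
  have hs : 2 * m n - gammaTree δ T + x = 2 * (m n - e) := by omega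
  rw [hs] at h1
  replace h2 := h2 (2 * (m n - e))
  set B := PowerSeries.coeff (2 * (m n - e)) (egf δ 0 ^ (n - k) * ∏ u, egf δ (T.degree u)) with hB
  have h5 := coeff_law_pow δ hG0.ne' n (2 * m n)
  set D := PowerSeries.coeff (2 * m n) (egf δ 0 ^ n) with hD
  replace h4 := h4 n (by omega) ((2 * m n : ℕ) : ℤ)
  rw [show (2 * m n : ℤ) = ((2 * m n : ℕ) : ℤ) by push_cast; rfl] at h3
  rw [coeffZ_natCast] at h3 h4
  set f := PowerSeries.coeff (2 * m n) (law δ (χ n) ^ n) with hf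
  have hf0 : 0 < f := lt_of_lt_of_le (by positivity) h3
  set Δ := genFun δ (χ n) with hΔ
  have hpow : Δ ^ n = Δ ^ (n - k) * Δ ^ k := by rw [← pow_add]; congr 1; omega
  have hχS : χ n ^ (2 * m n) = χ n ^ (2 * (m n - e)) * χ n ^ (2 * e) := by
    rw [← pow_add]; congr 1; omega
  have hχγ : χ n ^ gammaTree δ T = χ n ^ x * χ n ^ (2 * e) := by rw [← pow_add, hγ]
  have hX : 0 < χ n ^ (2 * m n) := pow_pos hχ _
  have hD0 : 0 < D := by
    have : 0 < D * χ n ^ (2 * m n) := by rw [h5]; positivity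
    exact pos_of_mul_pos_left this hX.le
  have hBe : B * χ n ^ (2 * m n) = (B * χ n ^ (2 * (m n - e))) * χ n ^ (2 * e) := by
    rw [hχS]; ring
  have hlo : Δ ^ k ≤ (2 * δ 0) ^ k := pow_le_pow_left₀ hG0.le hG.2 k
  have hhi : δ 0 ^ k ≤ Δ ^ k := pow_le_pow_left₀ hδ0.le hG.1 k
  refine ⟨hD0, ?_, ?_⟩
  · refine le_of_mul_le_mul_right ?_ hX
    rw [hBe]
    calc c₁ / (C₂ * (2 * δ 0) ^ k) * χ n ^ gammaTree δ T * D * χ n ^ (2 * m n)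
        = c₁ / (C₂ * (2 * δ 0) ^ k) * χ n ^ gammaTree δ T * (Δ ^ n * f) := by rw [← h5]; ring
      _ ≤ c₁ / (C₂ * (2 * δ 0) ^ k) * χ n ^ gammaTree δ T *
            (Δ ^ (n - k) * (2 * δ 0) ^ k * (C₂ / √(m n))) := by
          rw [hpow]
          gcongr
      _ = (c₁ * Δ ^ (n - k) * χ n ^ x / √(m n)) * χ n ^ (2 * e) := by
          rw [hχγ]
          field_simp
      _ ≤ _ := by gcongr
  · refine le_of_mul_le_mul_right ?_ hX
    rw [hBe]
    calc B * χ n ^ (2 * (m n - e)) * χ n ^ (2 * e)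
        ≤ (C₁ * Δ ^ (n - k) * χ n ^ x / √(m n)) * χ n ^ (2 * e) := by gcongr
      _ = C₁ / (c₂ * δ 0 ^ k) * χ n ^ gammaTree δ T *
            (Δ ^ (n - k) * δ 0 ^ k * (c₂ / √(m n))) := by
          rw [hχγ]
          field_simp
      _ ≤ C₁ / (c₂ * δ 0 ^ k) * χ n ^ gammaTree δ T * (Δ ^ n * f) := by
          rw [hpow]
          gcongr
      _ = _ := by rw [← h5]; ring

end SparseData

lemma expectedCopies_eq {V : Type*} (δ : ℕ → ℝ) (n m : ℕ) (T : SimpleGraph V) :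
    expectedCopies δ n m T =
      (∑ G : Multigraph n m, G.weight δ * (G.copies T : ℝ)) / totalWeight δ n m := by
  rw [expectedCopies, Finset.sum_div]
  exact Finset.sum_congr rfl fun G _ => by rw [prob]; ring

lemma factorial_ratio {m e : ℕ} (h : 2 * e ≤ m) :
    (m : ℝ) ^ (2 * e) * ((2 * (m - e))! : ℝ) ≤ ((2 * m)! : ℝ) ∧
      ((2 * m)! : ℝ) ≤ (2 * m : ℝ) ^ (2 * e) * ((2 * (m - e))! : ℝ) := by
  have h1 := Nat.factorial_mul_descFactorial (n := 2 * m) (k := 2 * e) (by omega)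
  rw [show 2 * m - 2 * e = 2 * (m - e) by omega] at h1
  have h2 := Nat.pow_sub_le_descFactorial (2 * m) (2 * e)
  have h3 := Nat.descFactorial_le_pow (2 * m) (2 * e)
  have h4 : m ^ (2 * e) ≤ (2 * m + 1 - 2 * e) ^ (2 * e) := Nat.pow_le_pow_left (by omega) _
  rw [← h1]
  constructor
  · rw [mul_comm]
    exact_mod_cast Nat.mul_le_mul_left _ (h4.trans h2)
  · rw [mul_comm]
    exact_mod_cast Nat.mul_le_mul_right _ h3

lemma descFactorial_bounds {n k : ℕ} (h : 2 * k ≤ n) :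
    ((n : ℝ) / 2) ^ k ≤ (n.descFactorial k : ℝ) ∧ (n.descFactorial k : ℝ) ≤ (n : ℝ) ^ k := by
  constructor
  · have h1 : ((n + 1 - k : ℕ) : ℝ) ^ k ≤ (n.descFactorial k : ℝ) := by
      exact_mod_cast Nat.pow_sub_le_descFactorial n k
    refine le_trans ?_ h1
    have h2 : (n : ℝ) ≤ 2 * ((n + 1 - k : ℕ) : ℝ) := by
      exact_mod_cast (by omega : n ≤ 2 * (n + 1 - k))
    gcongr
    linarith
  · exact_mod_cast Nat.descFactorial_le_pow n k

namespace SparseData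

variable {δ : ℕ → ℝ} {m : ℕ → ℕ} {χ : ℕ → ℝ} {V : Type*} [Fintype V]

/-- The order of magnitude of the expected number of copies. -/
theorem exists_expectedCopies_bounds (h : SparseData δ m χ) (harc : CentralArcDominates δ m χ)
    (T : SimpleGraph V) [DecidableRel T.Adj] (hμ : ∀ v, ∃ d, T.degree v ≤ d ∧ 0 < δ d)
    (hV : 0 < Fintype.card V) :
    ∃ c > 0, ∃ C > 0, ∀ᶠ n in atTop, 0 < totalWeight δ n (m n) ∧
      c * ((n : ℝ) ^ Fintype.card V / (m n : ℝ) ^ T.edgeFinset.card * χ n ^ gammaTree δ T) ≤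
        expectedCopies δ n (m n) T ∧
      expectedCopies δ n (m n) T ≤
        C * ((n : ℝ) ^ Fintype.card V / (m n : ℝ) ^ T.edgeFinset.card * χ n ^ gammaTree δ T) := by
  classical
  have hE : Fintype.card T.edgeSet = T.edgeFinset.card := by
    rw [SimpleGraph.edgeFinset, Set.toFinset_card]
  set e := T.edgeFinset.card with he
  set k := Fintype.card V with hk
  obtain ⟨c, hc, C, hC, hratio⟩ := h.exists_ratio_bounds harc T hμ
    (T.sum_degrees_eq_twice_card_edges)
  rw [← he] at hratio
  -- For the one-vertex tree `e = 0`, and `0 ^ 0 = 1`.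
  have hke : 0 < ((k ^ k * e ^ e : ℕ) : ℝ) := by
    have : 0 < e ^ e := by
      rcases Nat.eq_zero_or_pos e with h0 | h0
      · simp [h0]
      · positivity
    exact_mod_cast Nat.mul_pos (pow_pos hV k) this
  refine ⟨c * (1 / 2) ^ k * (1 / 2) ^ e / 2 ^ (2 * e) / ((k ^ k * e ^ e : ℕ) : ℝ), by positivity,
    C * 2 ^ e, by positivity, ?_⟩
  filter_upwards [hratio, h.basic, h.tendsto_m.eventually_ge_atTop (2 * e),
    eventually_ge_atTop (2 * k)] with n ⟨hD, hlo, hhi⟩ ⟨hn, hm, hχ, _⟩ hme hnk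
  have hm' : (0 : ℝ) < m n := by exact_mod_cast hm
  have hn' : (0 : ℝ) < n := by exact_mod_cast hn
  obtain ⟨f1, f2⟩ := factorial_ratio hme
  obtain ⟨d1, d2⟩ := descFactorial_bounds hnk
  obtain ⟨d3, d4⟩ := descFactorial_bounds hme
  have hup := sum_weight_mul_copies_le (n := n) (m := m n) h.nonneg T
  have hdown := le_sum_weight_mul_copies (n := n) (m := m n) h.nonneg T
  have htot := totalWeight_eq δ n (m n)
  rw [hE, copyWeight] at hup hdown
  rw [← hk] at hup hdown hlo hhi
  set D := PowerSeries.coeff (2 * m n) (egf δ 0 ^ n) with hDdef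
  set B := PowerSeries.coeff (2 * (m n - e)) (egf δ 0 ^ (n - k) * ∏ u, egf δ (T.degree u)) with hB
  set F := ((2 * (m n - e))! : ℝ) with hF
  set W := ∑ G : Multigraph n (m n), G.weight δ * (G.copies T : ℝ) with hW
  have hF0 : 0 < F := by positivity
  have hW0 : 0 < totalWeight δ n (m n) := by rw [htot]; positivity
  have hB0 : 0 ≤ B := le_trans (by positivity) hlo
  set Y := χ n ^ gammaTree δ T with hY
  have hY0 : 0 < Y := pow_pos hχ _
  refine ⟨hW0, ?_, ?_⟩
  · rw [expectedCopies_eq, ← hW, le_div_iff₀ hW0, htot]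
    refine le_of_mul_le_mul_left ?_ hke
    refine le_trans ?_ hdown
    push_cast
    calc (k : ℝ) ^ k * (e : ℝ) ^ e * (c * (1 / 2) ^ k * (1 / 2) ^ e / 2 ^ (2 * e) /
          ((k : ℝ) ^ k * (e : ℝ) ^ e) * ((n : ℝ) ^ k / (m n : ℝ) ^ e * Y) *
            (((2 * m n)! : ℝ) * D))
        ≤ (k : ℝ) ^ k * (e : ℝ) ^ e * (c * (1 / 2) ^ k * (1 / 2) ^ e / 2 ^ (2 * e) /
          ((k : ℝ) ^ k * (e : ℝ) ^ e) * ((n : ℝ) ^ k / (m n : ℝ) ^ e * Y) *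
            (((2 * m n : ℝ) ^ (2 * e) * F) * D)) := by gcongr
      _ = ((n : ℝ) / 2) ^ k * ((m n : ℝ) / 2) ^ e * (F * (c * Y * D)) := by
          push_cast at hke
          have h1 := hke.ne'
          rw [mul_pow (2 : ℝ), div_pow, div_pow, div_pow, div_pow, one_pow, one_pow, pow_mul (m n : ℝ), sq,
            mul_pow]
          field_simp
      _ ≤ (n.descFactorial k : ℝ) * ((m n).descFactorial e : ℝ) * (F * B) := by
          gcongr
  · rw [expectedCopies_eq, ← hW, div_le_iff₀ hW0, htot]
    refine hup.trans ?_
    push_cast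
    calc (n.descFactorial k : ℝ) * (((m n).descFactorial e : ℝ) * 2 ^ e) * (F * B)
        ≤ (n : ℝ) ^ k * ((m n : ℝ) ^ e * 2 ^ e) * (F * (C * Y * D)) := by gcongr
      _ = C * 2 ^ e * ((n : ℝ) ^ k / (m n : ℝ) ^ e * Y) * (((m n : ℝ) ^ (2 * e) * F) * D) := by
          rw [mul_comm 2 e, pow_mul, sq, div_mul_eq_mul_div]
          field_simp
      _ ≤ _ := by gcongr

end SparseData

/-! ### First moment bound for the absence of copies -/

section Probability

variable {V : Type*} {δ : ℕ → ℝ} {n m : ℕ}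

/-- Markov's inequality for the integer-valued number of copies. -/
lemma one_sub_probNoCopy_le (hδ : ∀ d, 0 ≤ δ d) (hW : 0 < totalWeight δ n m) (T : SimpleGraph V) :
    1 - expectedCopies δ n m T ≤ probNoCopy δ n m T ∧ probNoCopy δ n m T ≤ 1 := by
  classical
  have hp : ∀ G : Multigraph n m, 0 ≤ prob δ G := fun G => div_nonneg (weight_nonneg hδ G) hW.le
  have h1 : ∑ G : Multigraph n m, prob δ G = 1 := by
    unfold prob
    rw [← Finset.sum_div, ← totalWeight, div_self hW.ne']
  have hsplit := Finset.sum_filter_add_sum_filter_not (Finset.univ : Finset (Multigraph n m))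
    (fun G => G.copies T = 0) (fun G => prob δ G)
  rw [h1] at hsplit
  have e : probNoCopy δ n m T =
      ∑ G ∈ (Finset.univ : Finset (Multigraph n m)).filter (fun G => G.copies T = 0), prob δ G := by
    unfold probNoCopy
    congr
  have h2 : ∑ G ∈ (Finset.univ : Finset (Multigraph n m)).filter (fun G => ¬ G.copies T = 0),
      prob δ G ≤ expectedCopies δ n m T := by
    refine le_trans (Finset.sum_le_sum (g := fun G => prob δ G * (G.copies T : ℝ))
      fun G hG => ?_) (Finset.sum_le_sum_of_subset_of_nonneg (Finset.filter_subset _ _)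
        fun G _ _ => mul_nonneg (hp G) (Nat.cast_nonneg _))
    refine le_mul_of_one_le_right (hp G) ?_
    exact_mod_cast Nat.one_le_iff_ne_zero.2 (Finset.mem_filter.1 hG).2
  have h3 := Finset.sum_nonneg (s := (Finset.univ : Finset (Multigraph n m)).filter
    (fun G => ¬ G.copies T = 0)) fun G _ => hp G
  rw [e]
  constructor <;> linarith

end Probability

/-- Comparison of powers of comparable quantities, with a real exponent. -/
lemma rpow_bounds {a x y c C : ℝ} (ha : 0 ≤ a) (hc : 0 < c) (hC : 0 < C) (hx : 0 < x)
    (h1 : c * x ≤ y) (h2 : y ≤ C * x) :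
    c ^ a * x ^ a ≤ y ^ a ∧ y ^ a ≤ C ^ a * x ^ a := by
  have hy : 0 < y := lt_of_lt_of_le (by positivity) h1
  rw [← Real.mul_rpow hc.le hx.le, ← Real.mul_rpow hC.le hx.le]
  exact ⟨Real.rpow_le_rpow (by positivity) h1 ha, Real.rpow_le_rpow hy.le h2 ha⟩

/-- A tree with at least two vertices has no isolated vertex. This makes the exponent of `ε`
positive and the denominator of `λ` negative. -/
lemma card_mul_mu_le_gammaTree {V : Type*} [Fintype V] {T : SimpleGraph V} [DecidableRel T.Adj]
    (hT : T.IsTree) {δ : ℕ → ℝ} (hμ : ∀ v, ∃ d, T.degree v ≤ d ∧ 0 < δ d)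
    (hV : 2 ≤ Fintype.card V) : Fintype.card V * mu δ 1 ≤ gammaTree δ T := by
  have : Nontrivial V := Fintype.one_lt_card_iff_nontrivial.1 hV
  rw [gammaTree, ← smul_eq_mul, ← Finset.card_univ, ← Finset.sum_const]
  refine Finset.sum_le_sum fun v _ => Nat.sInf_le ?_
  obtain ⟨h1, h2⟩ := mu_spec (hμ v)
  exact ⟨(hT.connected.preconnected.degree_pos_of_nontrivial v).trans_le h1, h2⟩

end DegreeWeighted

/-! ### Translation into powers of `ε` and conclusion -/

theorem mainTheorem11 {V : Type*} [Fintype V] (T : SimpleGraph V) [DecidableRel T.Adj]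
    (hT : T.IsTree)
    (δ : ℕ → ℝ) (hδ : ∀ d, 0 ≤ δ d)
    (hrad : ∃ r : ℝ, 0 < r ∧ Summable fun d : ℕ => δ d * r ^ d / (d ! : ℝ))
    (hμ : ∀ v, ∃ d, T.degree v ≤ d ∧ 0 < δ d)
    (m : ℕ → ℕ) (hm : Tendsto m atTop atTop)
    (ε : ℕ → ℝ) (hε : Tendsto ε atTop (𝓝[>] 0))
    (hmε : (fun n => (m n : ℝ)) =Θ[atTop] fun n => (n : ℝ) * ε n)
    (χ : ℕ → ℝ) (hχ : ∀ᶠ n in atTop, DegreeWeighted.IsSaddlePoint δ n (m n) (χ n))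
    (harc : DegreeWeighted.CentralArcDominates δ m χ) :
    ((fun n => DegreeWeighted.expectedCopies δ n (m n) T) =Θ[atTop] fun n =>
      (n : ℝ) * ε n ^ (-((Fintype.card V : ℝ) - 1) +
        (DegreeWeighted.gammaTree δ T : ℝ) / (DegreeWeighted.mu δ 1 : ℝ))) ∧
    (2 ≤ Fintype.card V →
      (ε =o[atTop] fun n => (n : ℝ) ^ ((DegreeWeighted.mu δ 1 : ℝ) /
        (((Fintype.card V : ℝ) - 1) * (DegreeWeighted.mu δ 1 : ℝ) -
          (DegreeWeighted.gammaTree δ T : ℝ)))) →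
      Tendsto (fun n => DegreeWeighted.probNoCopy δ n (m n) T) atTop (𝓝 1)) := by
  have hε0 : Tendsto ε atTop (𝓝 0) := hε.mono_right nhdsWithin_le_nhds
  have hεpos : ∀ᶠ n in atTop, 0 < ε n := hε.eventually self_mem_nhdsWithin
  obtain ⟨A₁, hA₁, hm1⟩ := hmε.1.exists_pos
  obtain ⟨A₂, hA₂, hm2⟩ := hmε.2.exists_pos
  have hmn : ∀ᶠ n in atTop, 1 / A₂ * ε n ≤ (m n : ℝ) / n ∧ (m n : ℝ) / n ≤ A₁ * ε n := by
    filter_upwards [hm1.bound, hm2.bound, hεpos, eventually_gt_atTop 0] with n h1 h2 h3 hn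
    have hn' : (0 : ℝ) < n := by exact_mod_cast hn
    rw [Real.norm_of_nonneg (Nat.cast_nonneg _), Real.norm_of_nonneg (by positivity)] at h1 h2
    constructor
    · rw [le_div_iff₀ hn', one_div, mul_assoc, inv_mul_le_iff₀ hA₂]
      linarith
    · rw [div_le_iff₀ hn']
      linarith
  have hdiv : Tendsto (fun n => (m n : ℝ) / n) atTop (𝓝 0) := by
    have hlim := hε0.const_mul A₁
    rw [mul_zero] at hlim
    exact squeeze_zero' (Eventually.of_forall fun n => by positivity)
      (hmn.mono fun n h => h.2) hlim
  have hdata : DegreeWeighted.SparseData δ m χ := ⟨hδ, hrad, hm, hdiv, hχ⟩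
  obtain ⟨hd1, -, -⟩ := hdata.mu_one_spec
  obtain ⟨B₁, hB₁, hχ1⟩ := hdata.exists_le_pow
  obtain ⟨B₂, hB₂, hχ2⟩ := hdata.exists_pow_le
  have hne : Nonempty V := hT.connected.nonempty
  obtain ⟨c, hc, C, hC, hexp⟩ := hdata.exists_expectedCopies_bounds harc T hμ Fintype.card_pos
  have hcard := hT.card_edgeFinset
  set k := Fintype.card V with hk
  set e := T.edgeFinset.card with he
  set d := DegreeWeighted.mu δ 1 with hd
  set γ := DegreeWeighted.gammaTree δ T with hγ
  have hke : (k : ℝ) - 1 = e := by rw [← hcard]; push_cast; ring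
  have hd0 : (0 : ℝ) < d := by exact_mod_cast hd1
  set p : ℝ := -((k : ℝ) - 1) + (γ : ℝ) / d with hp
  have ha : (0 : ℝ) ≤ (γ : ℝ) / d := by positivity
  set a : ℝ := (γ : ℝ) / d with hadef
  -- the order of magnitude in terms of `n` and `ε n`
  have hmain : ∃ c' > 0, ∃ C' > 0, ∀ᶠ n : ℕ in atTop,
      c' * ((n : ℝ) * ε n ^ p) ≤ DegreeWeighted.expectedCopies δ n (m n) T ∧
      DegreeWeighted.expectedCopies δ n (m n) T ≤ C' * ((n : ℝ) * ε n ^ p) := by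
    refine ⟨c * ((1 / A₁ ^ e) * (B₁ * (1 / A₂)) ^ a), by positivity,
      C * (A₂ ^ e * (B₂ * A₁) ^ a), by positivity, ?_⟩
    filter_upwards [hexp, hmn, hχ1, hχ2, hεpos, hdata.basic] with
      n ⟨_, hlo, hhi⟩ ⟨h1, h2⟩ h3 h4 hε1 ⟨hn, hm0, hχ0, _⟩
    have hn' : (0 : ℝ) < n := by exact_mod_cast hn
    have hm' : (0 : ℝ) < m n := by exact_mod_cast hm0
    have hχd1 : B₁ * (1 / A₂) * ε n ≤ χ n ^ d := by
      refine le_trans ?_ h3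
      rw [mul_assoc]
      gcongr
    have hχd2 : χ n ^ d ≤ B₂ * A₁ * ε n := by
      refine h4.trans ?_
      rw [mul_assoc]
      gcongr
    obtain ⟨r1, r2⟩ := DegreeWeighted.rpow_bounds ha (by positivity) (by positivity) hε1 hχd1 hχd2
    -- Only `χ^d` is comparable to `ε`, so `χ^γ` is recovered through the real exponent `γ/d`.
    have hχγ : (χ n ^ d) ^ a = χ n ^ γ := by
      rw [← Real.rpow_natCast (χ n) d, ← Real.rpow_mul hχ0.le, hadef, mul_div_cancel₀ _ hd0.ne',
        Real.rpow_natCast]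
    rw [hχγ] at r1 r2
    have hεp : ε n ^ p = 1 / ε n ^ e * ε n ^ a := by
      rw [hp, Real.rpow_add hε1, hke, Real.rpow_neg hε1.le, Real.rpow_natCast, one_div]
    -- For a tree `k = e + 1`, which leaves exactly one factor `n`.
    have hnm : (n : ℝ) ^ k / (m n : ℝ) ^ e = n * (1 / ((m n : ℝ) / n) ^ e) := by
      rw [← hcard, pow_succ, div_pow]
      field_simp
    have q1 : 1 / A₁ ^ e * (1 / ε n ^ e) ≤ 1 / ((m n : ℝ) / n) ^ e := by
      rw [div_mul_div_comm, one_mul, ← mul_pow]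
      exact one_div_le_one_div_of_le (by positivity) (pow_le_pow_left₀ (by positivity) h2 e)
    have q2 : 1 / ((m n : ℝ) / n) ^ e ≤ A₂ ^ e * (1 / ε n ^ e) := by
      have := one_div_le_one_div_of_le (by positivity) (pow_le_pow_left₀ (by positivity) h1 e)
      refine this.trans (le_of_eq ?_)
      rw [mul_pow, div_pow, one_pow]
      field_simp
    rw [hnm] at hlo hhi
    have hεe : 0 < ε n ^ e := pow_pos hε1 e
    have hεa : 0 < ε n ^ a := Real.rpow_pos_of_pos hε1 a
    have hχg : 0 < χ n ^ γ := pow_pos hχ0 γ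
    rw [hεp]
    constructor
    · refine le_trans ?_ hlo
      calc c * (1 / A₁ ^ e * (B₁ * (1 / A₂)) ^ a) * (n * (1 / ε n ^ e * ε n ^ a))
          = c * (n * (1 / A₁ ^ e * (1 / ε n ^ e)) * ((B₁ * (1 / A₂)) ^ a * ε n ^ a)) := by ring
        _ ≤ _ := by gcongr
    · refine hhi.trans ?_
      calc C * (n * (1 / ((m n : ℝ) / n) ^ e) * χ n ^ γ)
          ≤ C * (n * (A₂ ^ e * (1 / ε n ^ e)) * ((B₂ * A₁) ^ a * ε n ^ a)) := by gcongr
        _ = _ := by ring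
  obtain ⟨c', hc', C', hC', hmain⟩ := hmain
  have hpos : ∀ᶠ n : ℕ in atTop, 0 < (n : ℝ) * ε n ^ p := by
    filter_upwards [hεpos, eventually_gt_atTop 0] with n h1 hn
    have hn' : (0 : ℝ) < n := by exact_mod_cast hn
    have := Real.rpow_pos_of_pos h1 p
    positivity
  refine ⟨⟨IsBigO.of_bound C' ?_, IsBigO.of_bound (1 / c') ?_⟩, fun hk2 ho => ?_⟩
  · filter_upwards [hmain, hpos] with n ⟨h1, h2⟩ h3
    rw [Real.norm_of_nonneg (le_trans (by positivity) h1), Real.norm_of_nonneg h3.le]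
    exact h2
  · filter_upwards [hmain, hpos] with n ⟨h1, h2⟩ h3
    rw [Real.norm_of_nonneg (le_trans (by positivity) h1), Real.norm_of_nonneg h3.le, one_div,
      le_inv_mul_iff₀ hc']
    exact h1
  · have hγk := DegreeWeighted.card_mul_mu_le_gammaTree hT hμ hk2
    rw [← hk, ← hd, ← hγ] at hγk
    have hγk' : (k : ℝ) * d ≤ γ := by exact_mod_cast hγk
    have hden : ((k : ℝ) - 1) * d - γ < 0 := by linarith
    have hp0 : 0 < p := by
      have : (k : ℝ) ≤ γ / d := by rw [le_div_iff₀ hd0]; exact hγk'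
      linarith
    set lam : ℝ := (d : ℝ) / (((k : ℝ) - 1) * d - γ) with hlam
    -- The threshold exponent is `-1/p`, so `(ε / n^λ)^p = n ε^p`, the order of the expectation; it
    -- tends to zero since `p > 0`.
    have hlp : lam * p = -1 := by
      rw [hlam, hp, hadef, div_mul_eq_mul_div, div_eq_iff hden.ne]
      field_simp
      ring
    have hq := ho.tendsto_div_nhds_zero
    have hlim : Tendsto (fun n => C' * (ε n / (n : ℝ) ^ lam) ^ p) atTop (𝓝 (C' * 0 ^ p)) :=
      (hq.rpow_const (Or.inr hp0.le)).const_mul C'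
    rw [Real.zero_rpow hp0.ne', mul_zero] at hlim
    have hlim2 := hlim.const_sub 1
    rw [sub_zero] at hlim2
    refine tendsto_of_tendsto_of_tendsto_of_le_of_le' hlim2 tendsto_const_nhds ?_ ?_
    · filter_upwards [hexp, hmain, hεpos, eventually_gt_atTop 0] with n ⟨hW, _⟩ ⟨_, h2⟩ h3 hn
      have hn' : (0 : ℝ) < n := by exact_mod_cast hn
      have e1 : (ε n / (n : ℝ) ^ lam) ^ p = n * ε n ^ p := by
        rw [Real.div_rpow h3.le (by positivity), ← Real.rpow_mul hn'.le, hlp, Real.rpow_neg_one]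
        field_simp
      rw [e1]
      linarith [(DegreeWeighted.one_sub_probNoCopy_le hδ hW T).1]
    · filter_upwards [hexp] with n ⟨hW, _⟩
      exact (DegreeWeighted.one_sub_probNoCopy_le hδ hW T).2
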